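/- **Setting.** Let $\alpha,\beta,\gamma:(0,\infty)\to\mathbb R$ and $\partial_r\psi:\mathbb R\times(0,\infty)\to\mathbb R$ be given, and consider the force function $$\partial_r\Phi(r,\xi)=\alpha(\xi)\,r+\beta(\xi)\,r^2+\partial_r\psi(r,\xi).$$ Assume the following. * $\alpha,\beta\ge 0$ are piecewise continuous on $(0,\infty)$ (finitely many discontinuities in each compact subinterval, finite one-sided limits). * The integrals $\int_0^\infty\alpha\,\xi^j\,d\xi$ ($j=2,4,6$) and $\int_0^\infty\beta\,\xi^j\,d\xi$ ($j=\tfrac52,3,5$) are finite and positive, and $\int_0^\infty\gamma\,\xi^3\,d\xi$, $\int_0^\infty\gamma\,\xi^4\,d\xi$ are finite. * For each $\xi>0$ the function $\partial_r\psi(\cdot,\xi)$ is $C^1$ with $\partial_r\psi(0,\xi)=0$; for each $r$ the function $\partial_r\psi(r,\cdot)$ is continuous on $(0,\infty)$. * There is a constant $\rho>0$ such that for all $\xi>0$ $$|\partial_r^2\psi(r,\xi)|\le\gamma(\xi)\,r^2\qquad\text{whenever }|r|\le\max\{1,\rho\sqrt{\xi}\}.$$ Let $\mathsf L^2=\mathsf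 L^2(\mathbb R)$ be the real space with norm $\|\cdot\|_2$, let $\mathsf L^2_{\rm even}$ be its subspace of even functions, and put $$(\mathcal A_\eta W)(x)=\frac1\eta\int_{x-\eta/2}^{x+\eta/2}W(y)\,dy,\qquad W_0(x)=\frac{3d_1}{2d_2}\,\mathrm{sech}^2\!\Big(\tfrac12\sqrt{d_1}\,x\Big),$$ $$d_1=\frac{12}{\int_0^\infty\alpha\,\xi^4\,d\xi},\qquad d_2=\frac{12\int_0^\infty\beta\,\xi^3\,d\xi}{\int_0^\infty\alpha\,\xi^4\,d\xi}.$$ For $\varepsilon>0$ define, through Bochner integrals in $\mathsf L^2$, $$\mathcal B_\varepsilon W=W+\int_0^\infty\alpha\,\xi^2\,\frac{W-\mathcal A_{\varepsilon\xi}^2W}{\varepsilon^2}\,d\xi,\qquad \mathcal Q_\varepsilon[W]=\int_0^\infty\beta\,\xi^3\,\mathcal A_{\varepsilon\xi}(\mathcal A_{\varepsilon\xi}W)^2\,d\xi,$$ $$\mathcal P_\varepsilon[W]=\frac1{\varepsilon^6}\int_0^\infty\xi\,\mathcal A_{\varepsilon\xi}\,\partial_r\psi\big(\varepsilon^2\xi\,\mathcal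 A_{\varepsilon\xi}W,\xi\big)\,d\xi,\qquad \mathcal M_\varepsilon V=2\int_0^\infty\beta\,\xi^3\,\mathcal A_{\varepsilon\xi}\big((\mathcal A_{\varepsilon\xi}W_0)(\mathcal A_{\varepsilon\xi}V)\big)\,d\xi,$$ and $\mathcal L_\varepsilon=\mathcal B_\varepsilon-\mathcal M_\varepsilon$, $$K_\varepsilon=\frac{\mathcal Q_\varepsilon[W_0]-\mathcal B_\varepsilon W_0}{\varepsilon^2},\qquad E_\varepsilon=\mathcal P_\varepsilon[W_0],\qquad \mathcal N_\varepsilon[V]=\frac{\mathcal P_\varepsilon[W_0+\varepsilon^2V]-\mathcal P_\varepsilon[W_0]}{\varepsilon^2},$$ $$\mathcal F_\varepsilon[V]=\mathcal L_\varepsilon^{-1}\big(K_\varepsilon+E_\varepsilon+\varepsilon^2\mathcal Q_\varepsilon[V]+\varepsilon^2\mathcal N_\varepsilon[V]\big),$$ where $\mathcal L_\varepsilon^{-1}$ denotes the inverse of $\mathcal L_\varepsilon$ on $\mathsf L^2_{\rm even}$. **Theorem.** There exist $\varepsilon_*\in(0,1]$ and a constant $D>0$ (independent of $\varepsilon$)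 such that for every $0<\varepsilon\le\varepsilon_*$, with $B_D=\{V\in\mathsf L^2_{\rm even}:\|V\|_2\le D\}$: 1. $\mathcal F_\varepsilon$ is well defined on $B_D$. That is, the integrals defining $\mathcal B_\varepsilon V,\mathcal M_\varepsilon V,\mathcal Q_\varepsilon[V]$ for $V\in\mathsf L^2$, as well as $\mathcal P_\varepsilon[W_0]$ and $\mathcal P_\varepsilon[W_0+\varepsilon^2V]$ for $V\in B_D$, exist as Bochner integrals in $\mathsf L^2$; $\mathcal L_\varepsilon$ is a bijection of $\mathsf L^2_{\rm even}$ onto itself; and $K_\varepsilon+E_\varepsilon+\varepsilon^2\mathcal Q_\varepsilon[V]+\varepsilon^2\mathcal N_\varepsilon[V]\in\mathsf L^2_{\rm even}$ for all $V\in B_D$. 2. $\mathcal F_\varepsilon$ has exactly one fixed point $V_\varepsilon$ in $B_D$. -/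

import Mathlib

open MeasureTheory Set Filter Topology

noncomputable section

namespace Peridynamics

/-- The real Hilbert space `L²(ℝ)` (Lebesgue measure). -/
abbrev L2 : Type := Lp ℝ 2 (volume : Measure ℝ)

/-- The subspace of even functions in `L²(ℝ)`. -/
def L2even : Set L2 := {V | ∀ᵐ x : ℝ, V (-x) = V x}

/-- The set `B_D` of all even `V` with `‖V‖₂ ≤ D`. -/
def evenBall (D : ℝ) : Set L2 := {V | V ∈ L2even ∧ ‖V‖ ≤ D}

/-- Piecewise continuity on `(0,∞)`: only finitely many discontinuities in each compact
subinterval, and finite one-sided limits everywhere. -/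
def PiecewiseContinuousPos (f : ℝ → ℝ) : Prop :=
  (∀ a b : ℝ, 0 < a → a < b → {ξ ∈ Icc a b | ¬ ContinuousAt f ξ}.Finite) ∧
  ∀ ξ : ℝ, 0 < ξ →
    (∃ l, Tendsto f (𝓝[<] ξ) (𝓝 l)) ∧ (∃ l, Tendsto f (𝓝[>] ξ) (𝓝 l))

/-- The constitutive data of a medium with force function
`∂ᵣΦ(r,ξ) = α(ξ) r + β(ξ) r² + ∂ᵣψ(r,ξ)`; the field `dψ` is `∂ᵣψ`, as a function of `r`
and `ξ`, and `γ` is the weight in the bound on `∂ᵣ²ψ`. Only bond variables `ξ > 0` matter. -/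
structure Medium where
  α : ℝ → ℝ
  β : ℝ → ℝ
  γ : ℝ → ℝ
  dψ : ℝ → ℝ → ℝ

/-- The assumptions on the force function. -/
structure Medium.Admissible (M : Medium) : Prop where
  α_nonneg : ∀ ξ, 0 < ξ → 0 ≤ M.α ξ
  β_nonneg : ∀ ξ, 0 < ξ → 0 ≤ M.β ξ
  α_piecewise : PiecewiseContinuousPos M.α
  β_piecewise : PiecewiseContinuousPos M.β
  dψ_contDiff : ∀ ξ, 0 < ξ → ContDiff ℝ 1 (fun r => M.dψ r ξ)
  dψ_continuous : ∀ r, ContinuousOn (fun ξ => M.dψ r ξ) (Ioi 0)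
  dψ_zero : ∀ ξ, 0 < ξ → M.dψ 0 ξ = 0
  dψ_bound : ∀ ξ, 0 < ξ → ∀ r, |r| ≤ 1 → |deriv (fun s => M.dψ s ξ) r| ≤ M.γ ξ * r ^ 2
  α_two : IntegrableOn (fun ξ => M.α ξ * ξ ^ 2) (Ioi 0)
  α_four : IntegrableOn (fun ξ => M.α ξ * ξ ^ 4) (Ioi 0)
  α_six : IntegrableOn (fun ξ => M.α ξ * ξ ^ 6) (Ioi 0)
  α_two_pos : 0 < ∫ ξ in Ioi 0, M.α ξ * ξ ^ 2
  α_four_pos : 0 < ∫ ξ in Ioi 0, M.α ξ * ξ ^ 4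
  α_six_pos : 0 < ∫ ξ in Ioi 0, M.α ξ * ξ ^ 6
  β_three : IntegrableOn (fun ξ => M.β ξ * ξ ^ 3) (Ioi 0)
  β_fiveHalves : IntegrableOn (fun ξ => M.β ξ * ξ ^ (5 / 2 : ℝ)) (Ioi 0)
  β_five : IntegrableOn (fun ξ => M.β ξ * ξ ^ 5) (Ioi 0)
  β_three_pos : 0 < ∫ ξ in Ioi 0, M.β ξ * ξ ^ 3
  β_fiveHalves_pos : 0 < ∫ ξ in Ioi 0, M.β ξ * ξ ^ (5 / 2 : ℝ)
  β_five_pos : 0 < ∫ ξ in Ioi 0, M.β ξ * ξ ^ 5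
  γ_three : IntegrableOn (fun ξ => M.γ ξ * ξ ^ 3) (Ioi 0)
  γ_four : IntegrableOn (fun ξ => M.γ ξ * ξ ^ 4) (Ioi 0)

/-- The bound on `∂ᵣ²ψ` also holds on the range `|r| ≤ ρ √ξ`. -/
def Medium.BoundUpTo (M : Medium) (ρ : ℝ) : Prop :=
  ∀ ξ, 0 < ξ → ∀ r, |r| ≤ ρ * Real.sqrt ξ →
    |deriv (fun s => M.dψ s ξ) r| ≤ M.γ ξ * r ^ 2

/-- `(A_η W)(x) = (1/η) ∫_{x-η/2}^{x+η/2} W(y) dy`. -/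
def avg (η : ℝ) (W : ℝ → ℝ) (x : ℝ) : ℝ :=
  (1 / η) * ∫ y in (x - η / 2)..(x + η / 2), W y

open Classical in
/-- The class in `L²(ℝ)` of a square-integrable function (and `0` otherwise). -/
def toL2 (f : ℝ → ℝ) : L2 := if h : MemLp f 2 (volume : Measure ℝ) then h.toLp f else 0

/-- The Bochner integral `∫₀^∞ f(ξ) dξ` in `L²(ℝ)` of a family `f(ξ) : ℝ → ℝ`, `ξ > 0`. -/
def bochner (f : ℝ → ℝ → ℝ) : L2 := ∫ ξ in Ioi (0 : ℝ), toL2 (f ξ)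

/-- The family `f` consists of `L²`-functions and is Bochner integrable, so that `bochner f`
is a genuine Bochner integral. -/
def BochnerWellDefined (f : ℝ → ℝ → ℝ) : Prop :=
  (∀ ξ, 0 < ξ → MemLp (f ξ) 2 (volume : Measure ℝ)) ∧
    IntegrableOn (fun ξ => toL2 (f ξ)) (Ioi 0)

namespace Medium

variable (M : Medium)

def d₁ : ℝ := 12 / ∫ ξ in Ioi 0, M.α ξ * ξ ^ 4

def d₂ : ℝ := (12 * ∫ ξ in Ioi 0, M.β ξ * ξ ^ 3) / ∫ ξ in Ioi 0, M.α ξ * ξ ^ 4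

/-- The Korteweg-de Vries wave `W₀(x) = (3 d₁ / (2 d₂)) sech²(√d₁ x / 2)`. -/
def kdvWave (x : ℝ) : ℝ :=
  3 * M.d₁ / (2 * M.d₂) * (1 / Real.cosh (1 / 2 * Real.sqrt M.d₁ * x)) ^ 2

/-- `W₀` as an element of `L²(ℝ)`. -/
def W₀ : L2 := toL2 M.kdvWave

/-- The integrand of `B_ε`. -/
def integrandB (ε : ℝ) (W : L2) (ξ x : ℝ) : ℝ :=
  M.α ξ * ξ ^ 2 * ((W x - avg (ε * ξ) (avg (ε * ξ) W) x) / ε ^ 2)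

/-- The integrand of `Q_ε`. -/
def integrandQ (ε : ℝ) (W : L2) (ξ x : ℝ) : ℝ :=
  M.β ξ * ξ ^ 3 * avg (ε * ξ) (fun y => (avg (ε * ξ) W y) ^ 2) x

/-- The integrand of `P_ε`. -/
def integrandP (ε : ℝ) (W : L2) (ξ x : ℝ) : ℝ :=
  ξ * avg (ε * ξ) (fun y => M.dψ (ε ^ 2 * ξ * avg (ε * ξ) W y) ξ) x

/-- The integrand of `M_ε`, without the factor `2`. -/
def integrandM (ε : ℝ) (V : L2) (ξ x : ℝ) : ℝ :=
  M.β ξ * ξ ^ 3 * avg (ε * ξ) (fun y => avg (ε * ξ) M.W₀ y * avg (ε * ξ) V y) x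

/-- `B_ε W = W + ∫₀^∞ α(ξ) ξ² (W - A_{εξ}² W) / ε² dξ`. -/
def opB (ε : ℝ) (W : L2) : L2 := W + bochner (M.integrandB ε W)

/-- `Q_ε[W] = ∫₀^∞ β(ξ) ξ³ A_{εξ} (A_{εξ} W)² dξ`. -/
def opQ (ε : ℝ) (W : L2) : L2 := bochner (M.integrandQ ε W)

/-- `P_ε[W] = ε⁻⁶ ∫₀^∞ ξ A_{εξ} ∂ᵣψ(ε² ξ A_{εξ} W, ξ) dξ`. -/
def opP (ε : ℝ) (W : L2) : L2 := (1 / ε ^ 6) • bochner (M.integrandP ε W)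

/-- `M_ε V = 2 ∫₀^∞ β(ξ) ξ³ A_{εξ} ((A_{εξ} W₀) (A_{εξ} V)) dξ`. -/
def opM (ε : ℝ) (V : L2) : L2 := (2 : ℝ) • bochner (M.integrandM ε V)

/-- `L_ε = B_ε - M_ε`. -/
def opL (ε : ℝ) (V : L2) : L2 := M.opB ε V - M.opM ε V

/-- `K_ε = (Q_ε[W₀] - B_ε W₀) / ε²`. -/
def resK (ε : ℝ) : L2 := (1 / ε ^ 2) • (M.opQ ε M.W₀ - M.opB ε M.W₀)

/-- `E_ε = P_ε[W₀]`. -/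
def resE (ε : ℝ) : L2 := M.opP ε M.W₀

/-- `N_ε[V] = (P_ε[W₀ + ε² V] - P_ε[W₀]) / ε²`. -/
def opN (ε : ℝ) (V : L2) : L2 := (1 / ε ^ 2) • (M.opP ε (M.W₀ + ε ^ 2 • V) - M.opP ε M.W₀)

/-- `K_ε + E_ε + ε² Q_ε[V] + ε² N_ε[V]`. -/
def source (ε : ℝ) (V : L2) : L2 :=
  M.resK ε + M.resE ε + ε ^ 2 • M.opQ ε V + ε ^ 2 • M.opN ε V

/-- `F_ε[V] = L_ε⁻¹ (K_ε + E_ε + ε² Q_ε[V] + ε² N_ε[V])`, where `L_ε⁻¹` is the inverse of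
`L_ε` on the space of even functions. -/
def opF (ε : ℝ) (V : L2) : L2 := Function.invFunOn (M.opL ε) L2even (M.source ε V)

end Medium

/-- The Korteweg-de Vries wave is square-integrable, so `W₀` is its class in `L²(ℝ)`. -/
theorem memLp_kdvWave (M : Medium) (hM : M.Admissible) :
    MemLp M.kdvWave 2 (volume : Measure ℝ) := by
  have hd : 0 < M.d₁ := div_pos (by norm_num) hM.α_four_pos
  set c : ℝ := 1 / 2 * Real.sqrt M.d₁ with hc
  have hc0 : c ≠ 0 := by
    have := Real.sqrt_pos.2 hd
    positivity
  have hcont : Continuous M.kdvWave := by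
    unfold Medium.kdvWave
    have : ∀ x : ℝ, Real.cosh (1 / 2 * Real.sqrt M.d₁ * x) ≠ 0 := fun x => (Real.cosh_pos _).ne'
    fun_prop (disch := exact this _)
  rw [memLp_two_iff_integrable_sq hcont.aestronglyMeasurable]
  set K : ℝ := 3 * M.d₁ / (2 * M.d₂) with hK
  have hint : Integrable (fun x : ℝ => K ^ 2 * (1 + (c * x) ^ 2)⁻¹) :=
    (integrable_inv_one_add_sq.comp_mul_left' hc0).const_mul _
  refine hint.mono' (hcont.pow 2).aestronglyMeasurable (ae_of_all _ fun x => ?_)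
  have h1 : 1 + (c * x) ^ 2 ≤ Real.cosh (c * x) ^ 2 := by
    rw [Real.cosh_sq]
    have : |c * x| ≤ |Real.sinh (c * x)| := by
      rw [Real.abs_sinh]
      exact Real.self_le_sinh_iff.2 (abs_nonneg _)
    have := sq_le_sq.2 this
    linarith
  have h2 : (1 : ℝ) ≤ Real.cosh (c * x) ^ 2 := by nlinarith [sq_nonneg (c * x)]
  have h3 : M.kdvWave x ^ 2 = K ^ 2 * ((Real.cosh (c * x) ^ 2)⁻¹ * (Real.cosh (c * x) ^ 2)⁻¹) := by
    have h4 : M.kdvWave x = K * (1 / Real.cosh (c * x)) ^ 2 := rfl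
    rw [h4, one_div]
    ring
  rw [Real.norm_of_nonneg (sq_nonneg _), h3]
  gcongr
  calc (Real.cosh (c * x) ^ 2)⁻¹ * (Real.cosh (c * x) ^ 2)⁻¹
      ≤ (Real.cosh (c * x) ^ 2)⁻¹ * 1 := by gcongr; exact inv_le_one_of_one_le₀ h2
    _ ≤ (1 + (c * x) ^ 2)⁻¹ := by rw [mul_one]; gcongr

end Peridynamics

end

/-! The proof is a contraction argument whose core is a uniform lower bound: `‖V‖ ≤ C ‖L_ε V‖` for
even `V` and small `ε`, with `C` independent of `ε` (`exists_lower_bound`). Given this bound, `L_ε`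
is symmetric, preserves evenness and is bounded below, so it is a bijection of the even functions
(`bijOn_opL`). The terms `K_ε` and `E_ε` are bounded uniformly in `ε`, and the part of the source
that depends on `V` has a Lipschitz constant of order `ε` on a fixed ball. Hence `F_ε` is a
contraction of that ball for small `ε`.

The lower bound is proved by duality. As `ε → 0`, `L_ε` formally becomes the linearized KdV operator
`L₀ u = u - u''/d₁ - 3 sech²(√d₁ x/2) u`. Its decaying kernel is spanned by the odd function `W₀'`,
so on even data it can be inverted explicitly by variation of constants, with `H²` bounds
(`exists_linearized_solution`). For an even test function `φ = L₀ u` one has `⟨φ, V⟩ = ⟨u, L_ε V⟩ +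
⟨(L₀ - L_ε) u, V⟩`, and it remains to bound the last term by `ε ‖V‖ ‖φ‖` up to a constant.

The difficulty is that `u''` is only controlled in `L²`, so the convergence of `B_ε u` has no rate
by itself. The remedy is to use the regularity hidden in `V`. The identity `u - A_η² u = -(η²/12)
S_η u''`, with a symmetric averaging operator `S_η` (`smear_cub_eq`), lets `S_η` be moved onto `V`.
The error then involves `V - S_η V`, and `‖V - S_η V‖² ≤ 4 (‖V‖² - ‖A_η V‖²)`
(`norm_sub_smear_cub_sq_le`). The right-hand side, weighted by `α ξ²` and integrated in `ξ`, is `ε²`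
times the excess of the quadratic form of `B_ε` over `‖V‖²`. That excess is at most a multiple of
`‖V‖²` unless `‖L_ε V‖ > ‖V‖`, in which case there is nothing to prove (`abs_inner_opB_sub_le`).

The residual `K_ε` is bounded because `W₀'' = d₁ W₀ - d₂ W₀²` cancels the leading terms of `Q_ε[W₀]
- B_ε W₀`, while symmetric averaging leaves errors of order `ε²`. The nonlinear terms are controlled
by `‖A_η V‖_∞ ≤ η^(-1/2) ‖V‖` (`abs_avg_le`), which loses only `ε^(-1/2)` against the prefactor
`ε²`. -/

noncomputable section

namespace Peridynamics

/-! ### Square-integrable functions and their classes in `L²(ℝ)` -/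

section Basics

variable {f g : ℝ → ℝ}

theorem toL2_of_memLp (hf : MemLp f 2 (volume : Measure ℝ)) : toL2 f = hf.toLp f := by
  rw [toL2, dif_pos hf]

theorem coeFn_toL2 (hf : MemLp f 2 (volume : Measure ℝ)) : toL2 f =ᵐ[volume] f := by
  rw [toL2_of_memLp hf]; exact hf.coeFn_toLp

theorem toL2_coe (V : L2) : toL2 V = V := by
  rw [toL2_of_memLp (Lp.memLp V)]; exact Lp.toLp_coeFn V _

theorem toL2_congr (h : f =ᵐ[volume] g) : toL2 f = toL2 g := by
  by_cases hf : MemLp f 2 (volume : Measure ℝ)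
  · rw [toL2_of_memLp hf, toL2_of_memLp ((memLp_congr_ae h).1 hf)]
    exact MemLp.toLp_congr _ _ h
  · rw [toL2, toL2, dif_neg hf, dif_neg (fun hg => hf ((memLp_congr_ae h).2 hg))]

theorem toL2_eq_of_ae {V : L2} (h : f =ᵐ[volume] V) : toL2 f = V := by
  rw [toL2_congr h, toL2_coe]

theorem toL2_add (hf : MemLp f 2 (volume : Measure ℝ)) (hg : MemLp g 2 (volume : Measure ℝ)) :
    toL2 (fun x => f x + g x) = toL2 f + toL2 g := by
  rw [toL2_of_memLp hf, toL2_of_memLp hg, ← MemLp.toLp_add]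
  exact toL2_of_memLp (hf.add hg)

theorem toL2_sub (hf : MemLp f 2 (volume : Measure ℝ)) (hg : MemLp g 2 (volume : Measure ℝ)) :
    toL2 (fun x => f x - g x) = toL2 f - toL2 g := by
  rw [toL2_of_memLp hf, toL2_of_memLp hg, ← MemLp.toLp_sub]
  exact toL2_of_memLp (hf.sub hg)

theorem toL2_const_mul (c : ℝ) (hf : MemLp f 2 (volume : Measure ℝ)) :
    toL2 (fun x => c * f x) = c • toL2 f := by
  rw [toL2_of_memLp hf, ← MemLp.toLp_const_smul]
  exact toL2_of_memLp (hf.const_smul c)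

theorem norm_toL2 (hf : MemLp f 2 (volume : Measure ℝ)) :
    ‖toL2 f‖ = (eLpNorm f 2 volume).toReal := by
  rw [toL2_of_memLp hf, Lp.norm_toLp]

theorem norm_toL2_le_of_eLpNorm_le (hf : MemLp f 2 (volume : Measure ℝ))
    (hg : MemLp g 2 (volume : Measure ℝ)) (h : eLpNorm f 2 volume ≤ eLpNorm g 2 volume) :
    ‖toL2 f‖ ≤ ‖toL2 g‖ := by
  rw [norm_toL2 hf, norm_toL2 hg]
  exact ENNReal.toReal_mono hg.2.ne h

theorem memLp_of_abs_le {C : ℝ} (hf : AEStronglyMeasurable f volume)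
    (hg : MemLp g 2 (volume : Measure ℝ)) (h : ∀ x, |f x| ≤ C * |g x|) :
    MemLp f 2 (volume : Measure ℝ) :=
  hg.of_le_mul hf (ae_of_all _ h)

theorem norm_toL2_le_of_abs_le {C : ℝ} (hC : 0 ≤ C) (hf : AEStronglyMeasurable f volume)
    (hg : MemLp g 2 (volume : Measure ℝ)) (h : ∀ x, |f x| ≤ C * |g x|) :
    ‖toL2 f‖ ≤ C * ‖toL2 g‖ := by
  have hf' := memLp_of_abs_le hf hg h
  have h2 := hg.const_mul C
  calc ‖toL2 f‖ ≤ ‖toL2 (fun x => C * g x)‖ := by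
        refine norm_toL2_le_of_eLpNorm_le hf' h2 (eLpNorm_mono fun x => ?_)
        rw [norm_mul, Real.norm_of_nonneg hC]; exact h x
    _ = C * ‖toL2 g‖ := by rw [toL2_const_mul C hg, norm_smul, Real.norm_of_nonneg hC]

theorem inner_toL2 (hf : MemLp f 2 (volume : Measure ℝ)) (hg : MemLp g 2 (volume : Measure ℝ)) :
    inner ℝ (toL2 f) (toL2 g) = ∫ x, f x * g x := by
  rw [L2.inner_def]
  refine integral_congr_ae ?_
  filter_upwards [coeFn_toL2 hf, coeFn_toL2 hg] with x h1 h2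
  rw [h1, h2]
  simp [mul_comm]

theorem inner_eq_integral (V W : L2) : inner ℝ V W = ∫ x, V x * W x := by
  rw [← inner_toL2 (Lp.memLp V) (Lp.memLp W), toL2_coe, toL2_coe]

theorem integrable_mul_of_memLp (hf : MemLp f 2 (volume : Measure ℝ))
    (hg : MemLp g 2 (volume : Measure ℝ)) : Integrable (fun x => f x * g x) :=
  MemLp.integrable_mul hf hg

theorem memLp_comp_add_right (hf : MemLp f 2 (volume : Measure ℝ)) (c : ℝ) :
    MemLp (fun x => f (x + c)) 2 (volume : Measure ℝ) :=
  hf.comp_measurePreserving (measurePreserving_add_right volume c)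

theorem eLpNorm_comp_add_right (hf : AEStronglyMeasurable f volume) (c : ℝ) :
    eLpNorm (fun x => f (x + c)) 2 volume = eLpNorm f 2 volume :=
  eLpNorm_comp_measurePreserving hf (measurePreserving_add_right volume c)

theorem eLpNorm_two_sq {α : Type*} [MeasurableSpace α] (μ : Measure α) (f : α → ℝ) :
    eLpNorm f 2 μ ^ 2 = ∫⁻ x, ‖f x‖ₑ ^ 2 ∂μ := by
  have := eLpNorm_nnreal_pow_eq_lintegral (f := f) (μ := μ) (p := 2) (by norm_num)
  simpa using this

/-- Jensen's inequality for the square, in integrated form. -/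
theorem eLpNorm_integral_sq_le {S : Type*} [MeasurableSpace S] (μ : Measure S)
    [IsProbabilityMeasure μ] {F : S → ℝ → ℝ} (hF : Measurable (Function.uncurry F)) :
    eLpNorm (fun x => ∫ s, F s x ∂μ) 2 volume ^ 2
      ≤ ∫⁻ s, eLpNorm (F s) 2 volume ^ 2 ∂μ := by
  simp_rw [eLpNorm_two_sq]
  rw [lintegral_lintegral_swap (f := fun s x => ‖F s x‖ₑ ^ 2)
    ((hF.enorm.pow_const 2).aemeasurable)]
  refine lintegral_mono fun x => ?_
  have hx : Measurable fun s => F s x := hF.comp (measurable_id.prodMk measurable_const)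
  calc ‖∫ s, F s x ∂μ‖ₑ ^ 2 ≤ (∫⁻ s, ‖F s x‖ₑ ∂μ) ^ 2 := by
        gcongr; exact enorm_integral_le_lintegral_enorm _
    _ = eLpNorm (fun s => F s x) 1 μ ^ 2 := by rw [eLpNorm_one_eq_lintegral_enorm]
    _ ≤ eLpNorm (fun s => F s x) 2 μ ^ 2 := by
        gcongr
        exact eLpNorm_le_eLpNorm_of_exponent_le (by norm_num) hx.aestronglyMeasurable
    _ = _ := eLpNorm_two_sq _ _

theorem eLpNorm_integral_le {S : Type*} [MeasurableSpace S] (μ : Measure S)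
    [IsProbabilityMeasure μ] {F : S → ℝ → ℝ} (hF : Measurable (Function.uncurry F))
    {B : ENNReal} (hB : ∀ᵐ s ∂μ, eLpNorm (F s) 2 volume ≤ B) :
    eLpNorm (fun x => ∫ s, F s x ∂μ) 2 volume ≤ B := by
  have h1 := eLpNorm_integral_sq_le μ hF
  have h2 : ∫⁻ s, eLpNorm (F s) 2 volume ^ 2 ∂μ ≤ B ^ 2 := by
    calc _ ≤ ∫⁻ _, B ^ 2 ∂μ := lintegral_mono_ae (hB.mono fun s hs => by gcongr)
      _ = B ^ 2 := by simp
  exact (ENNReal.pow_le_pow_left_iff two_ne_zero).1 (h1.trans h2)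

/-- A jointly measurable family of square-integrable functions is a measurable family
in `L²(ℝ)`. -/
theorem stronglyMeasurable_toL2 {F : ℝ → ℝ → ℝ} (hF : Measurable (Function.uncurry F))
    (hF2 : ∀ ξ, MemLp (F ξ) 2 (volume : Measure ℝ)) :
    StronglyMeasurable (fun ξ => toL2 (F ξ)) := by
  borelize L2
  -- By separability of `L²(ℝ)`, every open set is a countable union of balls, so measurable
  -- distances to fixed elements suffice. The square of such a distance is an integral over `x` of a
  -- jointly measurable function.
  have key : ∀ g : L2, Measurable fun ξ => ENNReal.ofReal (dist (toL2 (F ξ)) g) := by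
    intro g
    have : ∀ ξ, ENNReal.ofReal (dist (toL2 (F ξ)) g) ^ 2 = ∫⁻ x, ‖F ξ x - g x‖ₑ ^ 2 := by
      intro ξ
      have hm : MemLp (fun x => F ξ x - g x) 2 (volume : Measure ℝ) := (hF2 ξ).sub (Lp.memLp g)
      rw [dist_eq_norm]
      nth_rewrite 1 [← toL2_coe g]
      rw [← toL2_sub (hF2 ξ) (Lp.memLp g), norm_toL2 hm,
        ENNReal.ofReal_toReal hm.2.ne, eLpNorm_two_sq]
    have h2 : Measurable fun ξ => ENNReal.ofReal (dist (toL2 (F ξ)) g) ^ 2 := by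
      simp_rw [this]
      refine Measurable.lintegral_prod_right' (f := fun p : ℝ × ℝ => ‖F p.1 p.2 - g p.2‖ₑ ^ 2) ?_
      have hg : Measurable (g : ℝ → ℝ) := (Lp.stronglyMeasurable g).measurable
      exact ((hF.sub (hg.comp measurable_snd)).enorm).pow_const 2
    have h3 := h2.pow_const (1 / 2 : ℝ)
    have h4 : (fun ξ => (ENNReal.ofReal (dist (toL2 (F ξ)) g) ^ 2) ^ (1 / 2 : ℝ))
        = fun ξ => ENNReal.ofReal (dist (toL2 (F ξ)) g) := by
      funext ξ
      rw [← ENNReal.rpow_natCast, ← ENNReal.rpow_mul]; norm_num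
    rwa [h4] at h3
  have key2 : ∀ (g : L2) (r : ℝ), MeasurableSet ((fun ξ => toL2 (F ξ)) ⁻¹' Metric.ball g r) := by
    intro g r
    have : (fun ξ => toL2 (F ξ)) ⁻¹' Metric.ball g r
        = {ξ | (ENNReal.ofReal (dist (toL2 (F ξ)) g)).toReal < r} := by
      ext ξ
      simp [ENNReal.toReal_ofReal dist_nonneg]
    rw [this]
    exact measurableSet_lt (key g).ennreal_toReal measurable_const
  have : Fact ((2 : ENNReal) ≠ ⊤) := ⟨ENNReal.ofNat_ne_top⟩
  have : SecondCountableTopology L2 := Lp.SecondCountableTopology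
  refine Measurable.stronglyMeasurable (measurable_of_isOpen fun s hs => ?_)
  choose! r hr hrs using fun x (hx : x ∈ s) => Metric.isOpen_iff.1 hs x hx
  obtain ⟨c, hc, hcs⟩ := TopologicalSpace.isOpen_biUnion_countable s
    (fun x => Metric.ball x (r x)) (fun x _ => Metric.isOpen_ball)
  have : s = ⋃ x ∈ c, Metric.ball x (r x) := by
    rw [hcs.2]
    refine Subset.antisymm (fun x hx => mem_biUnion hx (Metric.mem_ball_self (hr x hx))) ?_
    exact iUnion₂_subset fun x hx => hrs x hx
  rw [this, preimage_iUnion₂]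
  exact MeasurableSet.biUnion hcs.1 fun x _ => key2 x _

end Basics

/-! ### Averages of translates over a probability measure -/

section Smear

/-- The average of the translates `f(x + η s)` with respect to a measure in `s`. -/
def smear (μ : Measure ℝ) (η : ℝ) (f : ℝ → ℝ) (x : ℝ) : ℝ := ∫ s, f (x + η * s) ∂μ

/-- Symmetric probability measures on `[-1, 1]`. -/
class AveragingMeasure (μ : Measure ℝ) : Prop extends IsProbabilityMeasure μ, μ.IsNegInvariant where
  support : ∀ᵐ s ∂μ, |s| ≤ 1

variable {μ : Measure ℝ} {f g : ℝ → ℝ} {η : ℝ}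

theorem measurable_smear_uncurry [SFinite μ] {F : ℝ → ℝ → ℝ} {h : ℝ → ℝ}
    (hF : Measurable (Function.uncurry F)) (hh : Measurable h) :
    Measurable (Function.uncurry fun ξ x => smear μ (h ξ) (F ξ) x) := by
  unfold smear
  have : Measurable fun p : (ℝ × ℝ) × ℝ => F p.1.1 (p.1.2 + h p.1.1 * p.2) := by
    have h1 : Measurable fun p : (ℝ × ℝ) × ℝ => (p.1.1, p.1.2 + h p.1.1 * p.2) := by fun_prop
    exact hF.comp h1
  exact (StronglyMeasurable.integral_prod_right' (ν := μ) this.stronglyMeasurable).measurable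

theorem measurable_smear [SFinite μ] (hf : Measurable f) : Measurable (smear μ η f) := by
  have : Measurable (Function.uncurry fun _ : ℝ => f) := hf.comp measurable_snd
  have h2 := measurable_smear_uncurry (μ := μ) this (measurable_const (a := η))
  exact h2.comp (measurable_const (a := (0 : ℝ)) |>.prodMk measurable_id)

theorem eLpNorm_smear_le [IsProbabilityMeasure μ] (hf : Measurable f) :
    eLpNorm (smear μ η f) 2 volume ≤ eLpNorm f 2 volume := by
  unfold smear
  refine eLpNorm_integral_le μ (F := fun s x => f (x + η * s)) ?_ (ae_of_all _ fun s => ?_)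
  · exact hf.comp (by fun_prop)
  · exact (eLpNorm_comp_add_right hf.aestronglyMeasurable _).le

theorem memLp_smear [IsProbabilityMeasure μ] (hf : Measurable f)
    (hf2 : MemLp f 2 (volume : Measure ℝ)) : MemLp (smear μ η f) 2 (volume : Measure ℝ) :=
  ⟨(measurable_smear hf).aestronglyMeasurable, (eLpNorm_smear_le hf).trans_lt hf2.2⟩

theorem norm_toL2_smear_le [IsProbabilityMeasure μ] (hf : Measurable f)
    (hf2 : MemLp f 2 (volume : Measure ℝ)) : ‖toL2 (smear μ η f)‖ ≤ ‖toL2 f‖ :=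
  norm_toL2_le_of_eLpNorm_le (memLp_smear hf hf2) hf2 (eLpNorm_smear_le hf)

theorem abs_smear_le [IsProbabilityMeasure μ] {C : ℝ} (h : ∀ x, |f x| ≤ C) (x : ℝ) :
    |smear μ η f x| ≤ C := by
  have := norm_integral_le_of_norm_le_const (μ := μ) (f := fun s => f (x + η * s)) (C := C)
    (ae_of_all _ fun s => h _)
  simpa [smear] using this

theorem smear_comp_neg [μ.IsNegInvariant] (x : ℝ) :
    smear μ η (fun y => f (-y)) x = smear μ η f (-x) := by
  unfold smear
  rw [← integral_neg_eq_self (μ := μ) (fun s => f (-x + η * s))]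
  refine integral_congr_ae (ae_of_all _ fun s => ?_)
  change f (-(x + η * s)) = f (-x + η * -s)
  congr 1; ring

/-- By Tonelli, the integral over `x` of the second moments in `s` is `‖f‖₂²`. So for almost every
`x` the translates are square-integrable in `s`, hence integrable on a probability space. -/
theorem ae_integrable_smear [IsProbabilityMeasure μ] (hf : Measurable f)
    (hf2 : MemLp f 2 (volume : Measure ℝ)) :
    ∀ᵐ x, Integrable (fun s => f (x + η * s)) μ := by
  have hm : Measurable (Function.uncurry fun s x => f (x + η * s)) := hf.comp (by fun_prop)
  have h1 : ∫⁻ x, ∫⁻ s, ‖f (x + η * s)‖ₑ ^ 2 ∂μ < ⊤ := by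
    rw [lintegral_lintegral_swap (f := fun x s => ‖f (x + η * s)‖ₑ ^ 2)
      (((hm.comp measurable_swap).enorm.pow_const 2).aemeasurable)]
    simp_rw [← eLpNorm_two_sq, eLpNorm_comp_add_right hf.aestronglyMeasurable]
    simpa using hf2.2
  have h2 : Measurable fun x => ∫⁻ s, ‖f (x + η * s)‖ₑ ^ 2 ∂μ := by
    have : Measurable fun p : ℝ × ℝ => ‖f (p.1 + η * p.2)‖ₑ ^ 2 :=
      (hf.comp (by fun_prop : Measurable fun p : ℝ × ℝ => p.1 + η * p.2)).enorm.pow_const 2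
    exact this.lintegral_prod_right'
  filter_upwards [ae_lt_top h2 h1.ne] with x hx
  have hx' : Measurable fun s => f (x + η * s) := hf.comp (by fun_prop)
  have : MemLp (fun s => f (x + η * s)) 2 μ := by
    refine ⟨hx'.aestronglyMeasurable, ?_⟩
    rw [← eLpNorm_two_sq] at hx
    exact (ENNReal.pow_lt_top_iff.1 hx).resolve_right (by norm_num)
  exact this.integrable (by norm_num)

theorem integrable_translate_mul [IsProbabilityMeasure μ] (hf : Measurable f)
    (hf2 : MemLp f 2 (volume : Measure ℝ)) (hg : Measurable g)
    (hg2 : MemLp g 2 (volume : Measure ℝ)) :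
    Integrable (Function.uncurry fun x s => f (x + η * s) * g x) (volume.prod μ) := by
  have hm : Measurable (Function.uncurry fun x s => f (x + η * s) * g x) :=
    (hf.comp (by fun_prop : Measurable fun p : ℝ × ℝ => p.1 + η * p.2)).mul (hg.comp measurable_fst)
  refine (integrable_prod_iff' hm.aestronglyMeasurable).2 ⟨ae_of_all _ fun s => ?_, ?_⟩
  · exact integrable_mul_of_memLp (memLp_comp_add_right hf2 (η * s)) hg2
  · refine Integrable.of_bound (C := ‖toL2 f‖ * ‖toL2 g‖) ?_ (ae_of_all _ fun s => ?_)
    · exact (StronglyMeasurable.integral_prod_left' (μ := volume)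
        hm.norm.stronglyMeasurable).aestronglyMeasurable
    · rw [Real.norm_of_nonneg (integral_nonneg fun _ => norm_nonneg _)]
      have h1 := (memLp_comp_add_right hf2 (η * s)).norm
      have h2 := hg2.norm
      calc ∫ x, ‖f (x + η * s) * g x‖ = inner ℝ (toL2 fun x => ‖f (x + η * s)‖) (toL2 fun x => ‖g x‖) := by
            rw [inner_toL2 h1 h2]; simp_rw [norm_mul]
        _ ≤ ‖toL2 fun x => ‖f (x + η * s)‖‖ * ‖toL2 fun x => ‖g x‖‖ := real_inner_le_norm _ _
        _ = _ := by
            rw [norm_toL2 h1, norm_toL2 h2, norm_toL2 hf2, norm_toL2 hg2, eLpNorm_norm, eLpNorm_norm,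
              eLpNorm_comp_add_right hf.aestronglyMeasurable]

theorem integral_smear_mul [IsProbabilityMeasure μ] (hf : Measurable f)
    (hf2 : MemLp f 2 (volume : Measure ℝ)) (hg : Measurable g)
    (hg2 : MemLp g 2 (volume : Measure ℝ)) :
    ∫ x, smear μ η f x * g x = ∫ s, (∫ x, f (x + η * s) * g x) ∂μ := by
  unfold smear
  simp_rw [← integral_mul_const]
  exact integral_integral_swap (integrable_translate_mul hf hf2 hg hg2)

/-- Self-adjointness of averaging: Fubini and a translation of `x` move the shift `η s` to the other
factor as `-η s`, and the symmetry of `μ` removes the sign. -/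
theorem integral_smear_mul_comm [IsProbabilityMeasure μ] [μ.IsNegInvariant] (hf : Measurable f)
    (hf2 : MemLp f 2 (volume : Measure ℝ)) (hg : Measurable g)
    (hg2 : MemLp g 2 (volume : Measure ℝ)) :
    ∫ x, smear μ η f x * g x = ∫ x, f x * smear μ η g x := by
  simp_rw [mul_comm (f _)]
  rw [integral_smear_mul hf hf2 hg hg2, integral_smear_mul hg hg2 hf hf2,
    ← integral_neg_eq_self (μ := μ) (fun s => ∫ x, g (x + η * s) * f x)]
  congr 1; funext s
  rw [← integral_add_right_eq_self (fun x => g (x + η * -s) * f x) (η * s)]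
  congr 1; funext x
  rw [mul_comm]; congr 2; ring

/-- Translation estimate in terms of the derivative. -/
theorem eLpNorm_translate_sub_le {f' : ℝ → ℝ} (hf : ∀ x, HasDerivAt f (f' x) x)
    (hf' : Continuous f') (c : ℝ) :
    eLpNorm (fun x => f (x + c) - f x) 2 volume
      ≤ ENNReal.ofReal |c| * eLpNorm f' 2 volume := by
  have h1 : ∀ x, f (x + c) - f x = ∫ t in Ioc (0 : ℝ) 1, c * f' (x + t * c) := by
    intro x
    rw [← intervalIntegral.integral_of_le zero_le_one]
    have h2 : ∀ t ∈ uIcc (0 : ℝ) 1, HasDerivAt (fun t => f (x + t * c)) (c * f' (x + t * c)) t := by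
      intro t _
      have h3 : HasDerivAt (fun t : ℝ => x + t * c) c t := by
        simpa using ((hasDerivAt_id t).mul_const c).const_add x
      have := (hf (x + t * c)).comp t h3
      exact this.congr_deriv (mul_comm _ _)
    rw [intervalIntegral.integral_eq_sub_of_hasDerivAt h2
      (Continuous.intervalIntegrable (by fun_prop) _ _)]
    simp
  simp_rw [h1]
  have : IsProbabilityMeasure (volume.restrict (Ioc (0 : ℝ) 1)) := ⟨by simp⟩
  refine eLpNorm_integral_le _ (F := fun t x => c * f' (x + t * c)) ?_ (ae_of_all _ fun t => ?_)
  · exact Continuous.measurable (by fun_prop)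
  · have : (fun x => c * f' (x + t * c)) = c • fun x => f' (x + t * c) := rfl
    rw [this, eLpNorm_const_smul, eLpNorm_comp_add_right hf'.aestronglyMeasurable, Real.enorm_eq_ofReal_abs]

theorem integrable_translate_of_continuous [AveragingMeasure μ] (hf : Continuous f) (x : ℝ) :
    Integrable (fun s => f (x + η * s)) μ := by
  obtain ⟨C, hC⟩ := (isCompact_Icc (a := (-1 : ℝ)) (b := 1)).exists_bound_of_continuousOn
    (f := fun s => f (x + η * s)) (by fun_prop)
  refine Integrable.of_bound (C := C) (by fun_prop) ?_
  filter_upwards [AveragingMeasure.support (μ := μ)] with s hs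
  exact hC s (abs_le.1 hs)

theorem eLpNorm_smear_sub_le [AveragingMeasure μ] {f' : ℝ → ℝ} (hf : ∀ x, HasDerivAt f (f' x) x)
    (hf' : Continuous f') :
    eLpNorm (fun x => smear μ η f x - f x) 2 volume
      ≤ ENNReal.ofReal |η| * eLpNorm f' 2 volume := by
  have hfc : Continuous f := continuous_iff_continuousAt.2 fun x => (hf x).continuousAt
  have h1 : ∀ x, smear μ η f x - f x = ∫ s, (f (x + η * s) - f x) ∂μ := by
    intro x
    rw [integral_sub (integrable_translate_of_continuous hfc x) (integrable_const _)]
    simp [smear]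
  simp_rw [h1]
  refine eLpNorm_integral_le _ (F := fun s x => f (x + η * s) - f x) ?_ ?_
  · exact Continuous.measurable (by fun_prop)
  · filter_upwards [AveragingMeasure.support (μ := μ)] with s hs
    refine (eLpNorm_translate_sub_le hf hf' _).trans ?_
    gcongr ENNReal.ofReal ?_ * _
    rw [abs_mul]
    exact mul_le_of_le_one_right (abs_nonneg _) hs

theorem eLpNorm_translate_sub_sub_le {f' f'' : ℝ → ℝ} (hf : ∀ x, HasDerivAt f (f' x) x)
    (hf' : ∀ x, HasDerivAt f' (f'' x) x) (hf'' : Continuous f'') (c : ℝ) :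
    eLpNorm (fun x => f (x + c) - f x - c * f' x) 2 volume
      ≤ ENNReal.ofReal (c ^ 2) * eLpNorm f'' 2 volume := by
  have hfc : Continuous f' := continuous_iff_continuousAt.2 fun x => (hf' x).continuousAt
  have h1 : ∀ x, f (x + c) - f x - c * f' x
      = ∫ t in Ioc (0 : ℝ) 1, c * (f' (x + t * c) - f' x) := by
    intro x
    rw [← intervalIntegral.integral_of_le zero_le_one]
    have h2 : ∀ t ∈ uIcc (0 : ℝ) 1, HasDerivAt (fun t => f (x + t * c) - t * (c * f' x))
        (c * (f' (x + t * c) - f' x)) t := by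
      intro t _
      have h3 : HasDerivAt (fun t : ℝ => x + t * c) c t := by
        simpa using ((hasDerivAt_id t).mul_const c).const_add x
      have h4 := (hf (x + t * c)).comp t h3
      have h5 := h4.sub ((hasDerivAt_id t).mul_const (c * f' x))
      refine h5.congr_deriv ?_
      ring
    rw [intervalIntegral.integral_eq_sub_of_hasDerivAt h2
      (Continuous.intervalIntegrable (by fun_prop) _ _)]
    simp; ring
  simp_rw [h1]
  have : IsProbabilityMeasure (volume.restrict (Ioc (0 : ℝ) 1)) := ⟨by simp⟩
  refine eLpNorm_integral_le _ (F := fun t x => c * (f' (x + t * c) - f' x)) ?_ ?_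
  · exact Continuous.measurable (by fun_prop)
  · filter_upwards [ae_restrict_mem measurableSet_Ioc] with t ht
    have : (fun x => c * (f' (x + t * c) - f' x)) = c • fun x => (f' (x + t * c) - f' x) := rfl
    rw [this, eLpNorm_const_smul, Real.enorm_eq_ofReal_abs]
    calc _ ≤ ENNReal.ofReal |c| * (ENNReal.ofReal |t * c| * eLpNorm f'' 2 volume) := by
          gcongr; exact eLpNorm_translate_sub_le hf' hf'' _
      _ ≤ ENNReal.ofReal |c| * (ENNReal.ofReal |c| * eLpNorm f'' 2 volume) := by
          gcongr ENNReal.ofReal |c| * (ENNReal.ofReal ?_ * _)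
          rw [abs_mul, abs_of_pos ht.1]
          exact mul_le_of_le_one_left (abs_nonneg _) ht.2
      _ = _ := by
          rw [← mul_assoc, ← ENNReal.ofReal_mul (abs_nonneg _), abs_mul_abs_self, sq]

/-- A symmetric measure has vanishing first moment, so `η s f'(x)` may be subtracted inside the
average for free. What remains is a second order Taylor remainder, whence the rate `η²`. -/
theorem eLpNorm_smear_sub_le_sq [AveragingMeasure μ] {f' f'' : ℝ → ℝ}
    (hf : ∀ x, HasDerivAt f (f' x) x)
    (hf' : ∀ x, HasDerivAt f' (f'' x) x) (hf'' : Continuous f'') :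
    eLpNorm (fun x => smear μ η f x - f x) 2 volume
      ≤ ENNReal.ofReal (η ^ 2) * eLpNorm f'' 2 volume := by
  have hfc : Continuous f := continuous_iff_continuousAt.2 fun x => (hf x).continuousAt
  have hfc' : Continuous f' := continuous_iff_continuousAt.2 fun x => (hf' x).continuousAt
  have hid : Integrable (fun s : ℝ => s) μ := by
    simpa using integrable_translate_of_continuous (μ := μ) (η := 1) continuous_id 0
  have h0 : ∫ s, s ∂μ = 0 := by
    have := integral_neg_eq_self (μ := μ) (fun s : ℝ => s)
    rw [integral_neg] at this
    linarith
  have h1 : ∀ x, smear μ η f x - f x = ∫ s, (f (x + η * s) - f x - η * s * f' x) ∂μ := by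
    intro x
    rw [integral_sub, integral_sub (integrable_translate_of_continuous hfc x) (integrable_const _),
      integral_mul_const, integral_const_mul, h0]
    · simp [smear]
    · exact (integrable_translate_of_continuous hfc x).sub (integrable_const _)
    · exact (hid.const_mul η).mul_const _
  simp_rw [h1]
  refine eLpNorm_integral_le _ (F := fun s x => f (x + η * s) - f x - η * s * f' x) ?_ ?_
  · exact Continuous.measurable (by fun_prop)
  · filter_upwards [AveragingMeasure.support (μ := μ)] with s hs
    refine (eLpNorm_translate_sub_sub_le hf hf' hf'' _).trans ?_
    gcongr ENNReal.ofReal ?_ * _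
    rw [mul_pow]
    refine mul_le_of_le_one_right (sq_nonneg _) ?_
    rw [← sq_abs]
    exact pow_le_one₀ (abs_nonneg _) hs

end Smear

/-! ### The uniform kernel, the cubic kernel and their comparison -/

section Kernels

variable {f g : ℝ → ℝ} {η : ℝ}

theorem isNegInvariant_withDensity {k : ℝ → ENNReal}
    (hke : ∀ s, k (-s) = k s) : (volume.withDensity k : Measure ℝ).IsNegInvariant := by
  refine ⟨Measure.ext fun s hs => ?_⟩
  rw [Measure.neg_apply, withDensity_apply _ hs, withDensity_apply _ hs.neg,
    ← lintegral_indicator hs, ← lintegral_indicator hs.neg,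
    ← lintegral_neg_eq_self (fun x => s.indicator k x)]
  refine lintegral_congr fun x => ?_
  by_cases hx : -x ∈ s <;> simp [indicator, hx, hke]

/-- The uniform distribution on `[-1/2, 1/2]`. -/
def unif : Measure ℝ := volume.withDensity ((Icc (-1 / 2 : ℝ) (1 / 2)).indicator 1)

theorem unif_eq : unif = volume.restrict (Icc (-1 / 2 : ℝ) (1 / 2)) :=
  withDensity_indicator_one measurableSet_Icc

instance : AveragingMeasure unif where
  measure_univ := by rw [unif_eq]; norm_num
  neg_eq_self := by
    have : (unif).IsNegInvariant := by
      refine isNegInvariant_withDensity fun s => ?_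
      have : -s ∈ Icc (-1 / 2 : ℝ) (1 / 2) ↔ s ∈ Icc (-1 / 2 : ℝ) (1 / 2) := by
        simp only [mem_Icc]
        constructor <;> intro h <;> constructor <;> linarith [h.1, h.2]
      rw [indicator_apply, indicator_apply, if_congr this rfl rfl]; rfl
    exact this.neg_eq_self
  support := by
    rw [unif_eq]
    filter_upwards [ae_restrict_mem measurableSet_Icc] with s hs
    rw [abs_le]
    constructor <;> linarith [hs.1, hs.2]

theorem avg_eq_smear (hη : η ≠ 0) (f : ℝ → ℝ) : avg η f = smear unif η f := by
  funext x
  have h := intervalIntegral.integral_comp_add_mul (a := -1 / 2) (b := 1 / 2) f hη x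
  rw [smear, unif_eq, integral_Icc_eq_integral_Ioc, ← intervalIntegral.integral_of_le (by norm_num),
    h, avg, smul_eq_mul, one_div]
  congr 2 <;> ring

/-- The density of the third averaging measure. -/
def cubDensity (s : ℝ) : ℝ := 2 * (max (1 - |s|) 0) ^ 3

theorem continuous_cubDensity : Continuous cubDensity := by unfold cubDensity; fun_prop

theorem cubDensity_nonneg (s : ℝ) : 0 ≤ cubDensity s := by
  unfold cubDensity; positivity

theorem cubDensity_eq_zero {s : ℝ} (h : s ∉ Icc (-1 : ℝ) 1) : cubDensity s = 0 := by
  have : 1 - |s| ≤ 0 := by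
    by_contra hc
    exact h (abs_le.1 (by linarith))
  simp [cubDensity, this]

/-- Folding onto `[0, 1]` makes the density a polynomial and produces the weight `(1 - s)³` of a
fourth order Taylor remainder. -/
theorem integral_cubDensity_mul {h : ℝ → ℝ} (hh : Continuous h) :
    ∫ s, cubDensity s * h s
      = 2 * ((∫ s in (0 : ℝ)..1, (1 - s) ^ 3 * h s) + ∫ s in (0 : ℝ)..1, (1 - s) ^ 3 * h (-s)) := by
  have hc : Continuous fun s => cubDensity s * h s := continuous_cubDensity.mul hh
  have h1 : ∫ s, cubDensity s * h s = ∫ s in Icc (-1 : ℝ) 1, cubDensity s * h s := by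
    refine (setIntegral_eq_integral_of_forall_compl_eq_zero fun s hs => ?_).symm
    rw [cubDensity_eq_zero hs, zero_mul]
  have h2 : ∀ s ∈ uIcc (0 : ℝ) 1, cubDensity s = 2 * (1 - s) ^ 3 := by
    intro s hs
    rw [uIcc_of_le zero_le_one] at hs
    rw [cubDensity, abs_of_nonneg hs.1, max_eq_left (by linarith [hs.2])]
  have h3 : ∀ s, cubDensity (-s) = cubDensity s := fun s => by simp [cubDensity]
  have h4 : ∫ s in (-1 : ℝ)..0, cubDensity s * h s = ∫ s in (0 : ℝ)..1, cubDensity s * h (-s) := by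
    have := intervalIntegral.integral_comp_neg (a := 0) (b := 1) (fun s => cubDensity s * h s)
    simp only [h3, neg_zero] at this
    exact this.symm
  rw [h1, integral_Icc_eq_integral_Ioc, ← intervalIntegral.integral_of_le (by norm_num),
    ← intervalIntegral.integral_add_adjacent_intervals (b := 0) (hc.intervalIntegrable _ _)
      (hc.intervalIntegrable _ _), h4, add_comm, mul_add,
    ← intervalIntegral.integral_const_mul, ← intervalIntegral.integral_const_mul]
  congr 1 <;> refine intervalIntegral.integral_congr fun s hs => ?_ <;> simp only [h2 s hs] <;> ring

theorem integral_one_sub_cube : ∫ s in (0 : ℝ)..1, (1 - s) ^ 3 = 1 / 4 := by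
  rw [intervalIntegral.integral_comp_sub_left (fun s => s ^ 3) 1]
  norm_num

/-- The measure with density `2 (1 - |s|)³` on `[-1, 1]`. -/
def cub : Measure ℝ := volume.withDensity fun s => ENNReal.ofReal (cubDensity s)

theorem integral_cub (h : ℝ → ℝ) : ∫ s, h s ∂cub = ∫ s, cubDensity s * h s := by
  rw [cub, integral_withDensity_eq_integral_toReal_smul
    continuous_cubDensity.measurable.ennreal_ofReal (ae_of_all _ fun _ => ENNReal.ofReal_lt_top)]
  simp_rw [ENNReal.toReal_ofReal (cubDensity_nonneg _), smul_eq_mul]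

instance : AveragingMeasure cub where
  measure_univ := by
    have hi : Integrable cubDensity := continuous_cubDensity.integrable_of_hasCompactSupport
      (HasCompactSupport.intro (isCompact_Icc (a := (-1 : ℝ)) (b := 1))
        fun s hs => cubDensity_eq_zero hs)
    rw [cub, withDensity_apply _ MeasurableSet.univ, Measure.restrict_univ,
      ← ofReal_integral_eq_lintegral_ofReal hi (ae_of_all _ cubDensity_nonneg)]
    have := integral_cubDensity_mul (continuous_const (y := (1 : ℝ)))
    simp only [mul_one, integral_one_sub_cube] at this
    rw [this]; norm_num
  neg_eq_self := by
    have : (cub).IsNegInvariant :=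
      isNegInvariant_withDensity fun s => by
        simp [cubDensity]
    exact this.neg_eq_self
  support := by
    rw [cub, ae_withDensity_iff continuous_cubDensity.measurable.ennreal_ofReal]
    refine ae_of_all _ fun s hs => ?_
    by_contra hc
    exact hs (by rw [cubDensity_eq_zero fun h => hc (abs_le.2 h), ENNReal.ofReal_zero])

/-- The second order remainder of the twofold average is an average of the second derivative. -/
theorem smear_cub_eq {u u' u'' : ℝ → ℝ} (hu : ∀ x, HasDerivAt u (u' x) x)
    (hu' : ∀ x, HasDerivAt u' (u'' x) x) (hu'' : Continuous u'') (hη : 0 < η) (x : ℝ) :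
    u x - avg η (avg η u) x = -(η ^ 2 / 12) * smear cub η u'' x := by
  have huc : Continuous u := continuous_iff_continuousAt.2 fun x => (hu x).continuousAt
  -- With `U'' = u`, the twofold average of `u` is the second difference of `U` divided by `η²`. The
  -- claim is thus Taylor's formula of order four for `U` with integral remainder, in which the odd
  -- orders cancel.
  obtain ⟨U', hU'⟩ : ∃ U' : ℝ → ℝ, ∀ x, HasDerivAt U' (u x) x :=
    ⟨fun x => ∫ y in (0 : ℝ)..x, u y, fun x => (huc.integral_hasStrictDerivAt 0 x).hasDerivAt⟩
  have hUc' : Continuous U' := continuous_iff_continuousAt.2 fun x => (hU' x).continuousAt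
  obtain ⟨U, hU⟩ : ∃ U : ℝ → ℝ, ∀ x, HasDerivAt U (U' x) x :=
    ⟨fun x => ∫ y in (0 : ℝ)..x, U' y, fun x => (hUc'.integral_hasStrictDerivAt 0 x).hasDerivAt⟩
  have hA : ∀ x, avg η u x = 1 / η * (U' (x + η / 2) - U' (x - η / 2)) := by
    intro x
    rw [avg, intervalIntegral.integral_eq_sub_of_hasDerivAt (fun y _ => hU' y)
      (huc.intervalIntegrable _ _)]
  have hAA : avg η (avg η u) x = 1 / η ^ 2 * (U (x + η) + U (x - η) - 2 * U x) := by
    have h1 : ∀ y ∈ uIcc (x - η / 2) (x + η / 2),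
        HasDerivAt (fun y => 1 / η * (U (y + η / 2) - U (y - η / 2))) (avg η u y) y := by
      intro y _
      rw [hA]
      exact (((hU _).comp_add_const y (η / 2)).sub ((hU _).comp_sub_const y (η / 2))).const_mul _
    have hc : Continuous (avg η u) := by
      rw [funext hA]; fun_prop
    rw [avg, intervalIntegral.integral_eq_sub_of_hasDerivAt h1 (hc.intervalIntegrable _ _)]
    have e1 : x + η / 2 + η / 2 = x + η := by ring
    have e2 : x + η / 2 - η / 2 = x := by ring
    have e3 : x - η / 2 + η / 2 = x := by ring
    have e4 : x - η / 2 - η / 2 = x - η := by ring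
    rw [e1, e2, e3, e4]
    ring
  -- Repeated integration by parts gives the antiderivative below. It is needed for `c = η` and `c =
  -- -η`, the two halves of the kernel.
  have hI : ∀ c : ℝ, c ≠ 0 → ∫ s in (0 : ℝ)..1, (1 - s) ^ 3 * u'' (x + c * s)
      = 6 * U (x + c) / c ^ 4 - (u' x / c + 3 * u x / c ^ 2 + 6 * U' x / c ^ 3 + 6 * U x / c ^ 4) := by
    intro c hc
    have hd : ∀ s ∈ uIcc (0 : ℝ) 1, HasDerivAt (fun s => (1 - s) ^ 3 * u' (x + c * s) / c
        + 3 * (1 - s) ^ 2 * u (x + c * s) / c ^ 2 + 6 * (1 - s) * U' (x + c * s) / c ^ 3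
        + 6 * U (x + c * s) / c ^ 4) ((1 - s) ^ 3 * u'' (x + c * s)) s := by
      intro s _
      have h0 : HasDerivAt (fun s : ℝ => x + c * s) c s := by
        simpa using ((hasDerivAt_id s).const_mul c).const_add x
      have h1 : HasDerivAt (fun s : ℝ => 1 - s) (-1) s := by
        simpa using (hasDerivAt_id s).const_sub 1
      have a1 := ((h1.pow 3).mul ((hu' (x + c * s)).comp s h0)).div_const c
      have a2 := (((h1.pow 2).const_mul 3).mul ((hu (x + c * s)).comp s h0)).div_const (c ^ 2)
      have a3 := ((h1.const_mul 6).mul ((hU' (x + c * s)).comp s h0)).div_const (c ^ 3)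
      have a4 := (((hU (x + c * s)).comp s h0).const_mul 6).div_const (c ^ 4)
      refine (((a1.add a2).add a3).add a4).congr_deriv ?_
      simp only [Function.comp_apply, Pi.pow_apply]
      field_simp
      push_cast
      ring
    rw [intervalIntegral.integral_eq_sub_of_hasDerivAt hd
      (Continuous.intervalIntegrable (by fun_prop) _ _)]
    simp
  have hp := hI η hη.ne'
  have hm := hI (-η) (neg_ne_zero.2 hη.ne')
  have hm' : ∫ s in (0 : ℝ)..1, (1 - s) ^ 3 * u'' (x + η * -s)
      = ∫ s in (0 : ℝ)..1, (1 - s) ^ 3 * u'' (x + -η * s) := by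
    simp_rw [mul_neg, neg_mul]
  have h5 : x + -η = x - η := by ring
  rw [smear, integral_cub, integral_cubDensity_mul (h := fun s => u'' (x + η * s)) (by fun_prop),
    hp, hm', hm, hAA, h5]
  field_simp
  ring

/-- The convolution of two copies of `unif` has the tent density `(1 - |s|)₊`, and `2 (1 - |s|)³ ≤ 2
(1 - |s|)` on `[-1, 1]`. This domination compares the loss under `cub` with the loss under two
averages. -/
theorem cub_le_unif_conv {h : ℝ → ENNReal} (hh : Measurable h) :
    ∫⁻ s, h s ∂cub ≤ 2 * ∫⁻ t, ∫⁻ s, h (s + t) ∂unif ∂unif := by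
  have h1 : ∀ t, ∫⁻ s, h (s + t) ∂unif
      = ∫⁻ w, (Icc (-1 / 2 : ℝ) (1 / 2)).indicator 1 (w - t) * h w := by
    intro t
    have h2 : Measurable fun s => h (s + t) := hh.comp (measurable_add_const t)
    rw [unif, lintegral_withDensity_eq_lintegral_mul _ (measurable_one.indicator measurableSet_Icc)
      h2,
      ← lintegral_add_right_eq_self (fun w => (Icc (-1 / 2 : ℝ) (1 / 2)).indicator 1 (w - t) * h w) t]
    simp
  have hm : Measurable fun p : ℝ × ℝ =>
      (Icc (-1 / 2 : ℝ) (1 / 2)).indicator (1 : ℝ → ENNReal) (p.2 - p.1) * h p.2 :=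
    ((measurable_one.indicator measurableSet_Icc).comp (measurable_snd.sub measurable_fst)).mul
      (hh.comp measurable_snd)
  simp_rw [h1]
  rw [lintegral_lintegral_swap hm.aemeasurable, cub,
    lintegral_withDensity_eq_lintegral_mul _ continuous_cubDensity.measurable.ennreal_ofReal hh,
    ← lintegral_const_mul _ (by
      exact (hm.comp measurable_swap).lintegral_prod_right' (ν := unif))]
  refine lintegral_mono fun w => ?_
  have hmw : Measurable fun t => (Icc (-1 / 2 : ℝ) (1 / 2)).indicator (1 : ℝ → ENNReal) (w - t) :=
    (measurable_one.indicator measurableSet_Icc).comp (measurable_const.sub measurable_id)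
  rw [lintegral_mul_const _ hmw, ← mul_assoc, Pi.mul_apply]
  gcongr
  by_cases hw : w ∈ Icc (-1 : ℝ) 1
  swap
  · rw [cubDensity_eq_zero hw]; simp
  have h2 : ENNReal.ofReal (1 - |w|)
      ≤ ∫⁻ t, (Icc (-1 / 2 : ℝ) (1 / 2)).indicator (1 : ℝ → ENNReal) (w - t) ∂unif := by
    -- The tent value at `w` is the overlap length of `[-1/2, 1/2]` with its translate by `w`. Only
    -- the lower bound is needed.
    have h3 : Icc (max (w - 1 / 2) (-1 / 2)) (min (w + 1 / 2) (1 / 2)) ⊆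
        {t | w - t ∈ Icc (-1 / 2 : ℝ) (1 / 2)} ∩ Icc (-1 / 2 : ℝ) (1 / 2) := by
      intro t ht
      simp only [mem_Icc, max_le_iff, le_min_iff] at ht
      simp only [mem_inter_iff, mem_ofPred_eq, mem_Icc]
      refine ⟨⟨?_, ?_⟩, ?_, ?_⟩ <;> linarith [ht.1.1, ht.1.2, ht.2.1, ht.2.2]
    have hms : MeasurableSet {t | w - t ∈ Icc (-1 / 2 : ℝ) (1 / 2)} :=
      (measurable_const.sub measurable_id) measurableSet_Icc
    have h4 : ∫⁻ t, (Icc (-1 / 2 : ℝ) (1 / 2)).indicator (1 : ℝ → ENNReal) (w - t) ∂unif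
        = volume ({t | w - t ∈ Icc (-1 / 2 : ℝ) (1 / 2)} ∩ Icc (-1 / 2 : ℝ) (1 / 2)) := by
      rw [unif_eq, ← Measure.restrict_apply hms, ← lintegral_indicator_one hms]
      rfl
    rw [h4]
    refine le_trans ?_ (measure_mono h3)
    rw [Real.volume_Icc]
    refine ENNReal.ofReal_le_ofReal ?_
    rcases le_total 0 w with h0 | h0
    · rw [abs_of_nonneg h0, min_eq_right (by linarith), max_eq_left (by linarith)]; linarith
    · rw [abs_of_nonpos h0, min_eq_left (by linarith), max_eq_right (by linarith)]; linarith
  refine le_trans ?_ (mul_le_mul_right h2 2)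
  rw [← ENNReal.ofReal_ofNat, ← ENNReal.ofReal_mul (by norm_num)]
  refine ENNReal.ofReal_le_ofReal ?_
  have h5 : 0 ≤ 1 - |w| := by linarith [abs_le.2 hw]
  have h6 : 1 - |w| ≤ 1 := by linarith [abs_nonneg w]
  rw [cubDensity, max_eq_left h5]
  gcongr
  exact pow_le_of_le_one h5 h6 (by norm_num)

/-- Cauchy–Schwarz against the indicator of an interval of length `η`. This smoothing from `L²` to
`L^∞` is what makes the nonlinear terms well defined on `L²`. -/
theorem abs_avg_le (hη : 0 < η) (V : L2) (x : ℝ) : |avg η V x| ≤ η ^ (-1 / 2 : ℝ) * ‖V‖ := by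
  have hle : x - η / 2 ≤ x + η / 2 := by linarith
  have hv : volume (Ioc (x - η / 2) (x + η / 2)) ≠ ⊤ := by simp
  have h1 : ∫ y in (x - η / 2)..(x + η / 2), V y
      = inner ℝ (indicatorConstLp 2 measurableSet_Ioc hv (1 : ℝ)) V := by
    rw [L2.inner_indicatorConstLp_one, intervalIntegral.integral_of_le hle]
  have h2 : ‖indicatorConstLp 2 measurableSet_Ioc hv (1 : ℝ)‖ = η ^ (1 / 2 : ℝ) := by
    rw [norm_indicatorConstLp (by norm_num) (by norm_num)]
    simp [Measure.real, hη.le]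
  rw [avg, h1, abs_mul, abs_of_pos (by positivity)]
  have h3 := abs_real_inner_le_norm (indicatorConstLp 2 measurableSet_Ioc hv (1 : ℝ)) V
  rw [h2] at h3
  calc _ ≤ 1 / η * (η ^ (1 / 2 : ℝ) * ‖V‖) := by gcongr
    _ = η ^ (-1 / 2 : ℝ) * ‖V‖ := by
      rw [← mul_assoc, one_div, ← Real.rpow_neg_one, ← Real.rpow_add hη]; norm_num

end Kernels

/-! ### The averaging operator on `L²(ℝ)` and its energy loss -/

section Averages

variable {f g : ℝ → ℝ} {η : ℝ}

theorem measurable_coe (V : L2) : Measurable (V : ℝ → ℝ) := (Lp.stronglyMeasurable V).measurable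

theorem avg_congr (h : f =ᵐ[volume] g) : avg η f = avg η g := by
  funext x
  rw [avg, avg, intervalIntegral.integral_congr_ae (h.mono fun y hy _ => hy)]

theorem intervalIntegrable_of_locallyIntegrable (hf : LocallyIntegrable f) (a b : ℝ) :
    IntervalIntegrable f volume a b :=
  (hf.integrableOn_isCompact isCompact_uIcc).intervalIntegrable

theorem avg_add (hf : LocallyIntegrable f) (hg : LocallyIntegrable g) :
    avg η (fun x => f x + g x) = fun x => avg η f x + avg η g x := by
  funext x
  simp only [avg]
  rw [intervalIntegral.integral_add (intervalIntegrable_of_locallyIntegrable hf _ _)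
    (intervalIntegrable_of_locallyIntegrable hg _ _)]
  ring

theorem avg_sub (hf : LocallyIntegrable f) (hg : LocallyIntegrable g) :
    avg η (fun x => f x - g x) = fun x => avg η f x - avg η g x := by
  funext x
  simp only [avg]
  rw [intervalIntegral.integral_sub (intervalIntegrable_of_locallyIntegrable hf _ _)
    (intervalIntegrable_of_locallyIntegrable hg _ _)]
  ring

theorem avg_const_mul (c : ℝ) : avg η (fun x => c * f x) = fun x => c * avg η f x := by
  funext x
  simp only [avg, intervalIntegral.integral_const_mul]
  ring

theorem locallyIntegrable_of_memLp (hf : MemLp f 2 (volume : Measure ℝ)) : LocallyIntegrable f :=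
  hf.locallyIntegrable (by norm_num)

theorem measurable_avg (hη : 0 < η) (hf : Measurable f) : Measurable (avg η f) := by
  rw [avg_eq_smear hη.ne']; exact measurable_smear hf

theorem memLp_avg (hη : 0 < η) (hf : Measurable f) (hf2 : MemLp f 2 (volume : Measure ℝ)) :
    MemLp (avg η f) 2 (volume : Measure ℝ) := by
  rw [avg_eq_smear hη.ne']; exact memLp_smear hf hf2

theorem norm_toL2_avg_le (hη : 0 < η) (hf : Measurable f) (hf2 : MemLp f 2 (volume : Measure ℝ)) :
    ‖toL2 (avg η f)‖ ≤ ‖toL2 f‖ := by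
  rw [avg_eq_smear hη.ne']; exact norm_toL2_smear_le hf hf2

theorem abs_avg_le_of_bound (hη : 0 < η) {C : ℝ} (h : ∀ x, |f x| ≤ C) (x : ℝ) :
    |avg η f x| ≤ C := by
  rw [avg_eq_smear hη.ne']; exact abs_smear_le h x

theorem avg_comp_neg (hη : 0 < η) (x : ℝ) : avg η (fun y => f (-y)) x = avg η f (-x) := by
  rw [avg_eq_smear hη.ne', avg_eq_smear hη.ne']; exact smear_comp_neg x

theorem integral_avg_mul_comm (hη : 0 < η) (hf : Measurable f)
    (hf2 : MemLp f 2 (volume : Measure ℝ)) (hg : Measurable g)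
    (hg2 : MemLp g 2 (volume : Measure ℝ)) :
    ∫ x, avg η f x * g x = ∫ x, f x * avg η g x := by
  rw [avg_eq_smear hη.ne', avg_eq_smear hη.ne']; exact integral_smear_mul_comm hf hf2 hg hg2

/-- The average `A_η V` as an element of `L²(ℝ)`. -/
def opA (η : ℝ) (V : L2) : L2 := toL2 (avg η V)

theorem memLp_avg_coe (hη : 0 < η) (V : L2) : MemLp (avg η V) 2 (volume : Measure ℝ) :=
  memLp_avg hη (measurable_coe V) (Lp.memLp V)

theorem measurable_avg_coe (hη : 0 < η) (V : L2) : Measurable (avg η V) :=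
  measurable_avg hη (measurable_coe V)

theorem avg_coe_add (V W : L2) : avg η ⇑(V + W) = fun x => avg η V x + avg η W x := by
  rw [← avg_add (locallyIntegrable_of_memLp (Lp.memLp V)) (locallyIntegrable_of_memLp (Lp.memLp W))]
  exact avg_congr (Lp.coeFn_add V W)

theorem avg_coe_sub (V W : L2) : avg η ⇑(V - W) = fun x => avg η V x - avg η W x := by
  rw [← avg_sub (locallyIntegrable_of_memLp (Lp.memLp V)) (locallyIntegrable_of_memLp (Lp.memLp W))]
  exact avg_congr (Lp.coeFn_sub V W)

theorem avg_coe_smul (c : ℝ) (V : L2) : avg η ⇑(c • V) = fun x => c * avg η V x := by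
  rw [← avg_const_mul]
  exact avg_congr (Lp.coeFn_smul c V)

theorem avg_toL2 (hf : MemLp f 2 (volume : Measure ℝ)) : avg η (toL2 f) = avg η f :=
  avg_congr (coeFn_toL2 hf)

theorem avg_opA (hη : 0 < η) (V : L2) : avg η (opA η V) = avg η (avg η V) :=
  avg_toL2 (memLp_avg_coe hη V)

theorem norm_opA_le (hη : 0 < η) (V : L2) : ‖opA η V‖ ≤ ‖V‖ := by
  have := norm_toL2_avg_le hη (measurable_coe V) (Lp.memLp V)
  rwa [toL2_coe] at this

theorem inner_opA (hη : 0 < η) (V W : L2) : inner ℝ (opA η V) W = inner ℝ V (opA η W) := by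
  conv_lhs => rw [← toL2_coe W]
  conv_rhs => rw [← toL2_coe V]
  rw [opA, opA, inner_toL2 (memLp_avg_coe hη V) (Lp.memLp W),
    inner_toL2 (Lp.memLp V) (memLp_avg_coe hη W)]
  exact integral_avg_mul_comm hη (measurable_coe V) (Lp.memLp V) (measurable_coe W) (Lp.memLp W)

/-- The loss of energy under averaging. -/
def energyGap (η : ℝ) (V : L2) : ℝ := ‖V‖ ^ 2 - ‖opA η V‖ ^ 2

theorem energyGap_nonneg (hη : 0 < η) (V : L2) : 0 ≤ energyGap η V := by
  have := norm_opA_le hη V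
  rw [energyGap, sub_nonneg]
  gcongr

/-- Self-adjointness turns the quadratic form of `A_η²` into `‖A_η V‖²`, so the quadratic form of
`B_ε` is built from energy gaps. -/
theorem inner_sub_opA_opA (hη : 0 < η) (V : L2) :
    inner ℝ (V - opA η (opA η V)) V = energyGap η V := by
  rw [inner_sub_left, inner_opA hη (opA η V), real_inner_self_eq_norm_sq,
    real_inner_self_eq_norm_sq, energyGap]

/-- By Jensen, the left side is at most the `cub`-average of `‖V(· + η s) - V‖²`. Passing to two
copies of `unif` costs a factor `2`, and the resulting average is exactly twice the energy gap. No
smoothness of `V` enters. -/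
theorem norm_sub_smear_cub_sq_le (hη : 0 < η) (V : L2) :
    ‖V - toL2 (smear cub η V)‖ ^ 2 ≤ 4 * energyGap η V := by
  have hV := measurable_coe V
  have hV2 := Lp.memLp V
  set ρ : ℝ → ℝ := fun s => ∫ x, V (x + η * s) * V x with hρ
  have hρm : Measurable ρ := by
    have : Measurable fun p : ℝ × ℝ => V (p.2 + η * p.1) * V p.2 :=
      (hV.comp (by fun_prop)).mul (hV.comp measurable_snd)
    exact (StronglyMeasurable.integral_prod_right' (ν := volume) this.stronglyMeasurable).measurable
  -- `ρ` is the autocorrelation of `V`, and `H s` is the squared norm of `V(· + η s) - V` after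
  -- expanding the square.
  set H : ℝ → ℝ := fun s => 2 * ‖V‖ ^ 2 - 2 * ρ s with hH
  have hHm : Measurable H := measurable_const.sub (hρm.const_mul 2)
  have hVV : ‖V‖ ^ 2 = ∫ x, V x * V x := by
    rw [← real_inner_self_eq_norm_sq, inner_eq_integral]
  have htr : ∀ s, ‖toL2 fun x => V (x + η * s)‖ = ‖V‖ := by
    intro s
    rw [norm_toL2 (memLp_comp_add_right hV2 _), eLpNorm_comp_add_right hV.aestronglyMeasurable,
      ← norm_toL2 hV2, toL2_coe]
  have hHs : ∀ s, eLpNorm (fun x => V (x + η * s) - V x) 2 volume ^ 2 = ENNReal.ofReal (H s) := by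
    intro s
    have hm : MemLp (fun x => V (x + η * s) - V x) 2 (volume : Measure ℝ) :=
      (memLp_comp_add_right hV2 _).sub hV2
    rw [← ENNReal.ofReal_toReal hm.2.ne, ← norm_toL2 hm, ← ENNReal.ofReal_pow (norm_nonneg _),
      toL2_sub (memLp_comp_add_right hV2 _) hV2, norm_sub_sq_real, htr, toL2_coe]
    congr 1
    have : inner ℝ (toL2 fun x => V (x + η * s)) V = ρ s := by
      conv_lhs => rw [← toL2_coe V]
      rw [inner_toL2 (memLp_comp_add_right (Lp.memLp _) _) (Lp.memLp _), toL2_coe]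
    rw [this]; ring
  have hρb : ∀ s, |ρ s| ≤ ‖V‖ ^ 2 := by
    intro s
    have h1 := abs_real_inner_le_norm (toL2 fun x => V (x + η * s)) (toL2 V)
    rw [inner_toL2 (memLp_comp_add_right hV2 _) hV2, htr, toL2_coe, ← sq] at h1
    exact h1
  have hH0 : ∀ s, 0 ≤ H s := fun s => by have := abs_le.1 (hρb s); simp only [hH]; linarith
  have hHb : ∀ s, |H s| ≤ 4 * ‖V‖ ^ 2 := fun s => by
    rw [abs_of_nonneg (hH0 s)]; have := abs_le.1 (hρb s); simp only [hH]; linarith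
  have hHi : ∀ t, Integrable (fun s => H (s + t)) unif := fun t =>
    Integrable.of_bound (hHm.comp (measurable_add_const t)).aestronglyMeasurable _
      (ae_of_all _ fun s => hHb _)
  have hρi : ∀ t, Integrable (fun s => ρ (s + t)) unif := fun t =>
    Integrable.of_bound (hρm.comp (measurable_add_const t)).aestronglyMeasurable _
      (ae_of_all _ fun s => hρb _)
  have hmm : ∀ {k : ℝ → ℝ}, Measurable k →
      StronglyMeasurable fun t => ∫ s, k (s + t) ∂unif := fun {k} hk => by
    have : Measurable fun p : ℝ × ℝ => k (p.2 + p.1) := hk.comp (by fun_prop)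
    exact StronglyMeasurable.integral_prod_right' (ν := unif) this.stronglyMeasurable
  have hHi2 : Integrable (fun t => ∫ s, H (s + t) ∂unif) unif := by
    refine Integrable.of_bound (hmm hHm).aestronglyMeasurable (4 * ‖V‖ ^ 2) (ae_of_all _ fun t => ?_)
    have := norm_integral_le_of_norm_le_const (μ := unif) (f := fun s => H (s + t))
      (ae_of_all _ fun s => hHb (s + t))
    simpa using this
  have hρi2 : Integrable (fun t => ∫ s, ρ (s + t) ∂unif) unif := by
    refine Integrable.of_bound (hmm hρm).aestronglyMeasurable (‖V‖ ^ 2) (ae_of_all _ fun t => ?_)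
    have := norm_integral_le_of_norm_le_const (μ := unif) (f := fun s => ρ (s + t))
      (ae_of_all _ fun s => hρb (s + t))
    simpa using this
  have h1 : eLpNorm (fun x => smear cub η V x - V x) 2 volume ^ 2
      ≤ ∫⁻ s, eLpNorm (fun x => V (x + η * s) - V x) 2 volume ^ 2 ∂cub := by
    have h2 : (fun x => smear cub η V x - V x)
        =ᵐ[volume] fun x => ∫ s, (V (x + η * s) - V x) ∂cub := by
      filter_upwards [ae_integrable_smear (μ := cub) (η := η) hV hV2] with x hx
      rw [integral_sub hx (integrable_const _)]
      simp [smear]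
    rw [eLpNorm_congr_ae h2]
    refine eLpNorm_integral_sq_le cub (F := fun s x => V (x + η * s) - V x) ?_
    exact (hV.comp (by fun_prop : Measurable fun p : ℝ × ℝ => p.2 + η * p.1)).sub
      (hV.comp measurable_snd)
  have h3 : ∫⁻ t, ∫⁻ s, ENNReal.ofReal (H (s + t)) ∂unif ∂unif
      = ENNReal.ofReal (∫ t, ∫ s, H (s + t) ∂unif ∂unif) := by
    rw [ofReal_integral_eq_lintegral_ofReal hHi2
      (ae_of_all _ fun t => integral_nonneg fun s => hH0 _)]
    refine lintegral_congr fun t => ?_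
    rw [ofReal_integral_eq_lintegral_ofReal (hHi t) (ae_of_all _ fun s => hH0 _)]
  -- Averaging the autocorrelation twice pairs `A_η² V` with `V`, and self-adjointness turns this
  -- into `‖A_η V‖²`.
  have h4 : ∫ t, ∫ s, ρ (s + t) ∂unif ∂unif = ‖opA η V‖ ^ 2 := by
    have h5 : ∀ t, ∫ s, ρ (s + t) ∂unif = ∫ x, avg η V (x + η * t) * V x := by
      intro t
      have h6 := integral_smear_mul (μ := unif) (η := η) (f := fun x => V (x + η * t))
        (hV.comp (measurable_add_const _)) (memLp_comp_add_right hV2 _) hV hV2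
      have h7 : ∀ x, smear unif η (fun x => V (x + η * t)) x = avg η V (x + η * t) := by
        intro x
        rw [avg_eq_smear hη.ne', smear, smear]
        congr 1; funext s; congr 1; ring
      simp_rw [h7] at h6
      rw [h6]
      refine integral_congr_ae (ae_of_all _ fun s => ?_)
      simp only [hρ]
      congr 1; funext x; congr 2; ring
    simp_rw [h5]
    have h8 := integral_smear_mul (μ := unif) (η := η) (measurable_avg_coe hη V)
      (memLp_avg_coe hη V) hV hV2
    rw [← h8, ← avg_eq_smear hη.ne', integral_avg_mul_comm hη (measurable_avg_coe hη V)
      (memLp_avg_coe hη V) hV hV2, ← real_inner_self_eq_norm_sq, opA,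
      inner_toL2 (memLp_avg_coe hη V) (memLp_avg_coe hη V)]
  have h9 : ∫ t, ∫ s, H (s + t) ∂unif ∂unif = 2 * energyGap η V := by
    have : ∀ t, ∫ s, H (s + t) ∂unif = 2 * ‖V‖ ^ 2 - 2 * ∫ s, ρ (s + t) ∂unif := by
      intro t
      simp only [hH]
      rw [integral_sub (integrable_const _) ((hρi t).const_mul 2), integral_const_mul,
        integral_const_mul]
      simp
    simp_rw [this]
    rw [integral_sub (integrable_const _) (hρi2.const_mul 2), integral_const_mul,
      integral_const_mul, h4]
    simp [energyGap]; ring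
  have hm : MemLp (fun x => smear cub η V x - V x) 2 (volume : Measure ℝ) :=
    (memLp_smear hV hV2).sub hV2
  have h10 : ENNReal.ofReal (‖V - toL2 (smear cub η V)‖ ^ 2) ≤ ENNReal.ofReal (4 * energyGap η V) := by
    have : toL2 (fun x => smear cub η V x - V x) = toL2 (smear cub η V) - V := by
      rw [toL2_sub (memLp_smear hV hV2) hV2, toL2_coe]
    rw [norm_sub_rev, ← this, norm_toL2 hm, ENNReal.ofReal_pow ENNReal.toReal_nonneg,
      ENNReal.ofReal_toReal hm.2.ne]
    refine h1.trans ?_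
    simp_rw [hHs]
    refine (cub_le_unif_conv hHm.ennreal_ofReal).trans ?_
    rw [h3, h9, ← ENNReal.ofReal_ofNat, ← ENNReal.ofReal_mul (by norm_num)]
    refine ENNReal.ofReal_le_ofReal ?_
    linarith
  exact (ENNReal.ofReal_le_ofReal_iff (by have := energyGap_nonneg hη V; positivity)).1 h10

end Averages

/-! ### Reflection and even functions -/

section Reflection

variable {f g : ℝ → ℝ} {η : ℝ}

/-- The reflection `V(x) ↦ V(-x)` on `L²(ℝ)`. -/
def reflect : L2 →ₗᵢ[ℝ] L2 :=
  Lp.compMeasurePreservingₗᵢ ℝ (Neg.neg : ℝ → ℝ) (Measure.measurePreserving_neg volume)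

theorem coeFn_reflect (V : L2) : reflect V =ᵐ[volume] fun x => V (-x) :=
  Lp.coeFn_compMeasurePreserving V (Measure.measurePreserving_neg volume)

theorem mem_L2even_iff {V : L2} : V ∈ L2even ↔ reflect V = V := by
  rw [L2even, mem_ofPred_eq]
  constructor
  · intro h
    exact Lp.ext ((coeFn_reflect V).trans h)
  · intro h
    have := coeFn_reflect V
    rw [h] at this
    exact this.symm

theorem toL2_mem_L2even (hf : ∀ x, f (-x) = f x) : toL2 f ∈ L2even := by
  by_cases h : MemLp f 2 (volume : Measure ℝ)
  · have h1 := coeFn_toL2 h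
    have h2 := (Measure.measurePreserving_neg (volume : Measure ℝ)).quasiMeasurePreserving.ae_eq_comp h1
    filter_upwards [h1, h2] with x hx hx'
    simp only [Function.comp_apply] at hx'
    rw [hx, hx', hf]
  -- Outside `L²` the class is `0` by convention, which is even; no integrability hypothesis is
  -- therefore required.
  · rw [toL2, dif_neg h, mem_L2even_iff, map_zero]

/-- The even functions, as a subspace of `L²(ℝ)`. -/
def evenSubmodule : Submodule ℝ L2 := LinearMap.eqLocus reflect.toLinearMap LinearMap.id

theorem mem_evenSubmodule {V : L2} : V ∈ evenSubmodule ↔ V ∈ L2even := by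
  rw [mem_L2even_iff]; rfl

theorem isClosed_evenSubmodule : IsClosed (evenSubmodule : Set L2) :=
  isClosed_eq reflect.continuous continuous_id

/-- Reflection is a bounded linear map, so it commutes with the Bochner integral. -/
theorem bochner_mem_L2even {f : ℝ → ℝ → ℝ} (hf : BochnerWellDefined f)
    (he : ∀ ξ, 0 < ξ → toL2 (f ξ) ∈ L2even) : bochner f ∈ L2even := by
  rw [mem_L2even_iff, bochner]
  have := reflect.toContinuousLinearMap.integral_comp_comm hf.2
  change _ = reflect _ at this
  rw [← this]
  refine setIntegral_congr_fun measurableSet_Ioi fun ξ hξ => ?_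
  exact mem_L2even_iff.1 (he ξ hξ)

theorem avg_coe_even (hη : 0 < η) {V : L2} (hV : V ∈ L2even) (x : ℝ) :
    avg η V (-x) = avg η V x := by
  rw [← avg_comp_neg hη, avg_congr hV]

theorem avg_even (hη : 0 < η) (hf : ∀ x, f (-x) = f x) (x : ℝ) : avg η f (-x) = avg η f x := by
  rw [← avg_comp_neg hη]; simp_rw [hf]

end Reflection

/-! ### Bochner integrals of families of functions -/

section BochnerFamilies

/-- The weight `c` is split off because it is only almost everywhere strongly measurable on the half
line, while `F` is jointly Borel measurable and gives a measurable curve in `L²`. Domination by `b`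
then yields integrability. -/
theorem bochnerWellDefined_of_le {f F : ℝ → ℝ → ℝ} {c b : ℝ → ℝ}
    (hf : ∀ ξ, 0 < ξ → ∀ x, f ξ x = c ξ * F ξ x)
    (hc : AEStronglyMeasurable c (volume.restrict (Ioi 0)))
    (hF : Measurable (Function.uncurry F))
    (hF2 : ∀ ξ, 0 < ξ → MemLp (F ξ) 2 (volume : Measure ℝ))
    (hb : IntegrableOn b (Ioi 0)) (h : ∀ ξ, 0 < ξ → |c ξ| * ‖toL2 (F ξ)‖ ≤ b ξ) :
    BochnerWellDefined f := by
  have hf' : ∀ ξ, 0 < ξ → f ξ = fun x => c ξ * F ξ x := fun ξ hξ => funext (hf ξ hξ)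
  refine ⟨fun ξ hξ => ?_, ?_⟩
  · rw [hf' ξ hξ]; exact (hF2 ξ hξ).const_mul _
  -- The family is cut off at `ξ ≤ 0`, where square-integrability is not known.
  have hG : Measurable (Function.uncurry fun ξ x => if 0 < ξ then F ξ x else 0) := by
    refine Measurable.ite (measurableSet_lt measurable_const measurable_fst) hF measurable_const
  have hG2 : ∀ ξ, MemLp (fun x => if 0 < ξ then F ξ x else 0) 2 (volume : Measure ℝ) := by
    intro ξ
    by_cases hξ : 0 < ξ
    · simpa [hξ] using hF2 ξ hξ
    · simp [hξ]
  have hm := hc.smul (stronglyMeasurable_toL2 hG hG2).aestronglyMeasurable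
  have he : ∀ ξ ∈ Ioi (0 : ℝ), (c ξ • toL2 fun x => if 0 < ξ then F ξ x else 0) = toL2 (f ξ) := by
    intro ξ hξ
    rw [hf' ξ hξ, toL2_const_mul _ (hF2 ξ hξ)]
    simp [mem_Ioi.1 hξ]
  refine Integrable.mono' hb (hm.congr ?_) ?_
  · exact (ae_restrict_mem measurableSet_Ioi).mono he
  · filter_upwards [ae_restrict_mem measurableSet_Ioi] with ξ hξ
    rw [hf' ξ hξ, toL2_const_mul _ (hF2 ξ hξ), norm_smul]
    exact h ξ hξ

theorem norm_bochner_le {f : ℝ → ℝ → ℝ} {b : ℝ → ℝ} (hb : IntegrableOn b (Ioi 0))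
    (h : ∀ ξ, 0 < ξ → ‖toL2 (f ξ)‖ ≤ b ξ) : ‖bochner f‖ ≤ ∫ ξ in Ioi 0, b ξ :=
  norm_integral_le_of_norm_le hb ((ae_restrict_mem measurableSet_Ioi).mono h)

theorem inner_bochner {f : ℝ → ℝ → ℝ} (hf : BochnerWellDefined f) (U : L2) :
    inner ℝ (bochner f) U = ∫ ξ in Ioi 0, inner ℝ (toL2 (f ξ)) U := by
  rw [real_inner_comm, bochner, ← integral_inner hf.2]
  simp_rw [real_inner_comm U]

theorem bochner_sub {f g : ℝ → ℝ → ℝ} (hf : BochnerWellDefined f) (hg : BochnerWellDefined g) :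
    bochner f - bochner g = bochner fun ξ x => f ξ x - g ξ x := by
  rw [bochner, bochner, bochner, ← integral_sub hf.2 hg.2]
  exact setIntegral_congr_fun measurableSet_Ioi fun ξ hξ => (toL2_sub (hf.1 ξ hξ) (hg.1 ξ hξ)).symm

end BochnerFamilies

/-! ### The bilinear operation behind the quadratic terms -/

section Bilinear

variable {η : ℝ}

/-- The bilinear operation `A_η ((A_η U) (A_η V))`. -/
def opT (η : ℝ) (U V : L2) : L2 := toL2 (avg η fun y => avg η U y * avg η V y)

theorem memLp_avg_mul_avg (hη : 0 < η) (U V : L2) :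
    MemLp (fun y => avg η U y * avg η V y) 2 (volume : Measure ℝ) := by
  refine memLp_of_abs_le (C := η ^ (-1 / 2 : ℝ) * ‖U‖)
    ((measurable_avg_coe hη U).mul (measurable_avg_coe hη V)).aestronglyMeasurable
    (memLp_avg_coe hη V) fun x => ?_
  rw [abs_mul]
  gcongr
  exact abs_avg_le hη U x

theorem measurable_avg_mul_avg (hη : 0 < η) (U V : L2) :
    Measurable fun y => avg η U y * avg η V y :=
  (measurable_avg_coe hη U).mul (measurable_avg_coe hη V)

theorem memLp_opT (hη : 0 < η) (U V : L2) :
    MemLp (avg η fun y => avg η U y * avg η V y) 2 (volume : Measure ℝ) :=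
  memLp_avg hη (measurable_avg_mul_avg hη U V) (memLp_avg_mul_avg hη U V)

theorem norm_opT_le_of_bound (hη : 0 < η) {C : ℝ} {U : L2} (hU : ∀ x, |avg η U x| ≤ C) (V : L2) :
    ‖opT η U V‖ ≤ C * ‖V‖ := by
  have hC : 0 ≤ C := (abs_nonneg _).trans (hU 0)
  calc ‖opT η U V‖ ≤ ‖toL2 fun y => avg η U y * avg η V y‖ :=
        norm_toL2_avg_le hη (measurable_avg_mul_avg hη U V) (memLp_avg_mul_avg hη U V)
    _ ≤ C * ‖opA η V‖ := by
        refine norm_toL2_le_of_abs_le hC (measurable_avg_mul_avg hη U V).aestronglyMeasurable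
          (memLp_avg_coe hη V) fun x => ?_
        rw [abs_mul]
        gcongr
        exact hU x
    _ ≤ C * ‖V‖ := by gcongr; exact norm_opA_le hη V

theorem norm_opT_le (hη : 0 < η) (U V : L2) :
    ‖opT η U V‖ ≤ η ^ (-1 / 2 : ℝ) * ‖U‖ * ‖V‖ :=
  norm_opT_le_of_bound hη (abs_avg_le hη U) V

/-- For fixed `U` this is averaging, multiplication by the function `A_η U`, and averaging again,
hence a symmetric operator. -/
theorem inner_opT (hη : 0 < η) (U V W : L2) :
    inner ℝ (opT η U V) W = inner ℝ V (opT η U W) := by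
  conv_lhs => rw [← toL2_coe W]
  conv_rhs => rw [← toL2_coe V]
  rw [opT, opT, inner_toL2 (memLp_opT hη U V) (Lp.memLp W),
    inner_toL2 (Lp.memLp V) (memLp_opT hη U W),
    integral_avg_mul_comm hη (measurable_avg_mul_avg hη U V) (memLp_avg_mul_avg hη U V)
      (measurable_coe W) (Lp.memLp W),
    ← integral_avg_mul_comm hη (measurable_coe V) (Lp.memLp V)
      (measurable_avg_mul_avg hη U W) (memLp_avg_mul_avg hη U W)]
  congr 1; funext x; ring

/-- Averaged form of `u² - v² = (u + v)(u - v)`; it supplies the Lipschitz estimate for `Q_ε`. -/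
theorem opT_self_sub_self (hη : 0 < η) (U V : L2) :
    opT η U U - opT η V V = opT η (U + V) (U - V) := by
  rw [opT, opT, opT, ← toL2_sub (memLp_opT hη U U) (memLp_opT hη V V),
    ← avg_sub (locallyIntegrable_of_memLp (memLp_avg_mul_avg hη U U))
      (locallyIntegrable_of_memLp (memLp_avg_mul_avg hη V V))]
  congr 2; funext x
  rw [avg_coe_add, avg_coe_sub]
  ring

theorem measurable_avg_uncurry (ε : ℝ) (V : L2) :
    Measurable (Function.uncurry fun ξ x => smear unif (ε * ξ) V x) :=
  measurable_smear_uncurry (F := fun _ => V) ((measurable_coe V).comp measurable_snd)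
    (measurable_const_mul ε)

end Bilinear

/-! ### Well-definedness, symmetry and parity of the operators; bijectivity from a lower bound -/

namespace Medium

variable {M : Medium} {ε : ℝ}

/-- A single integrable moment makes the weight measurable on the half line, where powers of `ξ` can
be divided out. -/
theorem aestronglyMeasurable_of_mul_pow {k : ℝ → ℝ} {n : ℕ}
    (h : IntegrableOn (fun ξ => k ξ * ξ ^ n) (Ioi 0)) {m : ℕ} :
    AEStronglyMeasurable (fun ξ => k ξ * ξ ^ m) (volume.restrict (Ioi 0)) := by
  have h1 : AEStronglyMeasurable (fun ξ : ℝ => (k ξ * ξ ^ n) * ((ξ ^ n)⁻¹ * ξ ^ m))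
      (volume.restrict (Ioi 0)) := by
    refine h.aestronglyMeasurable.mul (Measurable.aestronglyMeasurable ?_)
    fun_prop
  refine h1.congr ?_
  filter_upwards [ae_restrict_mem measurableSet_Ioi] with ξ hξ
  have : ξ ^ n ≠ 0 := pow_ne_zero _ (ne_of_gt hξ)
  field_simp

theorem toL2_integrandB (hε : 0 < ε) (V : L2) {ξ : ℝ} (hξ : 0 < ξ) :
    toL2 (M.integrandB ε V ξ)
      = (M.α ξ * ξ ^ 2 / ε ^ 2) • (V - opA (ε * ξ) (opA (ε * ξ) V)) := by
  have hη := mul_pos hε hξ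
  have h1 : M.integrandB ε V ξ = fun x => (M.α ξ * ξ ^ 2 / ε ^ 2) *
      (V x - avg (ε * ξ) (opA (ε * ξ) V) x) := by
    funext x
    rw [integrandB, avg_opA hη]; ring
  rw [h1, toL2_const_mul, toL2_sub (Lp.memLp V) (memLp_avg_coe hη _), toL2_coe]
  · rfl
  · exact (Lp.memLp V).sub (memLp_avg_coe hη _)

theorem norm_sub_opA_opA_le {η : ℝ} (hη : 0 < η) (V : L2) : ‖V - opA η (opA η V)‖ ≤ 2 * ‖V‖ := by
  have h1 := norm_sub_le V (opA η (opA η V))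
  have h2 := norm_opA_le hη V
  have h3 := norm_opA_le hη (opA η V)
  linarith

theorem bochnerWellDefined_integrandB (hM : M.Admissible) (hε : 0 < ε) (V : L2) :
    BochnerWellDefined (M.integrandB ε V) := by
  refine bochnerWellDefined_of_le (c := fun ξ => M.α ξ * ξ ^ 2)
    (F := fun ξ x => (V x - smear unif (ε * ξ) (smear unif (ε * ξ) V) x) / ε ^ 2)
    (b := fun ξ => M.α ξ * ξ ^ 2 * (2 * ‖V‖ / ε ^ 2)) ?_ ?_ ?_ ?_ (hM.α_two.mul_const _) ?_
  · intro ξ hξ x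
    have hη := mul_pos hε hξ
    rw [integrandB, avg_eq_smear hη.ne', avg_eq_smear hη.ne']
  · exact aestronglyMeasurable_of_mul_pow hM.α_two
  · refine (Measurable.sub ((measurable_coe V).comp measurable_snd) ?_).div_const _
    exact measurable_smear_uncurry (measurable_avg_uncurry ε V) (measurable_const_mul ε)
  · intro ξ hξ
    have hη := mul_pos hε hξ
    simp_rw [div_eq_mul_inv]
    exact ((Lp.memLp V).sub (memLp_smear (measurable_smear (measurable_coe V))
      (memLp_smear (measurable_coe V) (Lp.memLp V)))).mul_const _
  · intro ξ hξ
    have hη := mul_pos hε hξ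
    have h1 := hM.α_nonneg ξ hξ
    rw [abs_of_nonneg (by positivity)]
    gcongr
    have h2 : (fun x => (V x - smear unif (ε * ξ) (smear unif (ε * ξ) V) x) / ε ^ 2)
        = fun x => (1 / ε ^ 2) * (V x - avg (ε * ξ) (opA (ε * ξ) V) x) := by
      funext x
      rw [avg_opA hη, avg_eq_smear hη.ne', avg_eq_smear hη.ne']; ring
    have h3 : MemLp (fun x => V x - avg (ε * ξ) (opA (ε * ξ) V) x) 2 (volume : Measure ℝ) :=
      (Lp.memLp V).sub (memLp_avg_coe hη _)
    rw [h2, toL2_const_mul _ h3,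
      toL2_sub (Lp.memLp V) (memLp_avg_coe hη _), toL2_coe, norm_smul,
      Real.norm_of_nonneg (by positivity), one_div, div_eq_inv_mul]
    gcongr
    exact norm_sub_opA_opA_le hη V

/-- The `L^∞` bound of an average contributes `(ε ξ)^(-1/2)`; this is where the moment of order
`5/2` of `β` enters. -/
theorem rpow_weight (hε : 0 < ε) {ξ : ℝ} (hξ : 0 < ξ) :
    ξ ^ 3 * (ε * ξ) ^ (-1 / 2 : ℝ) = ε ^ (-1 / 2 : ℝ) * ξ ^ (5 / 2 : ℝ) := by
  rw [Real.mul_rpow hε.le hξ.le, mul_left_comm, ← Real.rpow_natCast, ← Real.rpow_add hξ]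
  norm_num

theorem bochnerWellDefined_bilinear (hM : M.Admissible) (hε : 0 < ε) (U V : L2) :
    BochnerWellDefined (fun ξ x => M.β ξ * ξ ^ 3 *
      avg (ε * ξ) (fun y => avg (ε * ξ) U y * avg (ε * ξ) V y) x) := by
  refine bochnerWellDefined_of_le (c := fun ξ => M.β ξ * ξ ^ 3)
    (F := fun ξ => smear unif (ε * ξ) fun y => smear unif (ε * ξ) U y * smear unif (ε * ξ) V y)
    (b := fun ξ => M.β ξ * ξ ^ (5 / 2 : ℝ) * (ε ^ (-1 / 2 : ℝ) * ‖U‖ * ‖V‖)) ?_ ?_ ?_ ?_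
    (hM.β_fiveHalves.mul_const _) ?_
  · intro ξ hξ x
    have hη := mul_pos hε hξ
    simp_rw [avg_eq_smear hη.ne']
  · exact aestronglyMeasurable_of_mul_pow hM.β_three
  · exact measurable_smear_uncurry
      ((measurable_avg_uncurry ε U).mul (measurable_avg_uncurry ε V)) (measurable_const_mul ε)
  · intro ξ hξ
    have hη := mul_pos hε hξ
    have := memLp_opT hη U V
    simp_rw [avg_eq_smear hη.ne'] at this
    exact this
  · intro ξ hξ
    have hη := mul_pos hε hξ
    have h1 := hM.β_nonneg ξ hξ
    have h2 := norm_opT_le hη U V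
    simp_rw [opT, avg_eq_smear hη.ne'] at h2
    rw [abs_of_nonneg (by positivity)]
    calc _ ≤ M.β ξ * ξ ^ 3 * ((ε * ξ) ^ (-1 / 2 : ℝ) * ‖U‖ * ‖V‖) := by gcongr
      _ = M.β ξ * (ξ ^ 3 * (ε * ξ) ^ (-1 / 2 : ℝ)) * ‖U‖ * ‖V‖ := by ring
      _ = _ := by rw [rpow_weight hε hξ]; ring

theorem integrandQ_eq (V : L2) : M.integrandQ ε V = fun ξ x => M.β ξ * ξ ^ 3 *
      avg (ε * ξ) (fun y => avg (ε * ξ) V y * avg (ε * ξ) V y) x := by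
  funext ξ x
  simp only [integrandQ, sq]

theorem bochnerWellDefined_integrandQ (hM : M.Admissible) (hε : 0 < ε) (V : L2) :
    BochnerWellDefined (M.integrandQ ε V) := by
  rw [integrandQ_eq]; exact bochnerWellDefined_bilinear hM hε V V

theorem bochnerWellDefined_integrandM (hM : M.Admissible) (hε : 0 < ε) (V : L2) :
    BochnerWellDefined (M.integrandM ε V) :=
  bochnerWellDefined_bilinear hM hε M.W₀ V

theorem toL2_integrandQ (hε : 0 < ε) (V : L2) {ξ : ℝ} (hξ : 0 < ξ) :
    toL2 (M.integrandQ ε V ξ) = (M.β ξ * ξ ^ 3) • opT (ε * ξ) V V := by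
  rw [integrandQ_eq, toL2_const_mul _ (memLp_opT (mul_pos hε hξ) V V)]; rfl

theorem toL2_integrandM (hε : 0 < ε) (V : L2) {ξ : ℝ} (hξ : 0 < ξ) :
    toL2 (M.integrandM ε V ξ) = (M.β ξ * ξ ^ 3) • opT (ε * ξ) M.W₀ V := by
  have : M.integrandM ε V ξ = fun x => M.β ξ * ξ ^ 3 *
      avg (ε * ξ) (fun y => avg (ε * ξ) M.W₀ y * avg (ε * ξ) V y) x := rfl
  rw [this, toL2_const_mul _ (memLp_opT (mul_pos hε hξ) M.W₀ V)]; rfl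

theorem inner_opB (hM : M.Admissible) (hε : 0 < ε) (V U : L2) :
    inner ℝ (M.opB ε V) U = inner ℝ V U + ∫ ξ in Ioi 0,
      M.α ξ * ξ ^ 2 / ε ^ 2 * inner ℝ (V - opA (ε * ξ) (opA (ε * ξ) V)) U := by
  rw [opB, inner_add_left, inner_bochner (bochnerWellDefined_integrandB hM hε V)]
  congr 1
  refine setIntegral_congr_fun measurableSet_Ioi fun ξ hξ => ?_
  rw [toL2_integrandB hε V hξ, real_inner_smul_left]

theorem inner_opM (hM : M.Admissible) (hε : 0 < ε) (V U : L2) :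
    inner ℝ (M.opM ε V) U = 2 * ∫ ξ in Ioi 0,
      M.β ξ * ξ ^ 3 * inner ℝ (opT (ε * ξ) M.W₀ V) U := by
  rw [opM, real_inner_smul_left, inner_bochner (bochnerWellDefined_integrandM hM hε V)]
  congr 1
  refine setIntegral_congr_fun measurableSet_Ioi fun ξ hξ => ?_
  rw [toL2_integrandM hε V hξ, real_inner_smul_left]

/-- Every bond contributes a symmetric operator, and inner products pass through the Bochner
integrals. -/
theorem inner_opL_comm (hM : M.Admissible) (hε : 0 < ε) (V U : L2) :
    inner ℝ (M.opL ε V) U = inner ℝ V (M.opL ε U) := by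
  rw [real_inner_comm _ V, opL, opL, inner_sub_left, inner_sub_left, inner_opB hM hε, inner_opB hM hε,
    inner_opM hM hε, inner_opM hM hε, real_inner_comm U V]
  congr 1
  · congr 1
    refine setIntegral_congr_fun measurableSet_Ioi fun ξ hξ => ?_
    have hη := mul_pos hε hξ
    rw [inner_sub_left, inner_sub_left, inner_opA hη, inner_opA hη, real_inner_comm U V,
      real_inner_comm (opA _ _) V]
  · congr 1
    refine setIntegral_congr_fun measurableSet_Ioi fun ξ hξ => ?_
    rw [inner_opT (mul_pos hε hξ), real_inner_comm]

/-- The symmetric operator `L_ε` is linear. -/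
def linL (M : Medium) (hM : M.Admissible) {ε : ℝ} (hε : 0 < ε) : L2 →ₗ[ℝ] L2 where
  toFun := M.opL ε
  -- Linearity is read off from symmetry: tested against `U`, `L_ε` acts only on `U`, and the inner
  -- product is linear in the remaining argument.
  map_add' V W := ext_inner_right ℝ fun U => by
    rw [inner_add_left]; simp only [inner_opL_comm hM hε, inner_add_left]
  map_smul' c V := ext_inner_right ℝ fun U => by
    simp only [inner_opL_comm hM hε, real_inner_smul_left, RingHom.id_apply]

theorem opA_mem_L2even {η : ℝ} (hη : 0 < η) {V : L2} (hV : V ∈ L2even) : opA η V ∈ L2even :=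
  toL2_mem_L2even (avg_coe_even hη hV)

theorem opT_mem_L2even {η : ℝ} (hη : 0 < η) {U V : L2} (hU : U ∈ L2even) (hV : V ∈ L2even) :
    opT η U V ∈ L2even :=
  toL2_mem_L2even (avg_even hη fun x => by rw [avg_coe_even hη hU, avg_coe_even hη hV])

theorem opB_mem_L2even (hM : M.Admissible) (hε : 0 < ε) {V : L2} (hV : V ∈ L2even) :
    M.opB ε V ∈ L2even := by
  refine mem_evenSubmodule.1 (add_mem (mem_evenSubmodule.2 hV) (mem_evenSubmodule.2 ?_))
  refine bochner_mem_L2even (bochnerWellDefined_integrandB hM hε V) fun ξ hξ => ?_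
  have hη := mul_pos hε hξ
  rw [toL2_integrandB hε V hξ, ← mem_evenSubmodule]
  exact Submodule.smul_mem _ _ (sub_mem (mem_evenSubmodule.2 hV)
    (mem_evenSubmodule.2 (opA_mem_L2even hη (opA_mem_L2even hη hV))))

theorem opQ_mem_L2even (hM : M.Admissible) (hε : 0 < ε) {V : L2} (hV : V ∈ L2even) :
    M.opQ ε V ∈ L2even := by
  refine bochner_mem_L2even (bochnerWellDefined_integrandQ hM hε V) fun ξ hξ => ?_
  rw [toL2_integrandQ hε V hξ, ← mem_evenSubmodule]
  exact Submodule.smul_mem _ _ (mem_evenSubmodule.2 (opT_mem_L2even (mul_pos hε hξ) hV hV))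

theorem opL_mem_L2even (hM : M.Admissible) (hε : 0 < ε) (hW : M.W₀ ∈ L2even) {V : L2}
    (hV : V ∈ L2even) : M.opL ε V ∈ L2even := by
  refine mem_evenSubmodule.1 (sub_mem (mem_evenSubmodule.2 (opB_mem_L2even hM hε hV))
    (Submodule.smul_mem _ _ (mem_evenSubmodule.2 ?_)))
  refine bochner_mem_L2even (bochnerWellDefined_integrandM hM hε V) fun ξ hξ => ?_
  rw [toL2_integrandM hε V hξ, ← mem_evenSubmodule]
  exact Submodule.smul_mem _ _ (mem_evenSubmodule.2 (opT_mem_L2even (mul_pos hε hξ) hW hV))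

/-- A symmetric operator that preserves the even functions and is bounded from below on them is
a bijection of the space of even functions. -/
theorem bijOn_opL (hM : M.Admissible) (hε : 0 < ε) (hW : M.W₀ ∈ L2even) {c : ℝ}
    (hc : 0 < c) (h : ∀ V ∈ L2even, c * ‖V‖ ≤ ‖M.opL ε V‖) :
    BijOn (M.opL ε) L2even L2even := by
  have hmaps : ∀ V ∈ evenSubmodule, linL M hM hε V ∈ evenSubmodule := fun V hV =>
    mem_evenSubmodule.2 (opL_mem_L2even hM hε hW (mem_evenSubmodule.1 hV))
  have : CompleteSpace evenSubmodule := isClosed_evenSubmodule.completeSpace_coe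
  set T : evenSubmodule →ₗ[ℝ] evenSubmodule := (linL M hM hε).restrict hmaps with hT
  have hTs : T.IsSymmetric := fun V U => inner_opL_comm hM hε (V : L2) (U : L2)
  have hTb : ∀ V, c * ‖V‖ ≤ ‖T V‖ := fun V => h V (mem_evenSubmodule.1 V.2)
  have hker : LinearMap.ker T = ⊥ := by
    rw [LinearMap.ker_eq_bot']
    intro V hV
    have := hTb V
    rw [hV, norm_zero] at this
    exact norm_le_zero_iff.1 (nonpos_of_mul_nonpos_right this hc)
  -- Hellinger–Toeplitz: a symmetric operator defined on a whole Hilbert space is continuous. No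
  -- operator norm bound is computed.
  let T' : evenSubmodule →L[ℝ] evenSubmodule := ⟨T, hTs.continuous⟩
  have hanti : AntilipschitzWith (Real.toNNReal c⁻¹) T' := by
    refine AddMonoidHomClass.antilipschitz_of_bound T' fun V => ?_
    rw [Real.coe_toNNReal _ (by positivity), ← div_eq_inv_mul, le_div_iff₀ hc, mul_comm]
    exact hTb V
  have hclosed : IsClosed (T.range : Set evenSubmodule) :=
    hanti.isClosed_range T'.uniformContinuous
  -- The lower bound makes the range closed. Its orthogonal complement is the kernel of the
  -- symmetric operator, which is trivial.
  have hrange : T.range = ⊤ := by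
    have : CompleteSpace T.range := hclosed.completeSpace_coe
    rw [← Submodule.orthogonal_eq_bot_iff, LinearMap.IsSymmetric.orthogonal_range hTs, hker]
  refine ⟨fun V hV => opL_mem_L2even hM hε hW hV, fun V hV U hU hVU => ?_, fun U hU => ?_⟩
  · have : T ⟨V, mem_evenSubmodule.2 hV⟩ = T ⟨U, mem_evenSubmodule.2 hU⟩ := Subtype.ext hVU
    exact congrArg Subtype.val (LinearMap.ker_eq_bot.1 hker this)
  · obtain ⟨V, hV⟩ := LinearMap.range_eq_top.1 hrange ⟨U, mem_evenSubmodule.2 hU⟩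
    exact ⟨V, mem_evenSubmodule.1 V.2, congrArg Subtype.val hV⟩

end Medium

/-! ### Averages of smooth functions in `L²(ℝ)` -/

section SmoothAverages

variable {μ : Measure ℝ} {η : ℝ} {f f' f'' : ℝ → ℝ}

theorem continuous_of_hasDerivAt (hf : ∀ x, HasDerivAt f (f' x) x) : Continuous f :=
  continuous_iff_continuousAt.2 fun x => (hf x).continuousAt

theorem norm_smear_sub_le [AveragingMeasure μ] (hf : ∀ x, HasDerivAt f (f' x) x)
    (hf' : Continuous f') (h2 : MemLp f 2 (volume : Measure ℝ))
    (h2' : MemLp f' 2 (volume : Measure ℝ)) :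
    ‖toL2 (smear μ η f) - toL2 f‖ ≤ |η| * ‖toL2 f'‖ := by
  have hm := (continuous_of_hasDerivAt hf).measurable
  have hs : MemLp (smear μ η f) 2 (volume : Measure ℝ) := memLp_smear hm h2
  have hd : MemLp (fun x => smear μ η f x - f x) 2 (volume : Measure ℝ) := hs.sub h2
  rw [← toL2_sub hs h2, norm_toL2 hd, norm_toL2 h2', ← ENNReal.toReal_ofReal (abs_nonneg η),
    ← ENNReal.toReal_mul]
  exact ENNReal.toReal_mono (ENNReal.mul_ne_top ENNReal.ofReal_ne_top h2'.2.ne)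
    (eLpNorm_smear_sub_le hf hf')

theorem norm_smear_sub_le_sq [AveragingMeasure μ] (hf : ∀ x, HasDerivAt f (f' x) x)
    (hf' : ∀ x, HasDerivAt f' (f'' x) x) (hf'' : Continuous f'')
    (h2 : MemLp f 2 (volume : Measure ℝ)) (h2'' : MemLp f'' 2 (volume : Measure ℝ)) :
    ‖toL2 (smear μ η f) - toL2 f‖ ≤ η ^ 2 * ‖toL2 f''‖ := by
  have hm := (continuous_of_hasDerivAt hf).measurable
  have hs : MemLp (smear μ η f) 2 (volume : Measure ℝ) := memLp_smear hm h2
  have hd : MemLp (fun x => smear μ η f x - f x) 2 (volume : Measure ℝ) := hs.sub h2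
  rw [← toL2_sub hs h2, norm_toL2 hd, norm_toL2 h2'', ← ENNReal.toReal_ofReal (sq_nonneg η),
    ← ENNReal.toReal_mul]
  exact ENNReal.toReal_mono (ENNReal.mul_ne_top ENNReal.ofReal_ne_top h2''.2.ne)
    (eLpNorm_smear_sub_le_sq hf hf' hf'')

theorem sub_opA_opA_toL2 (hη : 0 < η) (hf : ∀ x, HasDerivAt f (f' x) x)
    (hf' : ∀ x, HasDerivAt f' (f'' x) x) (hf'' : Continuous f'')
    (h2 : MemLp f 2 (volume : Measure ℝ)) (h2'' : MemLp f'' 2 (volume : Measure ℝ)) :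
    toL2 f - opA η (opA η (toL2 f)) = -(η ^ 2 / 12) • toL2 (smear cub η f'') := by
  have hm := (continuous_of_hasDerivAt hf).measurable
  have h3 := memLp_avg hη hm h2
  rw [← toL2_const_mul _ (memLp_smear hf''.measurable h2''), opA, avg_opA hη, avg_toL2 h2,
    ← toL2_sub h2 (memLp_avg hη (measurable_avg hη hm) h3)]
  congr 1; funext x
  exact smear_cub_eq hf hf' hf'' hη x

end SmoothAverages

/-! ### The Korteweg-de Vries wave and its residual -/

namespace Medium

variable {M : Medium} {ε : ℝ}

theorem d₁_pos (hM : M.Admissible) : 0 < M.d₁ := div_pos (by norm_num) hM.α_four_pos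

theorem d₂_pos (hM : M.Admissible) : 0 < M.d₂ :=
  div_pos (mul_pos (by norm_num) hM.β_three_pos) hM.α_four_pos

/-- The third moment of `β`. -/
def momentβ (M : Medium) : ℝ := ∫ ξ in Ioi 0, M.β ξ * ξ ^ 3

theorem momentβ_eq (hM : M.Admissible) : M.momentβ = M.d₂ / M.d₁ := by
  have := hM.α_four_pos
  rw [momentβ, d₁, d₂]
  field_simp

theorem integral_α_four (hM : M.Admissible) : ∫ ξ in Ioi 0, M.α ξ * ξ ^ 4 = 12 / M.d₁ := by
  have := hM.α_four_pos
  rw [d₁]; field_simp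

/-- The inverse length scale of the wave. -/
def rate (M : Medium) : ℝ := 1 / 2 * Real.sqrt M.d₁

theorem rate_pos (hM : M.Admissible) : 0 < M.rate := by
  have := Real.sqrt_pos.2 (d₁_pos hM)
  unfold rate; positivity

theorem rate_sq (hM : M.Admissible) : 4 * M.rate ^ 2 = M.d₁ := by
  rw [rate, mul_pow, Real.sq_sqrt (d₁_pos hM).le]; ring

/-- The amplitude of the wave. -/
def amp (M : Medium) : ℝ := 3 * M.d₁ / (2 * M.d₂)

theorem amp_pos (hM : M.Admissible) : 0 < M.amp := by
  have := d₁_pos hM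
  have := d₂_pos hM
  unfold amp; positivity

theorem kdvWave_eq (x : ℝ) : M.kdvWave x = M.amp * (1 / Real.cosh (M.rate * x)) ^ 2 := rfl

/-- Identifies the limit of `M_ε` with the potential term `3 sech²(a x)` of the linearized equation,
where `a` is `rate`. -/
theorem two_mul_momentβ_mul_kdvWave (hM : M.Admissible) (x : ℝ) :
    2 * M.momentβ * M.kdvWave x = 3 * (1 / Real.cosh (M.rate * x)) ^ 2 := by
  have := d₁_pos hM
  have := d₂_pos hM
  rw [momentβ_eq hM, kdvWave_eq, amp]
  field_simp

theorem kdvWave_nonneg (hM : M.Admissible) (x : ℝ) : 0 ≤ M.kdvWave x := by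
  have := amp_pos hM
  rw [kdvWave_eq]; positivity

theorem kdvWave_le (hM : M.Admissible) (x : ℝ) : M.kdvWave x ≤ M.amp := by
  have := amp_pos hM
  rw [kdvWave_eq]
  refine mul_le_of_le_one_right this.le (pow_le_one₀ (by positivity) ?_)
  rw [div_le_one (Real.cosh_pos _)]
  exact Real.one_le_cosh _

theorem abs_kdvWave_le (hM : M.Admissible) (x : ℝ) : |M.kdvWave x| ≤ M.amp := by
  rw [abs_of_nonneg (kdvWave_nonneg hM x)]; exact kdvWave_le hM x

/-- The derivative of the wave. -/
def kdvWaveDeriv (M : Medium) (x : ℝ) : ℝ :=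
  -2 * M.rate * M.amp * (Real.sinh (M.rate * x) / Real.cosh (M.rate * x) ^ 3)

theorem hasDerivAt_cosh_mul (a x : ℝ) :
    HasDerivAt (fun x => Real.cosh (a * x)) (a * Real.sinh (a * x)) x := by
  have h : HasDerivAt (fun x : ℝ => a * x) a x := by simpa using (hasDerivAt_id x).const_mul a
  exact h.cosh.congr_deriv (mul_comm _ _)

theorem hasDerivAt_sinh_mul (a x : ℝ) :
    HasDerivAt (fun x => Real.sinh (a * x)) (a * Real.cosh (a * x)) x := by
  have h : HasDerivAt (fun x : ℝ => a * x) a x := by simpa using (hasDerivAt_id x).const_mul a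
  exact h.sinh.congr_deriv (mul_comm _ _)

theorem hasDerivAt_kdvWave (x : ℝ) : HasDerivAt M.kdvWave (M.kdvWaveDeriv x) x := by
  have hc := (Real.cosh_pos (M.rate * x)).ne'
  have h := ((((hasDerivAt_cosh_mul M.rate x).fun_inv hc).fun_pow 2).const_mul M.amp)
  have h2 : M.kdvWave = fun x => M.amp * (Real.cosh (M.rate * x))⁻¹ ^ 2 := by
    funext x; rw [kdvWave_eq, one_div]
  rw [h2]
  refine h.congr_deriv ?_
  rw [kdvWaveDeriv]
  norm_num
  field_simp

/-- The profile equation `W₀'' = d₁ W₀ - d₂ W₀²`, on which the cancellation in `K_ε` rests. All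
higher derivatives of the wave are polynomials in `W₀` and `W₀'` through it. -/
theorem hasDerivAt_kdvWaveDeriv (hM : M.Admissible) (x : ℝ) :
    HasDerivAt M.kdvWaveDeriv (M.d₁ * M.kdvWave x - M.d₂ * M.kdvWave x ^ 2) x := by
  have hc := (Real.cosh_pos (M.rate * x)).ne'
  have h := ((hasDerivAt_sinh_mul M.rate x).fun_div ((hasDerivAt_cosh_mul M.rate x).fun_pow 3)
    (pow_ne_zero 3 hc)).const_mul (-2 * M.rate * M.amp)
  refine h.congr_deriv ?_
  have h1 := d₂_pos hM
  have h2 := Real.sinh_sq (M.rate * x)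
  have h3 : M.amp = 6 * M.rate ^ 2 / M.d₂ := by
    rw [amp, ← rate_sq hM]; field_simp; ring
  rw [kdvWave_eq, h3, ← rate_sq hM]
  field_simp
  push_cast
  linear_combination 6 * M.rate ^ 4 * Real.cosh (M.rate * x) ^ 2 * h2

/-- The first integral of the profile equation. As the cubic term is nonnegative, it bounds `|W₀'|`
by `√d₁ W₀`, so that the derivative inherits boundedness and square-integrability. -/
theorem kdvWaveDeriv_sq (hM : M.Admissible) (x : ℝ) :
    M.kdvWaveDeriv x ^ 2 = M.d₁ * M.kdvWave x ^ 2 - 2 / 3 * M.d₂ * M.kdvWave x ^ 3 := by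
  have hc := (Real.cosh_pos (M.rate * x)).ne'
  have h1 := d₂_pos hM
  have h2 := Real.sinh_sq (M.rate * x)
  have h3 : M.amp = 6 * M.rate ^ 2 / M.d₂ := by
    rw [amp, ← rate_sq hM]; field_simp; ring
  rw [kdvWaveDeriv, kdvWave_eq, h3, ← rate_sq hM]
  field_simp
  rw [h2]
  ring

theorem abs_kdvWaveDeriv_le (hM : M.Admissible) (x : ℝ) :
    |M.kdvWaveDeriv x| ≤ Real.sqrt M.d₁ * |M.kdvWave x| := by
  refine abs_le_of_sq_le_sq ?_ (by positivity)
  rw [mul_pow, Real.sq_sqrt (d₁_pos hM).le, sq_abs, kdvWaveDeriv_sq hM]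
  have := pow_nonneg (kdvWave_nonneg hM x) 3
  have := d₂_pos hM
  have : 0 ≤ 2 / 3 * M.d₂ * M.kdvWave x ^ 3 := by positivity
  linarith

theorem continuous_kdvWave : Continuous M.kdvWave := continuous_of_hasDerivAt hasDerivAt_kdvWave

theorem continuous_kdvWaveDeriv (hM : M.Admissible) : Continuous M.kdvWaveDeriv :=
  continuous_of_hasDerivAt (hasDerivAt_kdvWaveDeriv hM)

theorem memLp_of_le_kdvWave (hM : M.Admissible) {f : ℝ → ℝ} (hf : Continuous f) {C : ℝ}
    (h : ∀ x, |f x| ≤ C * |M.kdvWave x|) : MemLp f 2 (volume : Measure ℝ) :=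
  memLp_of_abs_le hf.aestronglyMeasurable (memLp_kdvWave M hM) h

theorem memLp_kdvWave_sq (hM : M.Admissible) :
    MemLp (fun x => M.kdvWave x ^ 2) 2 (volume : Measure ℝ) := by
  refine memLp_of_le_kdvWave hM (continuous_kdvWave.pow 2) (C := M.amp) fun x => ?_
  rw [sq, abs_mul]
  exact mul_le_mul_of_nonneg_right (abs_kdvWave_le hM x) (abs_nonneg _)

theorem memLp_kdvWaveDeriv (hM : M.Admissible) :
    MemLp M.kdvWaveDeriv 2 (volume : Measure ℝ) :=
  memLp_of_le_kdvWave hM (continuous_kdvWaveDeriv hM) (abs_kdvWaveDeriv_le hM)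

theorem abs_kdvWaveDeriv_le_const (hM : M.Admissible) (x : ℝ) :
    |M.kdvWaveDeriv x| ≤ Real.sqrt M.d₁ * M.amp :=
  (abs_kdvWaveDeriv_le hM x).trans (by gcongr; exact abs_kdvWave_le hM x)

/-- The second derivative of the wave. -/
def kdvWaveDeriv2 (M : Medium) (x : ℝ) : ℝ := M.d₁ * M.kdvWave x - M.d₂ * M.kdvWave x ^ 2

theorem memLp_kdvWaveDeriv2 (hM : M.Admissible) :
    MemLp M.kdvWaveDeriv2 2 (volume : Measure ℝ) :=
  ((memLp_kdvWave M hM).const_mul _).sub ((memLp_kdvWave_sq hM).const_mul _)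

theorem continuous_kdvWaveDeriv2 : Continuous M.kdvWaveDeriv2 := by
  have := continuous_kdvWave (M := M)
  unfold kdvWaveDeriv2; fun_prop

/-- The second derivative of the squared wave. -/
def kdvWaveSqDeriv2 (M : Medium) (x : ℝ) : ℝ :=
  2 * (M.kdvWaveDeriv x * M.kdvWaveDeriv x + M.kdvWave x * M.kdvWaveDeriv2 x)

theorem hasDerivAt_kdvWave_sq (x : ℝ) :
    HasDerivAt (fun x => M.kdvWave x ^ 2) (2 * (M.kdvWave x * M.kdvWaveDeriv x)) x :=
  ((hasDerivAt_kdvWave x).fun_pow 2).congr_deriv (by push_cast; ring)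

theorem hasDerivAt_kdvWave_sq_deriv (hM : M.Admissible) (x : ℝ) :
    HasDerivAt (fun x => 2 * (M.kdvWave x * M.kdvWaveDeriv x)) (M.kdvWaveSqDeriv2 x) x :=
  (((hasDerivAt_kdvWave x).fun_mul (hasDerivAt_kdvWaveDeriv hM x)).const_mul 2).congr_deriv
    (by rw [kdvWaveSqDeriv2, kdvWaveDeriv2])

theorem continuous_kdvWaveSqDeriv2 (hM : M.Admissible) : Continuous M.kdvWaveSqDeriv2 := by
  have := continuous_kdvWave (M := M)
  have := continuous_kdvWaveDeriv hM
  have := continuous_kdvWaveDeriv2 (M := M)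
  unfold kdvWaveSqDeriv2; fun_prop

theorem memLp_bounded_mul {f g : ℝ → ℝ} {C : ℝ} (hf : Continuous f) (hfC : ∀ x, |f x| ≤ C)
    (hg : MemLp g 2 (volume : Measure ℝ)) : MemLp (fun x => f x * g x) 2 (volume : Measure ℝ) :=
  memLp_of_abs_le (C := C) (hf.aestronglyMeasurable.mul hg.1) hg fun x => by
    rw [abs_mul]; exact mul_le_mul_of_nonneg_right (hfC x) (abs_nonneg _)

theorem memLp_kdvWaveSqDeriv2 (hM : M.Admissible) :
    MemLp M.kdvWaveSqDeriv2 2 (volume : Measure ℝ) :=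
  ((memLp_bounded_mul (continuous_kdvWaveDeriv hM) (abs_kdvWaveDeriv_le_const hM)
    (memLp_kdvWaveDeriv hM)).add (memLp_bounded_mul continuous_kdvWave (abs_kdvWave_le hM)
    (memLp_kdvWaveDeriv2 hM))).const_mul 2

/-- The fourth derivative of the wave. -/
def kdvWaveDeriv4 (M : Medium) (x : ℝ) : ℝ :=
  M.d₁ * M.kdvWaveDeriv2 x - M.d₂ * M.kdvWaveSqDeriv2 x

theorem hasDerivAt_kdvWaveDeriv2 (x : ℝ) : HasDerivAt M.kdvWaveDeriv2
    (M.d₁ * M.kdvWaveDeriv x - M.d₂ * (2 * (M.kdvWave x * M.kdvWaveDeriv x))) x :=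
  ((hasDerivAt_kdvWave x).const_mul _).sub ((hasDerivAt_kdvWave_sq x).const_mul _)

theorem hasDerivAt_kdvWaveDeriv3 (hM : M.Admissible) (x : ℝ) : HasDerivAt
    (fun x => M.d₁ * M.kdvWaveDeriv x - M.d₂ * (2 * (M.kdvWave x * M.kdvWaveDeriv x)))
    (M.kdvWaveDeriv4 x) x :=
  ((hasDerivAt_kdvWaveDeriv hM x).const_mul _).sub
    ((hasDerivAt_kdvWave_sq_deriv hM x).const_mul _)

theorem continuous_kdvWaveDeriv4 (hM : M.Admissible) : Continuous M.kdvWaveDeriv4 :=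
  (continuous_kdvWaveDeriv2.const_mul _).sub ((continuous_kdvWaveSqDeriv2 hM).const_mul _)

theorem memLp_kdvWaveDeriv4 (hM : M.Admissible) :
    MemLp M.kdvWaveDeriv4 2 (volume : Measure ℝ) :=
  ((memLp_kdvWaveDeriv2 hM).const_mul _).sub ((memLp_kdvWaveSqDeriv2 hM).const_mul _)

theorem W₀_mem_L2even : M.W₀ ∈ L2even :=
  toL2_mem_L2even fun x => by rw [kdvWave_eq, kdvWave_eq, mul_neg, Real.cosh_neg]

theorem avg_W₀ (hM : M.Admissible) (η : ℝ) : avg η M.W₀ = avg η M.kdvWave :=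
  avg_toL2 (memLp_kdvWave M hM)

theorem abs_avg_W₀_le (hM : M.Admissible) {η : ℝ} (hη : 0 < η) (x : ℝ) :
    |avg η M.W₀ x| ≤ M.amp := by
  rw [avg_W₀ hM]; exact abs_avg_le_of_bound hη (abs_kdvWave_le hM) x

/-- Quadratic consistency of the averaged square of the wave. -/
theorem norm_opT_W₀_sub_le (hM : M.Admissible) {η : ℝ} (hη : 0 < η) :
    ‖opT η M.W₀ M.W₀ - toL2 (fun x => M.kdvWave x ^ 2)‖
      ≤ η ^ 2 * (2 * M.amp * ‖toL2 M.kdvWaveDeriv2‖ + ‖toL2 M.kdvWaveSqDeriv2‖) := by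
  have hw := memLp_kdvWave M hM
  have hwm := (continuous_kdvWave (M := M)).measurable
  have hw2 := memLp_kdvWave_sq hM
  have hw2m : Measurable fun x => M.kdvWave x ^ 2 :=
    ((continuous_kdvWave (M := M)).pow 2).measurable
  have hprod := memLp_avg_mul_avg hη M.W₀ M.W₀
  have hpm := measurable_avg_mul_avg hη M.W₀ M.W₀
  -- The error is split into that of the inner averages, smoothed by the outer one, and that of the
  -- outer average acting on `W₀²`.
  have e1 : opT η M.W₀ M.W₀ - toL2 (fun x => M.kdvWave x ^ 2)
      = toL2 (avg η fun y => avg η M.W₀ y * avg η M.W₀ y - M.kdvWave y ^ 2)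
        + (toL2 (avg η fun x => M.kdvWave x ^ 2) - toL2 (fun x => M.kdvWave x ^ 2)) := by
    rw [avg_sub (locallyIntegrable_of_memLp hprod) (locallyIntegrable_of_memLp hw2),
      toL2_sub (memLp_opT hη _ _) (memLp_avg hη hw2m hw2), opT]
    abel
  have hA := memLp_avg hη hwm hw
  have hdiff : MemLp (fun x => avg η M.kdvWave x - M.kdvWave x) 2 (volume : Measure ℝ) := hA.sub hw
  have e2 : ‖toL2 fun y => avg η M.W₀ y * avg η M.W₀ y - M.kdvWave y ^ 2‖
      ≤ 2 * M.amp * (η ^ 2 * ‖toL2 M.kdvWaveDeriv2‖) := by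
    have h1 := norm_smear_sub_le_sq (μ := unif) (η := η) hasDerivAt_kdvWave
      (hasDerivAt_kdvWaveDeriv hM) continuous_kdvWaveDeriv2 hw (memLp_kdvWaveDeriv2 hM)
    rw [← avg_eq_smear hη.ne', ← toL2_sub hA hw] at h1
    have hamp := (amp_pos hM).le
    refine le_trans ?_ (mul_le_mul_of_nonneg_left h1 (by positivity))
    refine norm_toL2_le_of_abs_le (by positivity) (hpm.sub hw2m).aestronglyMeasurable hdiff
      fun x => ?_
    have h2 := abs_avg_W₀_le hM hη x
    have h3 := abs_kdvWave_le hM x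
    have h4 : avg η M.W₀ x * avg η M.W₀ x - M.kdvWave x ^ 2
        = (avg η M.W₀ x + M.kdvWave x) * (avg η M.kdvWave x - M.kdvWave x) := by
      rw [avg_W₀ hM]; ring
    rw [h4, abs_mul]
    gcongr
    exact (abs_add_le _ _).trans (by linarith)
  have e3 : ‖toL2 (avg η fun y => avg η M.W₀ y * avg η M.W₀ y - M.kdvWave y ^ 2)‖
      ≤ ‖toL2 fun y => avg η M.W₀ y * avg η M.W₀ y - M.kdvWave y ^ 2‖ :=
    norm_toL2_avg_le hη (hpm.sub hw2m) (hprod.sub hw2)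
  have e4 : ‖toL2 (avg η fun x => M.kdvWave x ^ 2) - toL2 (fun x => M.kdvWave x ^ 2)‖
      ≤ η ^ 2 * ‖toL2 M.kdvWaveSqDeriv2‖ := by
    rw [avg_eq_smear hη.ne']
    exact norm_smear_sub_le_sq hasDerivAt_kdvWave_sq (hasDerivAt_kdvWave_sq_deriv hM)
      (continuous_kdvWaveSqDeriv2 hM) hw2 (memLp_kdvWaveSqDeriv2 hM)
  rw [e1]
  refine (norm_add_le _ _).trans ?_
  linarith

/-- The error of each bond is quadratic in `ε ξ`; with the weight `β ξ³` this requires the fifth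
moment of `β`. -/
theorem exists_norm_opQ_W₀_sub_le (hM : M.Admissible) : ∃ C, ∀ ε, 0 < ε →
    ‖M.opQ ε M.W₀ - M.momentβ • toL2 (fun x => M.kdvWave x ^ 2)‖ ≤ C * ε ^ 2 := by
  set c := 2 * M.amp * ‖toL2 M.kdvWaveDeriv2‖ + ‖toL2 M.kdvWaveSqDeriv2‖ with hc
  refine ⟨∫ ξ in Ioi 0, M.β ξ * ξ ^ 5 * c, fun ε hε => ?_⟩
  have h1 : M.opQ ε M.W₀ - M.momentβ • toL2 (fun x => M.kdvWave x ^ 2)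
      = ∫ ξ in Ioi 0, (toL2 (M.integrandQ ε M.W₀ ξ)
          - (M.β ξ * ξ ^ 3) • toL2 (fun x => M.kdvWave x ^ 2)) := by
    rw [integral_sub (bochnerWellDefined_integrandQ hM hε _).2 (hM.β_three.smul_const _),
      integral_smul_const]
    rfl
  rw [h1, ← integral_mul_const]
  refine norm_integral_le_of_norm_le ((hM.β_five.mul_const c).mul_const _) ?_
  filter_upwards [ae_restrict_mem measurableSet_Ioi] with ξ hξ
  have hβ := hM.β_nonneg ξ hξ
  have hξ' : 0 < ξ := hξ
  rw [toL2_integrandQ hε _ hξ, ← smul_sub, norm_smul, Real.norm_of_nonneg (by positivity)]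
  calc _ ≤ M.β ξ * ξ ^ 3 * ((ε * ξ) ^ 2 * c) := by
        gcongr; exact norm_opT_W₀_sub_le hM (mul_pos hε hξ)
    _ = _ := by ring

/-- Each bond contributes `-(α ξ⁴/12)` times the `cub`-average of `W₀''`. Replacing that average by
`W₀''` costs `(ε ξ)² ‖W₀''''‖`, hence the sixth moment of `α`. -/
theorem exists_norm_opB_W₀_sub_le (hM : M.Admissible) : ∃ C, ∀ ε, 0 < ε →
    ‖M.opB ε M.W₀ - (M.W₀ - (1 / M.d₁) • toL2 M.kdvWaveDeriv2)‖ ≤ C * ε ^ 2 := by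
  set c := ‖toL2 M.kdvWaveDeriv4‖ / 12 with hc
  refine ⟨∫ ξ in Ioi 0, M.α ξ * ξ ^ 6 * c, fun ε hε => ?_⟩
  have hI : (∫ ξ in Ioi 0, (M.α ξ * ξ ^ 4 / 12) • toL2 M.kdvWaveDeriv2)
      = (1 / M.d₁) • toL2 M.kdvWaveDeriv2 := by
    rw [integral_smul_const, integral_div, integral_α_four hM]
    congr 1; field_simp
  have h1 : M.opB ε M.W₀ - (M.W₀ - (1 / M.d₁) • toL2 M.kdvWaveDeriv2)
      = ∫ ξ in Ioi 0, (toL2 (M.integrandB ε M.W₀ ξ)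
          + (M.α ξ * ξ ^ 4 / 12) • toL2 M.kdvWaveDeriv2) := by
    rw [integral_add (bochnerWellDefined_integrandB hM hε _).2
      ((hM.α_four.div_const 12).smul_const _), hI, opB, bochner]
    abel
  rw [h1, ← integral_mul_const]
  refine norm_integral_le_of_norm_le ((hM.α_six.mul_const c).mul_const _) ?_
  filter_upwards [ae_restrict_mem measurableSet_Ioi] with ξ hξ
  have hα := hM.α_nonneg ξ hξ
  have hξ' : 0 < ξ := hξ
  have h2 : M.W₀ - opA (ε * ξ) (opA (ε * ξ) M.W₀)
      = -((ε * ξ) ^ 2 / 12) • toL2 (smear cub (ε * ξ) M.kdvWaveDeriv2) :=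
    sub_opA_opA_toL2 (mul_pos hε hξ) hasDerivAt_kdvWave (hasDerivAt_kdvWaveDeriv hM)
      continuous_kdvWaveDeriv2 (memLp_kdvWave M hM) (memLp_kdvWaveDeriv2 hM)
  have h3 : toL2 (M.integrandB ε M.W₀ ξ) + (M.α ξ * ξ ^ 4 / 12) • toL2 M.kdvWaveDeriv2
      = -(M.α ξ * ξ ^ 4 / 12) • (toL2 (smear cub (ε * ξ) M.kdvWaveDeriv2)
        - toL2 M.kdvWaveDeriv2) := by
    rw [toL2_integrandB hε _ hξ, h2, smul_smul, smul_sub, neg_smul _ (toL2 M.kdvWaveDeriv2),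
      sub_neg_eq_add]
    congr 2
    field_simp
  rw [h3, norm_smul, norm_neg, Real.norm_of_nonneg (by positivity)]
  calc _ ≤ M.α ξ * ξ ^ 4 / 12 * ((ε * ξ) ^ 2 * ‖toL2 M.kdvWaveDeriv4‖) := by
        gcongr
        exact norm_smear_sub_le_sq hasDerivAt_kdvWaveDeriv2 (hasDerivAt_kdvWaveDeriv3 hM)
          (continuous_kdvWaveDeriv4 hM) (memLp_kdvWaveDeriv2 hM) (memLp_kdvWaveDeriv4 hM)
    _ = _ := by rw [hc]; ring

/-- The residual of the wave is bounded uniformly in `ε`. -/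
theorem exists_norm_resK_le (hM : M.Admissible) : ∃ C, ∀ ε, 0 < ε → ‖M.resK ε‖ ≤ C := by
  obtain ⟨C₁, h₁⟩ := exists_norm_opQ_W₀_sub_le hM
  obtain ⟨C₂, h₂⟩ := exists_norm_opB_W₀_sub_le hM
  have hd1 := d₁_pos hM
  -- The profile equation, divided by `d₁`: the limits of `Q_ε[W₀]` and `B_ε W₀` coincide, so both
  -- errors of order `ε²` survive the division by `ε²`.
  have heq : M.momentβ • toL2 (fun x => M.kdvWave x ^ 2)
      = M.W₀ - (1 / M.d₁) • toL2 M.kdvWaveDeriv2 := by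
    rw [W₀, ← toL2_const_mul _ (memLp_kdvWave_sq hM), ← toL2_const_mul _ (memLp_kdvWaveDeriv2 hM),
      ← toL2_sub (memLp_kdvWave M hM) ((memLp_kdvWaveDeriv2 hM).const_mul _)]
    congr 1; funext x
    rw [momentβ_eq hM, kdvWaveDeriv2]
    field_simp; ring
  refine ⟨C₁ + C₂, fun ε hε => ?_⟩
  have h3 := h₁ ε hε
  have h4 := h₂ ε hε
  rw [heq] at h3
  rw [resK, norm_smul, Real.norm_of_nonneg (by positivity), one_div, ← div_eq_inv_mul,
    div_le_iff₀ (by positivity)]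
  rw [← sub_sub_sub_cancel_right _ _ (M.W₀ - (1 / M.d₁) • toL2 M.kdvWaveDeriv2)]
  refine (norm_sub_le _ _).trans ?_
  linarith

end Medium

/-! ### Convolution with a two-sided exponential -/

section ExponentialKernel

/-- The two-sided exponential distribution with rate `b`. -/
def laplace (b : ℝ) : Measure ℝ :=
  volume.withDensity fun s => ENNReal.ofReal (b / 2 * Real.exp (-b * |s|))

theorem integral_laplaceDensity {b : ℝ} (hb : 0 < b) :
    ∫ s, b / 2 * Real.exp (-b * |s|) = 1 := by
  rw [integral_comp_abs (f := fun s => b / 2 * Real.exp (-b * s)), integral_const_mul,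
    integral_exp_mul_Ioi (by linarith)]
  simp
  field_simp

theorem integrable_laplaceDensity {b : ℝ} (hb : 0 < b) :
    Integrable fun s => b / 2 * Real.exp (-b * |s|) := by
  -- A function that is not integrable has integral `0` by convention, whereas the value computed
  -- above is `1`.
  by_contra h
  have := integral_undef h
  rw [integral_laplaceDensity hb] at this
  exact one_ne_zero this

theorem isProbabilityMeasure_laplace {b : ℝ} (hb : 0 < b) : IsProbabilityMeasure (laplace b) := by
  refine ⟨?_⟩
  rw [laplace, withDensity_apply _ MeasurableSet.univ, Measure.restrict_univ,
    ← ofReal_integral_eq_lintegral_ofReal (integrable_laplaceDensity hb)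
      (ae_of_all _ fun s => by positivity), integral_laplaceDensity hb, ENNReal.ofReal_one]

theorem smear_laplace {b : ℝ} (hb : 0 < b) (f : ℝ → ℝ) (x : ℝ) :
    smear (laplace b) 1 f x = b / 2 * ∫ y, Real.exp (-b * |x - y|) * f y := by
  rw [smear, laplace, integral_withDensity_eq_integral_toReal_smul
    (by fun_prop) (ae_of_all _ fun _ => ENNReal.ofReal_lt_top), ← integral_const_mul,
    ← integral_add_left_eq_self (fun y => b / 2 * (Real.exp (-b * |x - y|) * f y)) x]
  congr 1; funext s
  rw [ENNReal.toReal_ofReal (by positivity), smul_eq_mul, one_mul, ← abs_neg s]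
  have : x - (x + s) = -s := by ring
  rw [this, mul_assoc]

/-- Convolution of `|φ|` with a two-sided exponential. -/
def expConv (b : ℝ) (φ : ℝ → ℝ) (x : ℝ) : ℝ := ∫ y, Real.exp (-b * |x - y|) * |φ y|

variable {b : ℝ} {φ : ℝ → ℝ}

theorem expConv_eq (hb : 0 < b) (φ : ℝ → ℝ) :
    expConv b φ = fun x => 2 / b * smear (laplace b) 1 (fun y => |φ y|) x := by
  funext x
  rw [smear_laplace hb, expConv]
  field_simp

theorem memLp_expConv (hb : 0 < b) (hm : Measurable φ) (hφ : MemLp φ 2 (volume : Measure ℝ)) :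
    MemLp (expConv b φ) 2 (volume : Measure ℝ) := by
  have := isProbabilityMeasure_laplace hb
  rw [expConv_eq hb]
  exact (memLp_smear hm.abs hφ.abs).const_mul _

/-- Young's inequality, obtained from averaging against a probability measure; `2 / b` is the mass
of `exp(-b |s|)`. -/
theorem norm_expConv_le (hb : 0 < b) (hm : Measurable φ) (hφ : MemLp φ 2 (volume : Measure ℝ)) :
    ‖toL2 (expConv b φ)‖ ≤ 2 / b * ‖toL2 φ‖ := by
  have := isProbabilityMeasure_laplace hb
  rw [expConv_eq hb, toL2_const_mul _ (memLp_smear hm.abs hφ.abs), norm_smul,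
    Real.norm_of_nonneg (by positivity)]
  gcongr
  refine (norm_toL2_smear_le hm.abs hφ.abs).trans ?_
  have := norm_toL2_le_of_abs_le (f := fun x => |φ x|) zero_le_one hm.abs.aestronglyMeasurable hφ
    (fun x => by rw [abs_abs, one_mul])
  linarith

theorem expConv_nonneg (x : ℝ) : 0 ≤ expConv b φ x :=
  integral_nonneg fun _ => mul_nonneg (Real.exp_nonneg _) (abs_nonneg _)

theorem expConv_neg (he : ∀ x, φ (-x) = φ x) (x : ℝ) : expConv b φ (-x) = expConv b φ x := by
  rw [expConv, expConv, ← integral_neg_eq_self]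
  congr 1; funext y
  rw [he, ← abs_neg (x - y)]
  congr 4; ring

theorem integrable_expConv (hc : Continuous φ) (hs : HasCompactSupport φ) (x : ℝ) :
    Integrable fun y => Real.exp (-b * |x - y|) * |φ y| :=
  Continuous.integrable_of_hasCompactSupport (by fun_prop)
    (HasCompactSupport.mul_left (hs.comp_left abs_zero))

/-- Bound for one half of a Green's function. -/
theorem abs_mul_setIntegral_le (hc : Continuous φ) (hs : HasCompactSupport φ) {g : ℝ → ℝ}
    {S : Set ℝ} (hS : MeasurableSet S) {x B c : ℝ} (hB : 0 ≤ B)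
    (h : ∀ y ∈ S, |c| * |g y| ≤ B * Real.exp (-b * |x - y|)) :
    |c * ∫ y in S, g y * φ y| ≤ B * expConv b φ x := by
  have hi := (integrable_expConv (b := b) hc hs x).const_mul B
  calc |c * ∫ y in S, g y * φ y| = ‖∫ y in S, c * (g y * φ y)‖ := by
        rw [integral_const_mul]; rfl
    _ ≤ ∫ y in S, B * (Real.exp (-b * |x - y|) * |φ y|) := by
        refine norm_integral_le_of_norm_le hi.integrableOn ?_
        filter_upwards [ae_restrict_mem hS] with y hy
        rw [← mul_assoc, ← mul_assoc, norm_mul, norm_mul]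
        exact mul_le_mul_of_nonneg_right (h y hy) (abs_nonneg _)
    _ ≤ ∫ y, B * (Real.exp (-b * |x - y|) * |φ y|) :=
        setIntegral_le_integral hi (ae_of_all _ fun y => by positivity)
    _ = B * expConv b φ x := by rw [integral_const_mul]; rfl

end ExponentialKernel

/-! ### Explicit inversion of the linearized equation on even functions -/

section GreenFunction

variable {a : ℝ}

/-- The decaying odd solution of the linearized equation. -/
def solP (a x : ℝ) : ℝ := Real.sinh (a * x) / Real.cosh (a * x) ^ 3

/-- The derivative of `solP`. -/
def solP' (a x : ℝ) : ℝ := a * ((3 - 2 * Real.cosh (a * x) ^ 2) / Real.cosh (a * x) ^ 4)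

/-- The growing even solution of the linearized equation. -/
def solQ (a x : ℝ) : ℝ := 15 * (a * x) * (Real.sinh (a * x) / Real.cosh (a * x) ^ 3)
  + 2 * Real.cosh (a * x) ^ 2 + 5 - 15 / Real.cosh (a * x) ^ 2

/-- The derivative of `solQ`. -/
def solQ' (a x : ℝ) : ℝ := a * (45 * (Real.sinh (a * x) / Real.cosh (a * x) ^ 3)
  + 15 * (a * x) * ((3 - 2 * Real.cosh (a * x) ^ 2) / Real.cosh (a * x) ^ 4)
  + 4 * (Real.cosh (a * x) * Real.sinh (a * x)))

/-- The potential of the linearized equation. -/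
def potential (a x : ℝ) : ℝ := 4 * a ^ 2 * (1 - 3 * (1 / Real.cosh (a * x)) ^ 2)

open Medium

theorem hasDerivAt_sinh_div_cosh_cube (x : ℝ) :
    HasDerivAt (fun x => Real.sinh (a * x) / Real.cosh (a * x) ^ 3)
      (a * ((3 - 2 * Real.cosh (a * x) ^ 2) / Real.cosh (a * x) ^ 4)) x := by
  have hc := (Real.cosh_pos (a * x)).ne'
  have h := (hasDerivAt_sinh_mul a x).fun_div ((hasDerivAt_cosh_mul a x).fun_pow 3)
    (pow_ne_zero 3 hc)
  refine h.congr_deriv ?_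
  have h2 := Real.sinh_sq (a * x)
  norm_num
  field_simp
  rw [h2]
  ring

theorem hasDerivAt_solP (x : ℝ) : HasDerivAt (solP a) (solP' a x) x :=
  hasDerivAt_sinh_div_cosh_cube x

theorem hasDerivAt_aux (x : ℝ) :
    HasDerivAt (fun x => (3 - 2 * Real.cosh (a * x) ^ 2) / Real.cosh (a * x) ^ 4)
      (a * (4 - 12 / Real.cosh (a * x) ^ 2) * (Real.sinh (a * x) / Real.cosh (a * x) ^ 3)) x := by
  have hc := (Real.cosh_pos (a * x)).ne'
  have h := ((((hasDerivAt_cosh_mul a x).fun_pow 2).const_mul 2).const_sub 3).fun_div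
    ((hasDerivAt_cosh_mul a x).fun_pow 4) (pow_ne_zero 4 hc)
  refine h.congr_deriv ?_
  norm_num
  field_simp
  ring

/-- Translation invariance: with `a` equal to `rate`, `solP a` is a multiple of `W₀'`, and
differentiating the profile equation gives the linearized one. -/
theorem hasDerivAt_solP' (x : ℝ) : HasDerivAt (solP' a) (potential a x * solP a x) x := by
  refine ((hasDerivAt_aux x).const_mul a).congr_deriv ?_
  have hc := (Real.cosh_pos (a * x)).ne'
  rw [potential, solP]
  field_simp
  ring

theorem hasDerivAt_solQ (x : ℝ) : HasDerivAt (solQ a) (solQ' a x) x := by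
  have hc := (Real.cosh_pos (a * x)).ne'
  have h0 : HasDerivAt (fun x : ℝ => 15 * (a * x)) (15 * a) x := by
    simpa using ((hasDerivAt_id x).const_mul a).const_mul 15
  have h := (((h0.fun_mul (hasDerivAt_sinh_div_cosh_cube (a := a) x)).fun_add
    (((hasDerivAt_cosh_mul a x).fun_pow 2).const_mul 2)).add_const 5).fun_sub
    (((((hasDerivAt_cosh_mul a x).fun_pow 2).fun_inv (pow_ne_zero 2 hc))).const_mul 15)
  have h2 : solQ a = fun x => 15 * (a * x) * (Real.sinh (a * x) / Real.cosh (a * x) ^ 3)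
      + 2 * Real.cosh (a * x) ^ 2 + 5 - 15 * (Real.cosh (a * x) ^ 2)⁻¹ := by
    funext x; rw [solQ, div_eq_mul_inv 15]
  rw [h2]
  refine h.congr_deriv ?_
  rw [solQ']
  norm_num
  field_simp
  ring

theorem hasDerivAt_solQ' (x : ℝ) : HasDerivAt (solQ' a) (potential a x * solQ a x) x := by
  have hc := (Real.cosh_pos (a * x)).ne'
  have h0 : HasDerivAt (fun x : ℝ => 15 * (a * x)) (15 * a) x := by
    simpa using ((hasDerivAt_id x).const_mul a).const_mul 15
  have h := ((((hasDerivAt_sinh_div_cosh_cube (a := a) x).const_mul 45).fun_add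
    (h0.fun_mul (hasDerivAt_aux (a := a) x))).fun_add
    (((hasDerivAt_cosh_mul a x).fun_mul (hasDerivAt_sinh_mul a x)).const_mul 4)).const_mul a
  refine h.congr_deriv ?_
  have h2 := Real.sinh_sq (a * x)
  rw [potential, solQ]
  norm_num
  field_simp
  ring_nf
  rw [h2]
  ring

/-- The Wronskian must be constant, since the equation has no first order term. Its value fixes the
normalization of the Green's function. -/
theorem wronskian (x : ℝ) : solP' a x * solQ a x - solP a x * solQ' a x = -8 * a := by
  have hc := (Real.cosh_pos (a * x)).ne'
  have h2 := Real.sinh_sq (a * x)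
  rw [solP, solP', solQ, solQ']
  field_simp
  ring_nf
  rw [h2]
  ring

theorem cosh_le_exp_abs (y : ℝ) : Real.cosh y ≤ Real.exp |y| := by
  rw [← Real.cosh_abs, Real.cosh_eq]
  have : Real.exp (-|y|) ≤ Real.exp |y| := Real.exp_le_exp.2 (by linarith [abs_nonneg y])
  linarith

theorem exp_abs_le_cosh (y : ℝ) : Real.exp |y| ≤ 2 * Real.cosh y := by
  rw [← Real.cosh_abs, Real.cosh_eq]
  have := Real.exp_pos (-|y|)
  linarith

theorem abs_sinh_le_cosh (y : ℝ) : |Real.sinh y| ≤ Real.cosh y := by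
  refine abs_le_of_sq_le_sq ?_ (Real.cosh_pos y).le
  rw [Real.sinh_sq]; linarith

theorem abs_le_cosh (y : ℝ) : |y| ≤ Real.cosh y := by
  refine le_trans ?_ (abs_sinh_le_cosh y)
  rw [Real.abs_sinh]
  exact Real.self_le_sinh_iff.2 (abs_nonneg _)

theorem abs_sinh_div_le (y : ℝ) : |Real.sinh y / Real.cosh y ^ 3| ≤ 1 / Real.cosh y ^ 2 := by
  have hc := Real.cosh_pos y
  rw [abs_div, abs_of_pos (pow_pos hc 3), div_le_div_iff₀ (by positivity) (by positivity)]
  have := abs_sinh_le_cosh y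
  calc |Real.sinh y| * Real.cosh y ^ 2 ≤ Real.cosh y * Real.cosh y ^ 2 := by gcongr
    _ = 1 * Real.cosh y ^ 3 := by ring

theorem abs_aux_le (y : ℝ) :
    |(3 - 2 * Real.cosh y ^ 2) / Real.cosh y ^ 4| ≤ 5 / Real.cosh y ^ 2 := by
  have hc := Real.cosh_pos y
  have h1 : 1 ≤ Real.cosh y ^ 2 := one_le_pow₀ (Real.one_le_cosh y)
  rw [abs_div, abs_of_pos (pow_pos hc 4), div_le_div_iff₀ (by positivity) (by positivity)]
  have : |3 - 2 * Real.cosh y ^ 2| ≤ 5 * Real.cosh y ^ 2 := by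
    rw [abs_le]; constructor <;> linarith
  calc |3 - 2 * Real.cosh y ^ 2| * Real.cosh y ^ 2 ≤ 5 * Real.cosh y ^ 2 * Real.cosh y ^ 2 := by
        gcongr
    _ = 5 * Real.cosh y ^ 4 := by ring

theorem inv_cosh_sq_le (y : ℝ) : 1 / Real.cosh y ^ 2 ≤ 4 * Real.exp (-2 * |y|) := by
  have hc := Real.cosh_pos y
  have h1 := exp_abs_le_cosh y
  have h2 : Real.exp (-2 * |y|) = 1 / Real.exp |y| ^ 2 := by
    rw [← Real.exp_nat_mul, one_div, ← Real.exp_neg]; congr 1; push_cast; ring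
  rw [h2, mul_one_div, div_le_div_iff₀ (by positivity) (by positivity)]
  calc 1 * Real.exp |y| ^ 2 ≤ 1 * (2 * Real.cosh y) ^ 2 := by gcongr
    _ = _ := by ring

theorem cosh_sq_le (y : ℝ) : Real.cosh y ^ 2 ≤ Real.exp (2 * |y|) := by
  have h2 : Real.exp (2 * |y|) = Real.exp |y| ^ 2 := by
    rw [← Real.exp_nat_mul]; push_cast; rfl
  rw [h2]
  have := Real.cosh_pos y
  gcongr
  exact cosh_le_exp_abs y

theorem abs_solP_le (x : ℝ) : |solP a x| ≤ 4 * Real.exp (-2 * |a * x|) :=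
  (abs_sinh_div_le _).trans (inv_cosh_sq_le _)

theorem abs_solP'_le (ha : 0 < a) (x : ℝ) : |solP' a x| ≤ 20 * a * Real.exp (-2 * |a * x|) := by
  rw [solP', abs_mul, abs_of_pos ha]
  have h1 := abs_aux_le (a * x)
  have h2 := inv_cosh_sq_le (a * x)
  have h3 : 5 / Real.cosh (a * x) ^ 2 = 5 * (1 / Real.cosh (a * x) ^ 2) := by ring
  calc _ ≤ a * (5 * (4 * Real.exp (-2 * |a * x|))) := by
        gcongr; linarith
    _ = _ := by ring

theorem abs_mul_div_cosh_sq_le (y : ℝ) : |y| * (1 / Real.cosh y ^ 2) ≤ 1 := by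
  have hc := Real.cosh_pos y
  rw [mul_one_div, div_le_one (by positivity)]
  exact (abs_le_cosh y).trans (le_self_pow₀ (Real.one_le_cosh y) two_ne_zero)

/-- The constant is `15 + 2 + 5 + 15`, one summand for each term of `solQ`. -/
theorem abs_solQ_le (x : ℝ) : |solQ a x| ≤ 37 * Real.exp (2 * |a * x|) := by
  set y := a * x with hy
  have hc := Real.cosh_pos y
  have h1 : 1 ≤ Real.cosh y ^ 2 := one_le_pow₀ (Real.one_le_cosh y)
  have h2 : |15 * y * (Real.sinh y / Real.cosh y ^ 3)| ≤ 15 := by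
    rw [abs_mul, abs_mul, abs_of_pos (by norm_num : (0 : ℝ) < 15), mul_assoc]
    have := abs_mul_div_cosh_sq_le y
    have := mul_le_mul_of_nonneg_left (abs_sinh_div_le y) (abs_nonneg y)
    linarith
  have h3 : 15 / Real.cosh y ^ 2 ≤ 15 := div_le_self (by norm_num) h1
  have h4 : 0 ≤ 15 / Real.cosh y ^ 2 := by positivity
  have h5 := cosh_sq_le y
  rw [solQ, ← hy]
  rw [abs_le] at h2 ⊢
  constructor <;> linarith [h2.1, h2.2]

theorem abs_solQ'_le (ha : 0 < a) (x : ℝ) : |solQ' a x| ≤ 124 * a * Real.exp (2 * |a * x|) := by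
  rw [solQ']
  set y := a * x with hy
  have hc := Real.cosh_pos y
  have h1 : 1 ≤ Real.cosh y ^ 2 := one_le_pow₀ (Real.one_le_cosh y)
  have h0 : 1 / Real.cosh y ^ 2 ≤ 1 := div_le_self (by norm_num) h1
  have h2 : |15 * y * ((3 - 2 * Real.cosh y ^ 2) / Real.cosh y ^ 4)| ≤ 75 := by
    rw [abs_mul, abs_mul, abs_of_pos (by norm_num : (0 : ℝ) < 15), mul_assoc]
    have h6 := abs_mul_div_cosh_sq_le y
    have h7 := mul_le_mul_of_nonneg_left (abs_aux_le y) (abs_nonneg y)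
    have h8 : |y| * (5 / Real.cosh y ^ 2) = 5 * (|y| * (1 / Real.cosh y ^ 2)) := by ring
    linarith
  have h3 : |45 * (Real.sinh y / Real.cosh y ^ 3)| ≤ 45 := by
    rw [abs_mul, abs_of_pos (by norm_num : (0 : ℝ) < 45)]
    linarith [abs_sinh_div_le y]
  have h4 : |4 * (Real.cosh y * Real.sinh y)| ≤ 4 * Real.cosh y ^ 2 := by
    rw [abs_mul, abs_mul, abs_of_pos (by norm_num : (0 : ℝ) < 4), abs_of_pos hc, sq]
    gcongr
    exact abs_sinh_le_cosh y
  have h5 := cosh_sq_le y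
  rw [abs_mul, abs_of_pos ha]
  have h9 : |45 * (Real.sinh y / Real.cosh y ^ 3)
      + 15 * y * ((3 - 2 * Real.cosh y ^ 2) / Real.cosh y ^ 4)
      + 4 * (Real.cosh y * Real.sinh y)| ≤ 124 * Real.exp (2 * |y|) := by
    refine (abs_add_three _ _ _).trans ?_
    linarith
  calc _ ≤ a * (124 * Real.exp (2 * |y|)) := by gcongr
    _ = _ := by ring

/-- The combination of two half-line integrals in the variation of constants formula. -/
def greenSum (a : ℝ) (φ q p : ℝ → ℝ) (x : ℝ) : ℝ :=
  q x * ((∫ y in Ioi 0, solP a y * φ y) - ∫ y in (0 : ℝ)..x, solP a y * φ y)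
    + p x * ∫ y in (0 : ℝ)..x, solQ a y * φ y

theorem continuous_solP : Continuous (solP a) := continuous_of_hasDerivAt hasDerivAt_solP

theorem continuous_solQ : Continuous (solQ a) := continuous_of_hasDerivAt hasDerivAt_solQ

theorem solP_neg (x : ℝ) : solP a (-x) = -solP a x := by
  simp [solP, neg_div]

theorem solP'_neg (x : ℝ) : solP' a (-x) = solP' a x := by
  simp [solP']

theorem solQ_neg (x : ℝ) : solQ a (-x) = solQ a x := by
  simp [solQ, neg_div]

theorem solQ'_neg (x : ℝ) : solQ' a (-x) = -solQ' a x := by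
  simp [solQ', neg_div]; ring

variable {φ q p : ℝ → ℝ}

/-- For even `φ` the product `solP a · φ` is odd, so its integral from `0` is even in the endpoint.
Consequently the coefficient of the growing solution decays at both ends with the same constant
`∫_0^∞`, and no solvability condition arises. -/
theorem greenSum_neg (he : ∀ x, φ (-x) = φ x) {σ : ℝ} (hq : ∀ x, q (-x) = σ * q x)
    (hp : ∀ x, p (-x) = -σ * p x) (x : ℝ) :
    greenSum a φ q p (-x) = σ * greenSum a φ q p x := by
  have h1 : ∫ y in (0 : ℝ)..(-x), solP a y * φ y = ∫ y in (0 : ℝ)..x, solP a y * φ y := by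
    have := intervalIntegral.integral_comp_neg (a := 0) (b := x) (fun y => solP a y * φ y)
    simp only [solP_neg, he, neg_zero, neg_mul, intervalIntegral.integral_neg] at this
    rw [intervalIntegral.integral_symm, ← this, neg_neg]
  have h2 : ∫ y in (0 : ℝ)..(-x), solQ a y * φ y = -∫ y in (0 : ℝ)..x, solQ a y * φ y := by
    have := intervalIntegral.integral_comp_neg (a := 0) (b := x) (fun y => solQ a y * φ y)
    simp only [solQ_neg, he, neg_zero] at this
    rw [intervalIntegral.integral_symm, ← this]
  rw [greenSum, greenSum, h1, h2, hq, hp]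
  ring

/-- Growth of `q` at `x` is compensated by decay of `solP` beyond `x`, and growth of `solQ` before
`x` by decay of `p` at `x`. Both halves are dominated by `exp(-2a |x - y|)`, and `41 = 4 + 37` adds
the constants of `solP` and `solQ`. -/
theorem abs_greenSum_le_of_nonneg (ha : 0 < a) (hc : Continuous φ) (hs : HasCompactSupport φ)
    {A : ℝ} (hA : 0 ≤ A) (hq : ∀ x, |q x| ≤ A * Real.exp (2 * |a * x|))
    (hp : ∀ x, |p x| ≤ A * Real.exp (-2 * |a * x|)) {x : ℝ} (hx : 0 ≤ x) :
    |greenSum a φ q p x| ≤ 41 * A * expConv (2 * a) φ x := by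
  have hi : Integrable fun y => solP a y * φ y :=
    Continuous.integrable_of_hasCompactSupport (continuous_solP.mul hc) hs.mul_left
  have h1 : (∫ y in Ioi 0, solP a y * φ y) - ∫ y in (0 : ℝ)..x, solP a y * φ y
      = ∫ y in Ioi x, solP a y * φ y := by
    rw [← intervalIntegral.integral_Ioi_sub_Ioi hi.integrableOn hx]; ring
  have h2 : |q x * ∫ y in Ioi x, solP a y * φ y| ≤ (4 * A) * expConv (2 * a) φ x := by
    refine abs_mul_setIntegral_le hc hs measurableSet_Ioi (by positivity) fun y hy => ?_
    have hxy : x < y := hy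
    calc |q x| * |solP a y|
        ≤ (A * Real.exp (2 * |a * x|)) * (4 * Real.exp (-2 * |a * y|)) :=
          mul_le_mul (hq x) (abs_solP_le y) (abs_nonneg _) (by positivity)
      _ = 4 * A * Real.exp (-(2 * a) * |x - y|) := by
          rw [abs_of_nonneg (by positivity : 0 ≤ a * x),
            abs_of_nonneg (mul_nonneg ha.le (hx.trans hxy.le)), abs_of_neg (sub_neg.2 hxy)]
          rw [mul_mul_mul_comm, ← Real.exp_add, mul_comm A]
          congr 2; ring
  have h3 : |p x * ∫ y in Ioc 0 x, solQ a y * φ y| ≤ (37 * A) * expConv (2 * a) φ x := by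
    refine abs_mul_setIntegral_le hc hs measurableSet_Ioc (by positivity) fun y hy => ?_
    calc |p x| * |solQ a y|
        ≤ (A * Real.exp (-2 * |a * x|)) * (37 * Real.exp (2 * |a * y|)) :=
          mul_le_mul (hp x) (abs_solQ_le y) (abs_nonneg _) (by positivity)
      _ = 37 * A * Real.exp (-(2 * a) * |x - y|) := by
          rw [abs_of_nonneg (by positivity : 0 ≤ a * x),
            abs_of_nonneg (mul_nonneg ha.le hy.1.le), abs_of_nonneg (sub_nonneg.2 hy.2)]
          rw [mul_mul_mul_comm, ← Real.exp_add, mul_comm A]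
          congr 2; ring
  rw [greenSum, h1, intervalIntegral.integral_of_le hx]
  refine (abs_add_le _ _).trans ?_
  linarith

theorem abs_greenSum_le (ha : 0 < a) (hc : Continuous φ) (hs : HasCompactSupport φ)
    (he : ∀ x, φ (-x) = φ x) {A σ : ℝ} (hA : 0 ≤ A)
    (hq : ∀ x, |q x| ≤ A * Real.exp (2 * |a * x|))
    (hp : ∀ x, |p x| ≤ A * Real.exp (-2 * |a * x|)) (hσ : |σ| = 1) (hqσ : ∀ x, q (-x) = σ * q x)
    (hpσ : ∀ x, p (-x) = -σ * p x) (x : ℝ) :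
    |greenSum a φ q p x| ≤ 41 * A * expConv (2 * a) φ x := by
  rcases le_total 0 x with hx | hx
  · exact abs_greenSum_le_of_nonneg ha hc hs hA hq hp hx
  · have := abs_greenSum_le_of_nonneg ha hc hs hA hq hp (neg_nonneg.2 hx)
    rwa [greenSum_neg he hqσ hpσ, abs_mul, hσ, one_mul, expConv_neg he] at this

/-- The local term vanishes when `p = solP` and `q = solQ`, and equals the Wronskian times `φ` when
both are replaced by their derivatives. -/
theorem hasDerivAt_greenSum (hc : Continuous φ) {q' p' : ℝ → ℝ} {x : ℝ}
    (hq : HasDerivAt q (q' x) x) (hp : HasDerivAt p (p' x) x) :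
    HasDerivAt (greenSum a φ q p)
      (greenSum a φ q' p' x + (p x * solQ a x - solP a x * q x) * φ x) x := by
  have h1 : HasDerivAt (fun x => ∫ y in (0 : ℝ)..x, solP a y * φ y) (solP a x * φ x) x :=
    ((continuous_solP.mul hc).integral_hasStrictDerivAt 0 x).hasDerivAt
  have h2 : HasDerivAt (fun x => ∫ y in (0 : ℝ)..x, solQ a y * φ y) (solQ a x * φ x) x :=
    ((continuous_solQ.mul hc).integral_hasStrictDerivAt 0 x).hasDerivAt
  refine ((hq.fun_mul (h1.const_sub _)).fun_add (hp.fun_mul h2)).congr_deriv ?_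
  rw [greenSum]; ring

theorem greenSum_potential (φ : ℝ → ℝ) (x : ℝ) :
    greenSum a φ (fun x => potential a x * solQ a x) (fun x => potential a x * solP a x) x
      = potential a x * greenSum a φ (solQ a) (solP a) x := by
  simp only [greenSum]; ring

theorem abs_potential_le (x : ℝ) : |potential a x| ≤ 8 * a ^ 2 := by
  have hc := Real.cosh_pos (a * x)
  have h1 : 1 ≤ Real.cosh (a * x) ^ 2 := one_le_pow₀ (Real.one_le_cosh _)
  have h0 : 1 / Real.cosh (a * x) ^ 2 ≤ 1 := div_le_self (by norm_num) h1
  have h2 : 0 ≤ 1 / Real.cosh (a * x) ^ 2 := by positivity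
  rw [potential, div_pow, one_pow, abs_mul, abs_of_nonneg (by positivity)]
  have : |1 - 3 * (1 / Real.cosh (a * x) ^ 2)| ≤ 2 := by
    rw [abs_le]; constructor <;> linarith
  calc _ ≤ 4 * a ^ 2 * 2 := by gcongr
    _ = _ := by ring

theorem continuous_potential : Continuous (potential a) := by
  have : ∀ x : ℝ, Real.cosh (a * x) ≠ 0 := fun x => (Real.cosh_pos _).ne'
  unfold potential
  fun_prop (disch := exact this _)

/-- The linearized equation `u - u'' / (4 a²) - 3 sech²(a x) u = φ` can be solved in `H²` for
even `φ`, with bounds. -/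
theorem exists_linearized_solution (ha : 0 < a) : ∃ C, 0 ≤ C ∧ ∀ φ : ℝ → ℝ, Continuous φ →
    HasCompactSupport φ → (∀ x, φ (-x) = φ x) → ∃ u u' u'' : ℝ → ℝ,
      (∀ x, HasDerivAt u (u' x) x) ∧ (∀ x, HasDerivAt u' (u'' x) x) ∧ Continuous u'' ∧
      MemLp u 2 (volume : Measure ℝ) ∧ MemLp u' 2 (volume : Measure ℝ) ∧
      MemLp u'' 2 (volume : Measure ℝ) ∧
      (∀ x, u x - 1 / (4 * a ^ 2) * u'' x - 3 * (1 / Real.cosh (a * x)) ^ 2 * u x = φ x) ∧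
      ‖toL2 u‖ ≤ C * ‖toL2 φ‖ ∧ ‖toL2 u'‖ ≤ C * ‖toL2 φ‖ ∧ ‖toL2 u''‖ ≤ C * ‖toL2 φ‖ := by
  set C₀ := a / 2 * (41 * 37) * (2 / (2 * a)) with hC₀
  set C₁ := a / 2 * (41 * (124 * a)) * (2 / (2 * a)) with hC₁
  have h0 : 0 ≤ C₀ := by positivity
  have h1 : 0 ≤ C₁ := by positivity
  refine ⟨C₀ + C₁ + (8 * a ^ 2 * C₀ + 4 * a ^ 2), by positivity, fun φ hc hs he => ?_⟩
  have hφ : MemLp φ 2 (volume : Measure ℝ) := hc.memLp_of_hasCompactSupport hs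
  -- The factor `a / 2` is `4 a² / (8 a)`: against the Wronskian `-8 a` it produces the source `-4
  -- a² φ` in `u''`.
  set u : ℝ → ℝ := fun x => a / 2 * greenSum a φ (solQ a) (solP a) x with hu
  set u' : ℝ → ℝ := fun x => a / 2 * greenSum a φ (solQ' a) (solP' a) x with hu'
  set u'' : ℝ → ℝ := fun x => potential a x * u x - 4 * a ^ 2 * φ x with hu''
  have hd : ∀ x, HasDerivAt u (u' x) x := fun x => by
    refine ((hasDerivAt_greenSum hc (hasDerivAt_solQ x) (hasDerivAt_solP x)).const_mul
      (a / 2)).congr_deriv ?_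
    rw [hu']; ring
  have hd' : ∀ x, HasDerivAt u' (u'' x) x := fun x => by
    refine ((hasDerivAt_greenSum hc (q' := fun x => potential a x * solQ a x)
      (p' := fun x => potential a x * solP a x) (hasDerivAt_solQ' x)
      (hasDerivAt_solP' x)).const_mul (a / 2)).congr_deriv ?_
    rw [greenSum_potential, wronskian]
    simp only [hu'', hu]; ring
  have huc := continuous_of_hasDerivAt hd
  have huc' := continuous_of_hasDerivAt hd'
  have huc'' : Continuous u'' := (continuous_potential.mul huc).sub (hc.const_mul _)
  have hexp : ∀ x : ℝ, 0 < Real.exp (-2 * |a * x|) := fun x => Real.exp_pos _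
  have hb : ∀ x, |u x| ≤ a / 2 * (41 * 37) * |expConv (2 * a) φ x| := fun x => by
    rw [abs_of_nonneg (expConv_nonneg x), hu, abs_mul, abs_of_pos (by positivity), mul_assoc]
    gcongr
    refine abs_greenSum_le (σ := 1) ha hc hs he (by norm_num) abs_solQ_le (fun x => ?_) abs_one
      (fun x => by rw [solQ_neg, one_mul]) (fun x => by rw [solP_neg]; ring) x
    refine (abs_solP_le x).trans ?_
    gcongr; norm_num
  have hb' : ∀ x, |u' x| ≤ a / 2 * (41 * (124 * a)) * |expConv (2 * a) φ x| := fun x => by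
    rw [abs_of_nonneg (expConv_nonneg x), hu', abs_mul, abs_of_pos (by positivity), mul_assoc]
    gcongr
    refine abs_greenSum_le (σ := -1) ha hc hs he (by positivity) (abs_solQ'_le ha) (fun x => ?_)
      (by simp) (fun x => by rw [solQ'_neg]; ring) (fun x => by rw [solP'_neg]; ring) x
    refine (abs_solP'_le ha x).trans ?_
    gcongr; norm_num
  have he2 := memLp_expConv (b := 2 * a) (by positivity) hc.measurable hφ
  have hen := norm_expConv_le (b := 2 * a) (by positivity) hc.measurable hφ
  have hu2 := memLp_of_abs_le huc.aestronglyMeasurable he2 hb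
  have hu2' := memLp_of_abs_le huc'.aestronglyMeasurable he2 hb'
  have hVu : MemLp (fun x => potential a x * u x) 2 (volume : Measure ℝ) :=
    memLp_bounded_mul continuous_potential abs_potential_le hu2
  have hu2'' : MemLp u'' 2 (volume : Measure ℝ) := hVu.sub (hφ.const_mul _)
  have hn : ‖toL2 u‖ ≤ C₀ * ‖toL2 φ‖ := by
    refine (norm_toL2_le_of_abs_le (by positivity) huc.aestronglyMeasurable he2 hb).trans ?_
    rw [hC₀, mul_assoc _ (2 / (2 * a))]
    gcongr
  have hn' : ‖toL2 u'‖ ≤ C₁ * ‖toL2 φ‖ := by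
    refine (norm_toL2_le_of_abs_le (by positivity) huc'.aestronglyMeasurable he2 hb').trans ?_
    rw [hC₁, mul_assoc _ (2 / (2 * a))]
    gcongr
  have hn'' : ‖toL2 u''‖ ≤ (8 * a ^ 2 * C₀ + 4 * a ^ 2) * ‖toL2 φ‖ := by
    rw [hu'', toL2_sub hVu (hφ.const_mul _), toL2_const_mul _ hφ]
    refine (norm_sub_le _ _).trans ?_
    rw [norm_smul, Real.norm_of_nonneg (by positivity), add_mul, mul_assoc (8 * a ^ 2)]
    gcongr
    refine (norm_toL2_le_of_abs_le (by positivity) hVu.1 hu2 (C := 8 * a ^ 2) fun x => ?_).trans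
      (by gcongr)
    rw [abs_mul]
    gcongr
    exact abs_potential_le x
  have hφn := norm_nonneg (toL2 φ)
  have p0 : 0 ≤ C₀ * ‖toL2 φ‖ := by positivity
  have p1 : 0 ≤ C₁ * ‖toL2 φ‖ := by positivity
  have p2 : 0 ≤ (8 * a ^ 2 * C₀ + 4 * a ^ 2) * ‖toL2 φ‖ := by positivity
  refine ⟨u, u', u'', hd, hd', huc'', hu2, hu2', hu2'', fun x => ?_, ?_, ?_, ?_⟩
  · simp only [hu'', potential]
    field_simp
    ring
  all_goals rw [add_mul, add_mul]; linarith

end GreenFunction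

/-! ### Pointwise averaging error and even approximation -/

section

variable {μ : Measure ℝ} {η : ℝ} {f f' : ℝ → ℝ}

theorem abs_smear_sub_le [AveragingMeasure μ] (hf : ∀ x, HasDerivAt f (f' x) x) {C : ℝ}
    (hC : ∀ x, |f' x| ≤ C) (x : ℝ) : |smear μ η f x - f x| ≤ C * |η| := by
  have hi := integrable_translate_of_continuous (μ := μ) (η := η) (continuous_of_hasDerivAt hf) x
  have h1 : smear μ η f x - f x = ∫ s, (f (x + η * s) - f x) ∂μ := by
    rw [integral_sub hi (integrable_const _)]
    simp [smear]
  have h2 : ∀ᵐ s ∂μ, ‖f (x + η * s) - f x‖ ≤ C * |η| := by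
    filter_upwards [AveragingMeasure.support (μ := μ)] with s hs
    have h3 := convex_univ.norm_image_sub_le_of_norm_hasDerivWithin_le
      (fun y _ => (hf y).hasDerivWithinAt) (fun y _ => hC y) (mem_univ x) (mem_univ (x + η * s))
    refine h3.trans ?_
    have hC0 := (abs_nonneg _).trans (hC 0)
    rw [add_sub_cancel_left, Real.norm_eq_abs, abs_mul]
    gcongr
    exact mul_le_of_le_one_right (abs_nonneg _) hs
  rw [h1]
  simpa using norm_integral_le_of_norm_le_const h2

/-- A compactly supported approximation is symmetrized. The projection onto even functions fixes `V`
and does not increase norms, so the error is preserved. -/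
theorem exists_even_compactSupport_approx {V : L2} (hV : V ∈ L2even) {δ : ℝ} (hδ : 0 < δ) :
    ∃ φ : ℝ → ℝ, Continuous φ ∧ HasCompactSupport φ ∧ (∀ x, φ (-x) = φ x) ∧
      ‖V - toL2 φ‖ ≤ δ := by
  obtain ⟨g, hgs, hgV, hgc, hg2⟩ := (Lp.memLp V).exists_hasCompactSupport_eLpNorm_sub_le
    (by norm_num) (ε := ENNReal.ofReal δ) (by simpa using hδ)
  have hg2' : MemLp (fun x => g (-x)) 2 (volume : Measure ℝ) :=
    hg2.comp_measurePreserving (Measure.measurePreserving_neg volume)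
  have hVg : ‖V - toL2 g‖ ≤ δ := by
    have h1 : MemLp (fun x => V x - g x) 2 (volume : Measure ℝ) := (Lp.memLp V).sub hg2
    have h2 := toL2_sub (Lp.memLp V) hg2
    rw [toL2_coe] at h2
    rw [← h2, norm_toL2 h1]
    exact ENNReal.toReal_le_of_le_ofReal hδ.le hgV
  have hr : reflect (toL2 g) = toL2 fun x => g (-x) := by
    symm
    refine toL2_eq_of_ae ?_
    have h1 := (Measure.measurePreserving_neg (volume : Measure ℝ)).quasiMeasurePreserving.ae_eq_comp
      (coeFn_toL2 hg2)
    exact (h1.symm).trans (coeFn_reflect _).symm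
  refine ⟨fun x => 1 / 2 * (g x + g (-x)), by fun_prop, ?_, fun x => ?_, ?_⟩
  · exact HasCompactSupport.mul_left (hgs.add (hgs.comp_homeomorph (Homeomorph.neg ℝ)))
  · change 1 / 2 * (g (-x) + g (- -x)) = 1 / 2 * (g x + g (-x))
    rw [neg_neg, add_comm]
  · have hadd : MemLp (fun x => g x + g (-x)) 2 (volume : Measure ℝ) := hg2.add hg2'
    rw [toL2_const_mul _ hadd, toL2_add hg2 hg2', ← hr]
    have h3 : V - (1 / 2 : ℝ) • (toL2 g + reflect (toL2 g))
        = (1 / 2 : ℝ) • ((V - toL2 g) + reflect (V - toL2 g)) := by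
      rw [map_sub, mem_L2even_iff.1 hV]
      module
    rw [h3, norm_smul]
    have h4 := norm_add_le (V - toL2 g) (reflect (V - toL2 g))
    rw [LinearIsometry.norm_map] at h4
    rw [Real.norm_of_nonneg (by norm_num)]
    linarith

end

/-! ### The uniform lower bound for `L_ε` -/

namespace Medium

variable {M : Medium} {ε : ℝ}

theorem momentβ_pos (hM : M.Admissible) : 0 < M.momentβ := hM.β_three_pos

theorem norm_opM_le (hM : M.Admissible) (hε : 0 < ε) (V : L2) :
    ‖M.opM ε V‖ ≤ 2 * M.momentβ * M.amp * ‖V‖ := by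
  rw [opM, norm_smul, Real.norm_of_nonneg (by norm_num)]
  have h : ‖bochner (M.integrandM ε V)‖ ≤ ∫ ξ in Ioi 0, M.β ξ * ξ ^ 3 * (M.amp * ‖V‖) := by
    refine norm_bochner_le (hM.β_three.mul_const _) fun ξ hξ => ?_
    have hβ := hM.β_nonneg ξ hξ
    have hη := mul_pos hε hξ
    rw [toL2_integrandM hε V hξ, norm_smul, Real.norm_of_nonneg (by positivity)]
    gcongr
    exact norm_opT_le_of_bound hη (abs_avg_W₀_le hM hη) V
  rw [integral_mul_const] at h
  have : M.momentβ = ∫ ξ in Ioi 0, M.β ξ * ξ ^ 3 := rfl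
  rw [this]
  linarith

section Consistency

variable {u u' u'' : ℝ → ℝ}

/-- First order accuracy suffices for the lower bound. The estimate uses one derivative of `u` and
of the wave, for the inner averages and the outer one. -/
theorem norm_opT_W₀_toL2_sub_le (hM : M.Admissible) {η : ℝ} (hη : 0 < η)
    (hu : ∀ x, HasDerivAt u (u' x) x) (hc' : Continuous u')
    (h2 : MemLp u 2 (volume : Measure ℝ)) (h2' : MemLp u' 2 (volume : Measure ℝ)) :
    ‖opT η M.W₀ (toL2 u) - toL2 (fun x => M.kdvWave x * u x)‖
      ≤ η * (2 * M.amp * ‖toL2 u'‖ + 2 * (Real.sqrt M.d₁ * M.amp) * ‖toL2 u‖) := by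
  have hamp := (amp_pos hM).le
  have hc := continuous_of_hasDerivAt hu
  have hwc := continuous_kdvWave (M := M)
  have hwu : MemLp (fun x => M.kdvWave x * u x) 2 (volume : Measure ℝ) :=
    memLp_bounded_mul hwc (abs_kdvWave_le hM) h2
  have hwum : Measurable fun x => M.kdvWave x * u x := (hwc.mul hc).measurable
  have hprod := memLp_avg_mul_avg hη M.W₀ (toL2 u)
  have hpm := measurable_avg_mul_avg hη M.W₀ (toL2 u)
  have e1 : opT η M.W₀ (toL2 u) - toL2 (fun x => M.kdvWave x * u x)
      = toL2 (avg η fun y => avg η M.W₀ y * avg η (toL2 u) y - M.kdvWave y * u y)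
        + (toL2 (avg η fun x => M.kdvWave x * u x) - toL2 (fun x => M.kdvWave x * u x)) := by
    rw [avg_sub (locallyIntegrable_of_memLp hprod) (locallyIntegrable_of_memLp hwu),
      toL2_sub (memLp_opT hη _ _) (memLp_avg hη hwum hwu), opT]
    abel
  have hA := memLp_avg hη hc.measurable h2
  have hAm := measurable_avg hη hc.measurable
  have hdiff : MemLp (fun x => avg η u x - u x) 2 (volume : Measure ℝ) := hA.sub h2
  have hdm : Measurable fun x => avg η u x - u x := hAm.sub hc.measurable
  have hwm : Measurable (avg η M.W₀) := measurable_avg_coe hη _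
  have e3 : ‖toL2 (avg η fun y => avg η M.W₀ y * avg η (toL2 u) y - M.kdvWave y * u y)‖
      ≤ ‖toL2 fun y => avg η M.W₀ y * avg η (toL2 u) y - M.kdvWave y * u y‖ :=
    norm_toL2_avg_le hη (hpm.sub hwum) (hprod.sub hwu)
  have b1 : ∀ x, |avg η M.W₀ x * (avg η u x - u x)| ≤ M.amp * |avg η u x - u x| := fun x => by
    rw [abs_mul]; gcongr; exact abs_avg_W₀_le hM hη x
  have b2 : ∀ x, |(avg η M.W₀ x - M.kdvWave x) * u x| ≤ Real.sqrt M.d₁ * M.amp * η * |u x| :=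
    fun x => by
      rw [abs_mul]; gcongr
      rw [avg_W₀ hM, avg_eq_smear hη.ne']
      refine (abs_smear_sub_le hasDerivAt_kdvWave (abs_kdvWaveDeriv_le_const hM) x).trans ?_
      rw [abs_of_pos hη]
  have m1 : Measurable fun x => avg η M.W₀ x * (avg η u x - u x) := hwm.mul hdm
  have m2 : Measurable fun x => (avg η M.W₀ x - M.kdvWave x) * u x :=
    (hwm.sub hwc.measurable).mul hc.measurable
  have l1 := memLp_of_abs_le m1.aestronglyMeasurable hdiff b1
  have l2 := memLp_of_abs_le m2.aestronglyMeasurable h2 b2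
  have e5 : ‖toL2 fun x => avg η u x - u x‖ ≤ η * ‖toL2 u'‖ := by
    rw [toL2_sub hA h2, avg_eq_smear hη.ne']
    have := norm_smear_sub_le (μ := unif) (η := η) hu hc' h2 h2'
    rwa [abs_of_pos hη] at this
  have e2 : ‖toL2 fun y => avg η M.W₀ y * avg η (toL2 u) y - M.kdvWave y * u y‖
      ≤ M.amp * (η * ‖toL2 u'‖) + Real.sqrt M.d₁ * M.amp * η * ‖toL2 u‖ := by
    have h4 : (fun y => avg η M.W₀ y * avg η (toL2 u) y - M.kdvWave y * u y)
        = fun x => avg η M.W₀ x * (avg η u x - u x) + (avg η M.W₀ x - M.kdvWave x) * u x := by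
      funext x; rw [avg_toL2 h2]; ring
    rw [h4, toL2_add l1 l2]
    refine (norm_add_le _ _).trans (add_le_add ?_ ?_)
    · exact (norm_toL2_le_of_abs_le hamp m1.aestronglyMeasurable hdiff b1).trans (by gcongr)
    · exact norm_toL2_le_of_abs_le (by positivity) m2.aestronglyMeasurable h2 b2
  have hdw : MemLp (fun x => M.kdvWaveDeriv x * u x) 2 (volume : Measure ℝ) :=
    memLp_bounded_mul (continuous_kdvWaveDeriv hM) (abs_kdvWaveDeriv_le_const hM) h2
  have hwd : MemLp (fun x => M.kdvWave x * u' x) 2 (volume : Measure ℝ) :=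
    memLp_bounded_mul hwc (abs_kdvWave_le hM) h2'
  have e4 : ‖toL2 (avg η fun x => M.kdvWave x * u x) - toL2 (fun x => M.kdvWave x * u x)‖
      ≤ η * (Real.sqrt M.d₁ * M.amp * ‖toL2 u‖ + M.amp * ‖toL2 u'‖) := by
    rw [avg_eq_smear hη.ne']
    have := norm_smear_sub_le (μ := unif) (η := η)
      (f' := fun x => M.kdvWaveDeriv x * u x + M.kdvWave x * u' x)
      (fun x => (hasDerivAt_kdvWave x).fun_mul (hu x))
      (((continuous_kdvWaveDeriv hM).mul hc).add (hwc.mul hc')) hwu (hdw.add hwd)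
    rw [abs_of_pos hη, toL2_add hdw hwd] at this
    refine this.trans ?_
    gcongr
    refine (norm_add_le _ _).trans (add_le_add ?_ ?_)
    · refine norm_toL2_le_of_abs_le (by positivity) hdw.1 h2 fun x => ?_
      rw [abs_mul]; gcongr; exact abs_kdvWaveDeriv_le_const hM x
    · refine norm_toL2_le_of_abs_le (by positivity) hwd.1 h2' fun x => ?_
      rw [abs_mul]; gcongr; exact abs_kdvWave_le hM x
  rw [e1]
  refine (norm_add_le _ _).trans ?_
  linarith

/-- A bound for the fourth moment of `β`. -/
def momentβ4 (M : Medium) : ℝ := ∫ ξ in Ioi 0, (M.β ξ * ξ ^ 3 + M.β ξ * ξ ^ 5)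

theorem norm_opM_sub_le (hM : M.Admissible) (hε : 0 < ε)
    (hu : ∀ x, HasDerivAt u (u' x) x) (hc' : Continuous u')
    (h2 : MemLp u 2 (volume : Measure ℝ)) (h2' : MemLp u' 2 (volume : Measure ℝ)) :
    ‖M.opM ε (toL2 u) - (2 * M.momentβ) • toL2 (fun x => M.kdvWave x * u x)‖
      ≤ 2 * (M.momentβ4 *
        (ε * (2 * M.amp * ‖toL2 u'‖ + 2 * (Real.sqrt M.d₁ * M.amp) * ‖toL2 u‖))) := by
  have hamp := (amp_pos hM).le
  set c := 2 * M.amp * ‖toL2 u'‖ + 2 * (Real.sqrt M.d₁ * M.amp) * ‖toL2 u‖ with hc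
  have hc0 : 0 ≤ c := by positivity
  have h1 : M.opM ε (toL2 u) - (2 * M.momentβ) • toL2 (fun x => M.kdvWave x * u x)
      = (2 : ℝ) • ∫ ξ in Ioi 0, (toL2 (M.integrandM ε (toL2 u) ξ)
          - (M.β ξ * ξ ^ 3) • toL2 (fun x => M.kdvWave x * u x)) := by
    rw [integral_sub (bochnerWellDefined_integrandM hM hε _).2 (hM.β_three.smul_const _),
      integral_smul_const, smul_sub, smul_smul]
    rfl
  rw [h1, norm_smul, Real.norm_of_nonneg (by norm_num)]
  gcongr
  rw [momentβ4, ← integral_mul_const]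
  refine norm_integral_le_of_norm_le ((hM.β_three.add hM.β_five).mul_const _) ?_
  filter_upwards [ae_restrict_mem measurableSet_Ioi] with ξ hξ
  have hβ := hM.β_nonneg ξ hξ
  have hξ' : 0 < ξ := hξ
  rw [toL2_integrandM hε _ hξ, ← smul_sub, norm_smul, Real.norm_of_nonneg (by positivity)]
  -- The first order error carries the weight `β ξ⁴`, which is interpolated between the assumed
  -- third and fifth moments.
  have hle : ξ ^ 4 ≤ ξ ^ 3 + ξ ^ 5 := by
    have : 0 ≤ ξ ^ 3 * (ξ ^ 2 - ξ + 1) := by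
      have : 0 ≤ ξ ^ 2 - ξ + 1 := by linarith [sq_nonneg (ξ - 1)]
      positivity
    linarith
  calc _ ≤ M.β ξ * ξ ^ 3 * ((ε * ξ) * c) := by
        gcongr; exact norm_opT_W₀_toL2_sub_le hM (mul_pos hε hξ) hu hc' h2 h2'
    _ = M.β ξ * ξ ^ 4 * (ε * c) := by ring
    _ ≤ M.β ξ * (ξ ^ 3 + ξ ^ 5) * (ε * c) := by gcongr
    _ = _ := by ring

/-- The quadratic form of `B_ε` exceeds `‖V‖²` by the weighted energy gaps divided by `ε²`. A bound
on the form hence makes the gaps of order `ε²` on average. -/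
theorem integral_energyGap (hM : M.Admissible) (hε : 0 < ε) (V : L2) :
    IntegrableOn (fun ξ => M.α ξ * ξ ^ 2 * energyGap (ε * ξ) V) (Ioi 0) ∧
    ∫ ξ in Ioi 0, M.α ξ * ξ ^ 2 * energyGap (ε * ξ) V
      = ε ^ 2 * (inner ℝ (M.opB ε V) V - ‖V‖ ^ 2) := by
  have heq : ∀ ξ ∈ Ioi (0 : ℝ), M.α ξ * ξ ^ 2 / ε ^ 2 *
      inner ℝ (V - opA (ε * ξ) (opA (ε * ξ) V)) V
      = 1 / ε ^ 2 * (M.α ξ * ξ ^ 2 * energyGap (ε * ξ) V) := by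
    intro ξ hξ
    rw [inner_sub_opA_opA (mul_pos hε hξ)]; ring
  have hi : IntegrableOn (fun ξ => inner ℝ (toL2 (M.integrandB ε V ξ)) V) (Ioi 0) :=
    (bochnerWellDefined_integrandB hM hε V).2.inner_const V
  constructor
  · refine IntegrableOn.congr_fun (hi.const_mul (ε ^ 2)) (fun ξ hξ => ?_) measurableSet_Ioi
    rw [toL2_integrandB hε V hξ, real_inner_smul_left, heq ξ hξ]
    field_simp
  · rw [inner_opB hM hε, setIntegral_congr_fun measurableSet_Ioi heq, integral_const_mul,
      real_inner_self_eq_norm_sq]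
    generalize ∫ ξ in Ioi 0, M.α ξ * ξ ^ 2 * energyGap (ε * ξ) V = I
    field_simp
    ring

/-- Since `u''` is merely square-integrable, the averaging kernel is moved to `V`, and the
difference becomes a weighted integral of `⟨u'', V - S_{εξ} V⟩`. The energy gaps of `V` control it,
and they are small because `‖L_ε V‖ ≤ ‖V‖` bounds the quadratic form of `B_ε`. -/
theorem abs_inner_opB_sub_le (hM : M.Admissible) (hε : 0 < ε)
    (hu : ∀ x, HasDerivAt u (u' x) x) (hu' : ∀ x, HasDerivAt u' (u'' x) x)
    (hc'' : Continuous u'')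
    (h2 : MemLp u 2 (volume : Measure ℝ)) (h2'' : MemLp u'' 2 (volume : Measure ℝ))
    {V : L2} (hV : V ≠ 0) (hLV : ‖M.opL ε V‖ ≤ ‖V‖) :
    |inner ℝ (M.opB ε (toL2 u)) V - inner ℝ (toL2 u - (1 / M.d₁) • toL2 u'') V|
      ≤ ε * ((2 * (1 + 2 * M.momentβ * M.amp) + (∫ ξ in Ioi 0, M.α ξ * ξ ^ 6) / 2) / 12)
        * ‖V‖ * ‖toL2 u''‖ := by
  have hVn : 0 < ‖V‖ := norm_pos_iff.2 hV
  have hamp := amp_pos hM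
  have hmom := momentβ_pos hM
  have hd1 := d₁_pos hM
  set W := toL2 u'' with hW
  set Cv : ℝ → L2 := fun ξ => toL2 (smear cub (ε * ξ) V) with hCv
  have hsymm : ∀ ξ, inner ℝ (toL2 (smear cub (ε * ξ) u'')) V = inner ℝ W (Cv ξ) := by
    intro ξ
    conv_lhs => rw [← toL2_coe V]
    rw [inner_toL2 (memLp_smear hc''.measurable h2'') (Lp.memLp V), hW, hCv,
      inner_toL2 h2'' (memLp_smear (measurable_coe V) (Lp.memLp V))]
    exact integral_smear_mul_comm hc''.measurable h2'' (measurable_coe V) (Lp.memLp V)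
  have hB : ∀ ξ ∈ Ioi (0 : ℝ), M.α ξ * ξ ^ 2 / ε ^ 2 *
      inner ℝ (toL2 u - opA (ε * ξ) (opA (ε * ξ) (toL2 u))) V
      = -(M.α ξ * ξ ^ 4 / 12 * inner ℝ W (Cv ξ)) := by
    intro ξ hξ
    rw [sub_opA_opA_toL2 (mul_pos hε hξ) hu hu' hc'' h2 h2'', real_inner_smul_left, hsymm]
    field_simp
  have hi : IntegrableOn (fun ξ => M.α ξ * ξ ^ 4 / 12 * inner ℝ W (Cv ξ)) (Ioi 0) := by
    have hi1 : IntegrableOn (fun ξ => inner ℝ (toL2 (M.integrandB ε (toL2 u) ξ)) V) (Ioi 0) :=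
      (bochnerWellDefined_integrandB hM hε (toL2 u)).2.inner_const V
    refine IntegrableOn.congr_fun hi1.neg (fun ξ hξ => ?_) measurableSet_Ioi
    rw [Pi.neg_apply, toL2_integrandB hε _ hξ, real_inner_smul_left, hB ξ hξ, neg_neg]
  have hi4 : IntegrableOn (fun ξ => M.α ξ * ξ ^ 4 / 12 * inner ℝ W V) (Ioi 0) :=
    (hM.α_four.div_const 12).mul_const _
  have hI4 : ∫ ξ in Ioi 0, M.α ξ * ξ ^ 4 / 12 * inner ℝ W V = 1 / M.d₁ * inner ℝ W V := by
    rw [integral_mul_const, integral_div, integral_α_four hM]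
    congr 1; field_simp
  have hdiff : inner ℝ (M.opB ε (toL2 u)) V - inner ℝ (toL2 u - (1 / M.d₁) • W) V
      = ∫ ξ in Ioi 0, M.α ξ * ξ ^ 4 / 12 * inner ℝ W (V - Cv ξ) := by
    have : ∀ ξ, M.α ξ * ξ ^ 4 / 12 * inner ℝ W (V - Cv ξ)
        = M.α ξ * ξ ^ 4 / 12 * inner ℝ W V - M.α ξ * ξ ^ 4 / 12 * inner ℝ W (Cv ξ) := by
      intro ξ; rw [inner_sub_right]; ring
    simp_rw [this]
    rw [integral_sub hi4 hi, hI4, inner_opB hM hε, setIntegral_congr_fun measurableSet_Ioi hB,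
      integral_neg, inner_sub_left, real_inner_smul_left]
    ring
  obtain ⟨hei, heI⟩ := integral_energyGap hM hε V
  -- `B_ε = L_ε + M_ε`, where `L_ε V` is bounded by assumption and `M_ε` uniformly in `ε`.
  have henergy : inner ℝ (M.opB ε V) V - ‖V‖ ^ 2 ≤ (1 + 2 * M.momentβ * M.amp) * ‖V‖ ^ 2 := by
    have e1 : M.opB ε V = M.opL ε V + M.opM ε V := by rw [opL]; abel
    have e2 := real_inner_le_norm (M.opL ε V) V
    have e3 := real_inner_le_norm (M.opM ε V) V
    have e4 := mul_le_mul_of_nonneg_right hLV hVn.le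
    have e5 := mul_le_mul_of_nonneg_right (norm_opM_le hM hε V) hVn.le
    rw [e1, inner_add_left]
    have := sq_nonneg ‖V‖
    linarith
  -- Weight for Young's inequality: the integrated gaps are of order `ε² ‖V‖²`, so this choice makes
  -- both resulting terms of order `ε ‖V‖`. The second of them carries the sixth moment of `α`.
  set δ := ε * ‖V‖ with hδ
  have hδ0 : 0 < δ := mul_pos hε hVn
  have hbint : IntegrableOn (fun ξ => (2 / δ * (M.α ξ * ξ ^ 2 * energyGap (ε * ξ) V)
      + δ / 2 * (M.α ξ * ξ ^ 6)) * (‖W‖ / 12)) (Ioi 0) :=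
    ((hei.const_mul _).add (hM.α_six.const_mul _)).mul_const _
  have hbound : |∫ ξ in Ioi 0, M.α ξ * ξ ^ 4 / 12 * inner ℝ W (V - Cv ξ)|
      ≤ ∫ ξ in Ioi 0, (2 / δ * (M.α ξ * ξ ^ 2 * energyGap (ε * ξ) V)
      + δ / 2 * (M.α ξ * ξ ^ 6)) * (‖W‖ / 12) := by
    rw [← Real.norm_eq_abs]
    refine norm_integral_le_of_norm_le hbint ?_
    filter_upwards [ae_restrict_mem measurableSet_Ioi] with ξ hξ
    have hα := hM.α_nonneg ξ hξ
    have hξ' : 0 < ξ := hξ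
    rw [norm_mul, Real.norm_of_nonneg (by positivity)]
    have g1 := norm_sub_smear_cub_sq_le (mul_pos hε hξ') V
    have g2 : ‖inner ℝ W (V - Cv ξ)‖ ≤ ‖W‖ * ‖V - Cv ξ‖ := abs_real_inner_le_norm _ _
    have g3 : ξ ^ 2 * ‖V - Cv ξ‖ ≤ 2 / δ * energyGap (ε * ξ) V + δ / 2 * ξ ^ 4 := by
      have g4 : ξ ^ 2 * ‖V - Cv ξ‖ ≤ 1 / (2 * δ) * ‖V - Cv ξ‖ ^ 2 + δ / 2 * ξ ^ 4 := by
        have g5 : 0 ≤ 1 / (2 * δ) * (‖V - Cv ξ‖ - δ * ξ ^ 2) ^ 2 := by positivity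
        have g6 : 1 / (2 * δ) * (‖V - Cv ξ‖ - δ * ξ ^ 2) ^ 2
          = 1 / (2 * δ) * ‖V - Cv ξ‖ ^ 2 + δ / 2 * ξ ^ 4 - ξ ^ 2 * ‖V - Cv ξ‖ := by
          field_simp; ring
        linarith
      have g7 : 1 / (2 * δ) * ‖V - Cv ξ‖ ^ 2 ≤ 1 / (2 * δ) * (4 * energyGap (ε * ξ) V) := by
        gcongr
      have g8 : 1 / (2 * δ) * (4 * energyGap (ε * ξ) V) = 2 / δ * energyGap (ε * ξ) V := by
        field_simp; ring
      linarith
    calc M.α ξ * ξ ^ 4 / 12 * ‖inner ℝ W (V - Cv ξ)‖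
        ≤ M.α ξ * ξ ^ 4 / 12 * (‖W‖ * ‖V - Cv ξ‖) := by gcongr
      _ = M.α ξ * ξ ^ 2 * (ξ ^ 2 * ‖V - Cv ξ‖) * (‖W‖ / 12) := by ring
      _ ≤ M.α ξ * ξ ^ 2 * (2 / δ * energyGap (ε * ξ) V + δ / 2 * ξ ^ 4) * (‖W‖ / 12) := by
          gcongr
      _ = _ := by ring
  rw [hdiff]
  refine hbound.trans ?_
  rw [integral_mul_const, integral_add (hei.const_mul _) (hM.α_six.const_mul _),
    integral_const_mul, integral_const_mul, heI]
  have f1 : 2 / δ * (ε ^ 2 * (inner ℝ (M.opB ε V) V - ‖V‖ ^ 2))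
      ≤ 2 / δ * (ε ^ 2 * ((1 + 2 * M.momentβ * M.amp) * ‖V‖ ^ 2)) := by gcongr
  have f2 : 2 / δ * (ε ^ 2 * ((1 + 2 * M.momentβ * M.amp) * ‖V‖ ^ 2))
      = 2 * (1 + 2 * M.momentβ * M.amp) * δ := by
    rw [hδ]; field_simp
  calc _ ≤ (2 * (1 + 2 * M.momentβ * M.amp) * δ + δ / 2 * ∫ ξ in Ioi 0, M.α ξ * ξ ^ 6)
        * (‖W‖ / 12) := mul_le_mul_of_nonneg_right (by linarith) (by positivity)
    _ = _ := by rw [hδ]; ring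

end Consistency

/-- For small `ε`, the operator `L_ε` is bounded from below on the even functions, uniformly
in `ε`. -/
theorem exists_lower_bound (hM : M.Admissible) : ∃ ε₀ : ℝ, 0 < ε₀ ∧ ∃ C : ℝ, 0 < C ∧
    ∀ ε, 0 < ε → ε ≤ ε₀ → ∀ V ∈ L2even, ‖V‖ ≤ C * ‖M.opL ε V‖ := by
  obtain ⟨C, hC0, hC⟩ := exists_linearized_solution (rate_pos hM)
  have hamp := amp_pos hM
  have hmom := momentβ_pos hM
  have hmom4 : 0 ≤ M.momentβ4 := setIntegral_nonneg measurableSet_Ioi fun ξ hξ => by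
    have := hM.β_nonneg ξ hξ
    have : 0 < ξ := hξ
    positivity
  have hα6 := hM.α_six_pos
  set kB := (2 * (1 + 2 * M.momentβ * M.amp) + (∫ ξ in Ioi 0, M.α ξ * ξ ^ 6) / 2) / 12 with hkB
  set kM := 2 * M.momentβ4 * (2 * M.amp + 2 * (Real.sqrt M.d₁ * M.amp)) with hkM
  have hkB0 : 0 ≤ kB := by positivity
  have hkM0 : 0 ≤ kM := by positivity
  set K := (kB + kM) * C with hK
  have hK0 : 0 ≤ K := by positivity
  -- The bound on `ε` gives `ε K ≤ 1/2`, so the error is absorbed into `‖V‖`, which doubles `C`. The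
  -- extra `1` in the constant covers the case `‖L_ε V‖ > ‖V‖`.
  refine ⟨1 / (2 * (K + 1)), by positivity, 2 * C + 1, by positivity, fun ε hε hε0 V hV => ?_⟩
  rcases le_or_gt ‖M.opL ε V‖ ‖V‖ with hLV | hLV
  swap
  · have h1 : 0 ≤ C * ‖M.opL ε V‖ := by positivity
    linarith
  by_cases hV0 : V = 0
  · rw [hV0, norm_zero]; positivity
  have hVn : 0 < ‖V‖ := norm_pos_iff.2 hV0
  set R := C * ‖M.opL ε V‖ + ε * K * ‖V‖ with hR
  have hR0 : 0 ≤ R := by positivity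
  -- Duality: `φ` is written as the limit operator applied to `u`, that operator is replaced by
  -- `L_ε` up to an error of order `ε`, and `L_ε` is moved onto `V` by symmetry.
  have htest : ∀ φ : ℝ → ℝ, Continuous φ → HasCompactSupport φ → (∀ x, φ (-x) = φ x) →
      inner ℝ (toL2 φ) V ≤ R * ‖toL2 φ‖ := by
    intro φ hφc hφs hφe
    obtain ⟨u, u', u'', hu, hu', hc'', h2, h2', h2'', heq, n0, n1, n2⟩ := hC φ hφc hφs hφe
    have hc := continuous_of_hasDerivAt hu
    have hwu : MemLp (fun x => M.kdvWave x * u x) 2 (volume : Measure ℝ) :=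
      memLp_bounded_mul continuous_kdvWave (abs_kdvWave_le hM) h2
    have hφ : toL2 φ = (toL2 u - (1 / M.d₁) • toL2 u'')
        - (2 * M.momentβ) • toL2 (fun x => M.kdvWave x * u x) := by
      have h3 : MemLp (fun x => u x - 1 / M.d₁ * u'' x) 2 (volume : Measure ℝ) :=
        h2.sub (h2''.const_mul _)
      rw [← toL2_const_mul _ h2'', ← toL2_const_mul _ hwu, ← toL2_sub h2 (h2''.const_mul _),
        ← toL2_sub h3 (hwu.const_mul _)]
      congr 1; funext x
      rw [← heq x, ← two_mul_momentβ_mul_kdvWave hM, rate_sq hM]; ring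
    have s1 := abs_inner_opB_sub_le hM hε hu hu' hc'' h2 h2'' hV0 hLV
    rw [← hkB] at s1
    have s2 := norm_opM_sub_le hM hε hu (continuous_of_hasDerivAt hu') h2 h2'
    have s3 : |inner ℝ (M.opM ε (toL2 u)
        - (2 * M.momentβ) • toL2 (fun x => M.kdvWave x * u x)) V|
        ≤ ε * kM * (C * ‖toL2 φ‖) * ‖V‖ := by
      refine (abs_real_inner_le_norm _ _).trans ?_
      gcongr
      refine s2.trans ?_
      calc _ ≤ 2 * (M.momentβ4 * (ε * (2 * M.amp * (C * ‖toL2 φ‖)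
            + 2 * (Real.sqrt M.d₁ * M.amp) * (C * ‖toL2 φ‖)))) := by gcongr
        _ = _ := by rw [hkM]; ring
    have s4 : inner ℝ (M.opL ε (toL2 u)) V ≤ C * ‖toL2 φ‖ * ‖M.opL ε V‖ := by
      rw [inner_opL_comm hM hε]
      exact (real_inner_le_norm _ _).trans (by gcongr)
    have s5 : ε * kB * ‖V‖ * ‖toL2 u''‖ ≤ ε * kB * ‖V‖ * (C * ‖toL2 φ‖) := by gcongr
    have s6 : inner ℝ (toL2 φ) V = inner ℝ (M.opL ε (toL2 u)) V
        - (inner ℝ (M.opB ε (toL2 u)) V - inner ℝ (toL2 u - (1 / M.d₁) • toL2 u'') V)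
        + inner ℝ (M.opM ε (toL2 u) - (2 * M.momentβ) • toL2 (fun x => M.kdvWave x * u x)) V := by
      rw [hφ, opL]
      simp only [inner_sub_left]
      ring
    have s7 := neg_le_of_abs_le s1
    have s8 := le_of_abs_le s3
    rw [s6]
    have s9 : R * ‖toL2 φ‖ = C * ‖toL2 φ‖ * ‖M.opL ε V‖ + ε * kB * ‖V‖ * (C * ‖toL2 φ‖)
        + ε * kM * (C * ‖toL2 φ‖) * ‖V‖ := by rw [hR, hK]; ring
    linarith
  -- The test estimate is applied to functions `φ` approaching `V`; evenness of `V` allows `φ` to be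
  -- even.
  have hmain : ‖V‖ ≤ R := by
    have h1 : ∀ δ : ℝ, 0 < δ → ‖V‖ ^ 2 ≤ R * ‖V‖ + δ := by
      intro δ hδ
      obtain ⟨φ, hφc, hφs, hφe, hφV⟩ :=
        exists_even_compactSupport_approx hV (δ := δ / (R + ‖V‖)) (by positivity)
      have h2 := htest φ hφc hφs hφe
      have h3 := real_inner_le_norm (V - toL2 φ) V
      have h4 : ‖toL2 φ‖ ≤ ‖V‖ + δ / (R + ‖V‖) := by
        have := norm_le_norm_add_norm_sub' (toL2 φ) V
        rw [norm_sub_rev] at this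
        linarith
      have h5 : ‖V‖ ^ 2 = inner ℝ (toL2 φ) V + inner ℝ (V - toL2 φ) V := by
        rw [← inner_add_left, add_sub_cancel, real_inner_self_eq_norm_sq]
      have h6 := mul_le_mul_of_nonneg_left h4 hR0
      have h7 := mul_le_mul_of_nonneg_right hφV hVn.le
      have h8 : (R + ‖V‖) * (δ / (R + ‖V‖)) = δ := by
        have : R + ‖V‖ ≠ 0 := by positivity
        field_simp
      linarith
    have h9 : ‖V‖ ^ 2 ≤ R * ‖V‖ := le_of_forall_pos_le_add h1
    rw [sq] at h9
    exact le_of_mul_le_mul_right h9 hVn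
  have hεK : ε * K ≤ 1 / 2 := by
    have : ε * K ≤ 1 / (2 * (K + 1)) * (K + 1) := by gcongr; linarith
    have h2 : 1 / (2 * (K + 1)) * (K + 1) = 1 / 2 := by field_simp
    linarith
  have h3 : ε * K * ‖V‖ ≤ 1 / 2 * ‖V‖ := by gcongr
  have h4 := norm_nonneg (M.opL ε V)
  linarith

end Medium

/-! ### The higher order forces and the Lipschitz bounds -/

namespace Medium

variable {M : Medium} {ε ρ : ℝ}

theorem γ_nonneg (hM : M.Admissible) {ξ : ℝ} (hξ : 0 < ξ) : 0 ≤ M.γ ξ := by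
  have := hM.dψ_bound ξ hξ 1 (by simp)
  rw [one_pow, mul_one] at this
  exact (abs_nonneg _).trans this

/-- Mean value inequality on `[-m, m]`, where the derivative in `r` is at most `γ m²`. -/
theorem abs_dψ_sub_le (hM : M.Admissible) (hb : M.BoundUpTo ρ) {ξ m r s : ℝ} (hξ : 0 < ξ)
    (hm : m ≤ ρ * Real.sqrt ξ) (hr : |r| ≤ m) (hs : |s| ≤ m) :
    |M.dψ r ξ - M.dψ s ξ| ≤ M.γ ξ * m ^ 2 * |r - s| := by
  have hd : Differentiable ℝ fun r => M.dψ r ξ :=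
    (hM.dψ_contDiff ξ hξ).differentiable (by norm_num)
  refine (convex_Icc (-m) m).norm_image_sub_le_of_norm_deriv_le (f := fun r => M.dψ r ξ)
    (fun t _ => hd t) (fun t ht => ?_) (abs_le.1 hs) (abs_le.1 hr)
  have ht' : |t| ≤ m := abs_le.2 ht
  refine (hb ξ hξ t (ht'.trans hm)).trans ?_
  have := γ_nonneg hM hξ
  rw [← sq_abs]
  gcongr

/-- The nonlinear force of the bond `ξ`. -/
def force (M : Medium) (ε ξ : ℝ) (W : L2) (y : ℝ) : ℝ :=
  M.dψ (ε ^ 2 * ξ * avg (ε * ξ) W y) ξ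

theorem measurable_force (hM : M.Admissible) (hε : 0 < ε) {ξ : ℝ} (hξ : 0 < ξ) (W : L2) :
    Measurable (M.force ε ξ W) :=
  (hM.dψ_contDiff ξ hξ).continuous.measurable.comp
    ((measurable_avg_coe (mul_pos hε hξ) W).const_mul _)

theorem abs_force_sub_le (hM : M.Admissible) (hb : M.BoundUpTo ρ) (hε : 0 < ε) {ξ S : ℝ}
    (hξ : 0 < ξ) (hS : ε ^ 2 * ξ * S ≤ ρ * Real.sqrt ξ) {W W' : L2}
    (hW : ∀ x, |avg (ε * ξ) W x| ≤ S) (hW' : ∀ x, |avg (ε * ξ) W' x| ≤ S) (x : ℝ) :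
    |M.force ε ξ W x - M.force ε ξ W' x|
      ≤ M.γ ξ * (ε ^ 2 * ξ * S) ^ 2 * (ε ^ 2 * ξ) * |avg (ε * ξ) W x - avg (ε * ξ) W' x| := by
  have h1 : ∀ {U : L2}, (∀ x, |avg (ε * ξ) U x| ≤ S) →
      |ε ^ 2 * ξ * avg (ε * ξ) U x| ≤ ε ^ 2 * ξ * S := fun {U} hU => by
    rw [abs_mul, abs_of_pos (by positivity)]
    gcongr
    exact hU x
  refine (abs_dψ_sub_le hM hb hξ hS (h1 hW) (h1 hW')).trans ?_
  rw [← mul_sub, abs_mul, abs_of_pos (by positivity : 0 < ε ^ 2 * ξ)]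
  exact le_of_eq (by ring)

theorem avg_zero (η x : ℝ) : avg η (0 : L2) x = 0 := by
  rw [avg_congr (Lp.coeFn_zero ℝ 2 volume)]
  simp [avg]

theorem force_zero (hM : M.Admissible) {ξ : ℝ} (hξ : 0 < ξ) (x : ℝ) : M.force ε ξ 0 x = 0 := by
  rw [force, avg_zero, mul_zero, hM.dψ_zero ξ hξ]

theorem memLp_force (hM : M.Admissible) (hb : M.BoundUpTo ρ) (hε : 0 < ε) {ξ S : ℝ}
    (hξ : 0 < ξ) (hS : ε ^ 2 * ξ * S ≤ ρ * Real.sqrt ξ) {W : L2}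
    (hW : ∀ x, |avg (ε * ξ) W x| ≤ S) : MemLp (M.force ε ξ W) 2 (volume : Measure ℝ) := by
  refine memLp_of_abs_le (measurable_force hM hε hξ W).aestronglyMeasurable
    (memLp_avg_coe (mul_pos hε hξ) W) (C := M.γ ξ * (ε ^ 2 * ξ * S) ^ 2 * (ε ^ 2 * ξ)) fun x => ?_
  have := abs_force_sub_le hM hb hε hξ hS hW (W' := 0)
    (fun x => by rw [avg_zero, abs_zero]; exact (abs_nonneg _).trans (hW 0)) x
  rwa [force_zero hM hξ, avg_zero, sub_zero, sub_zero] at this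

theorem norm_avg_force_sub_le (hM : M.Admissible) (hb : M.BoundUpTo ρ) (hε : 0 < ε) {ξ S : ℝ}
    (hξ : 0 < ξ) (hS : ε ^ 2 * ξ * S ≤ ρ * Real.sqrt ξ) {W W' : L2}
    (hW : ∀ x, |avg (ε * ξ) W x| ≤ S) (hW' : ∀ x, |avg (ε * ξ) W' x| ≤ S) :
    ‖toL2 (avg (ε * ξ) (M.force ε ξ W)) - toL2 (avg (ε * ξ) (M.force ε ξ W'))‖
      ≤ M.γ ξ * (ε ^ 2 * ξ * S) ^ 2 * (ε ^ 2 * ξ) * ‖W - W'‖ := by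
  have hη := mul_pos hε hξ
  have hγ := γ_nonneg hM hξ
  have m := memLp_force hM hb hε hξ hS hW
  have m' := memLp_force hM hb hε hξ hS hW'
  have hm := measurable_force hM hε hξ W
  have hm' := measurable_force hM hε hξ W'
  rw [← toL2_sub (memLp_avg hη hm m) (memLp_avg hη hm' m'),
    ← avg_sub (locallyIntegrable_of_memLp m) (locallyIntegrable_of_memLp m')]
  refine (norm_toL2_avg_le hη (hm.sub hm') (m.sub m')).trans ?_
  refine (norm_toL2_le_of_abs_le (by positivity) (hm.sub hm').aestronglyMeasurable
    (memLp_avg_coe hη (W - W')) fun x => ?_).trans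
    (mul_le_mul_of_nonneg_left (norm_opA_le hη (W - W')) (by positivity))
  rw [avg_coe_sub]
  exact abs_force_sub_le hM hb hε hξ hS hW hW' x

/-- The strain satisfies `ε² ξ |A_{εξ} W| ≤ ε^(3/2) √ξ ‖W‖`, so for small `ε` it stays in the range
`|r| ≤ ρ √ξ` for every `ξ` simultaneously. -/
theorem scale_le (hε : 0 < ε) (hε1 : ε ≤ 1) {ξ N : ℝ} (hξ : 0 < ξ) (hN0 : 0 ≤ N)
    (hN : ε * N ≤ ρ) : ε ^ 2 * ξ * ((ε * ξ) ^ (-1 / 2 : ℝ) * N) ≤ ρ * Real.sqrt ξ := by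
  have hη := mul_pos hε hξ
  have h1 : (ε * ξ) * (ε * ξ) ^ (-1 / 2 : ℝ) = Real.sqrt (ε * ξ) := by
    rw [Real.sqrt_eq_rpow]
    nth_rewrite 1 [← Real.rpow_one (ε * ξ)]
    rw [← Real.rpow_add hη]; norm_num
  have h2 : Real.sqrt (ε * ξ) ≤ Real.sqrt ξ :=
    Real.sqrt_le_sqrt (mul_le_of_le_one_left hξ.le hε1)
  calc ε ^ 2 * ξ * ((ε * ξ) ^ (-1 / 2 : ℝ) * N)
      = (ε * N) * ((ε * ξ) * (ε * ξ) ^ (-1 / 2 : ℝ)) := by ring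
    _ ≤ (ε * N) * Real.sqrt ξ := by rw [h1]; gcongr
    _ ≤ ρ * Real.sqrt ξ := by gcongr

theorem rpow_neg_half_sq {η : ℝ} (hη : 0 < η) : (η ^ (-1 / 2 : ℝ)) ^ 2 = 1 / η := by
  rw [← Real.rpow_natCast, ← Real.rpow_mul hη.le, one_div, ← Real.rpow_neg_one]
  norm_num

/-- A Carathéodory function, continuous in `r` and measurable in `ξ`, is jointly measurable. -/
theorem measurable_dψ (hM : M.Admissible) :
    Measurable (Function.uncurry fun ξ r : ℝ => if 0 < ξ then M.dψ r ξ else 0) := by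
  have h1 : ∀ ξ, Continuous fun r => if 0 < ξ then M.dψ r ξ else 0 := by
    intro ξ
    by_cases hξ : 0 < ξ
    · simpa [hξ] using (hM.dψ_contDiff ξ hξ).continuous
    · simpa [hξ] using continuous_const
  have h2 : ∀ r, Measurable fun ξ => if 0 < ξ then M.dψ r ξ else 0 := by
    intro r
    have := (hM.dψ_continuous r).measurable_piecewise (g := fun _ => (0 : ℝ))
      continuousOn_const measurableSet_Ioi
    convert this using 1
    funext ξ
    simp [Set.piecewise]
  have h3 := measurable_uncurry_of_continuous_of_measurable
    (u := fun r ξ : ℝ => if 0 < ξ then M.dψ r ξ else 0) h1 h2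
  exact h3.comp measurable_swap

theorem integrandP_eq (W : L2) :
    M.integrandP ε W = fun ξ x => ξ * avg (ε * ξ) (M.force ε ξ W) x := rfl

theorem bochnerWellDefined_integrandP (hM : M.Admissible) (hb : M.BoundUpTo ρ) (hε : 0 < ε)
    (hε1 : ε ≤ 1) {W : L2} (hW : ε * ‖W‖ ≤ ρ) : BochnerWellDefined (M.integrandP ε W) := by
  set F : ℝ → ℝ → ℝ := fun ξ => smear unif (ε * ξ) fun y =>
    if 0 < ξ then M.dψ (ε ^ 2 * ξ * smear unif (ε * ξ) W y) ξ else 0 with hF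
  have hFeq : ∀ ξ, 0 < ξ → F ξ = avg (ε * ξ) (M.force ε ξ W) := by
    intro ξ hξ
    have hη := mul_pos hε hξ
    have h : (fun y => if 0 < ξ then M.dψ (ε ^ 2 * ξ * smear unif (ε * ξ) W y) ξ else 0)
        = M.force ε ξ W := by
      funext y
      rw [if_pos hξ, force, avg_eq_smear hη.ne']
    rw [avg_eq_smear hη.ne', ← h]
  refine bochnerWellDefined_of_le (c := fun ξ => ξ) (F := F)
    (b := fun ξ => M.γ ξ * ξ ^ 3 * (ε ^ 5 * ‖W‖ ^ 3)) (fun ξ hξ x => ?_)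
    measurable_id.aestronglyMeasurable ?_ (fun ξ hξ => ?_) (hM.γ_three.mul_const _)
    fun ξ hξ => ?_
  · rw [hFeq ξ hξ]; rfl
  · refine measurable_smear_uncurry ?_ (measurable_const_mul ε)
    have h1 : Measurable fun p : ℝ × ℝ => (p.1, ε ^ 2 * p.1 * smear unif (ε * p.1) W p.2) :=
      measurable_fst.prodMk ((measurable_fst.const_mul (ε ^ 2)).mul (measurable_avg_uncurry ε W))
    exact (measurable_dψ hM).comp h1
  · have hη := mul_pos hε hξ
    rw [hFeq ξ hξ]
    exact memLp_avg hη (measurable_force hM hε hξ W) (memLp_force hM hb hε hξ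
      (scale_le hε hε1 hξ (norm_nonneg W) hW) (abs_avg_le hη W))
  · have hη := mul_pos hε hξ
    have h1 := norm_avg_force_sub_le hM hb hε hξ (scale_le hε hε1 hξ (norm_nonneg W) hW)
      (abs_avg_le hη W) (W' := 0) (fun x => by rw [avg_zero, abs_zero]; positivity)
    have h2 : toL2 (avg (ε * ξ) (M.force ε ξ 0)) = 0 := by
      have : avg (ε * ξ) (M.force ε ξ 0) = fun _ => 0 := by
        funext x; simp [avg, force_zero hM hξ]
      rw [this]
      exact toL2_eq_of_ae (Lp.coeFn_zero ℝ 2 volume).symm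
    rw [h2, sub_zero, sub_zero] at h1
    rw [hFeq ξ hξ, abs_of_pos hξ]
    calc _ ≤ ξ * (M.γ ξ * (ε ^ 2 * ξ * ((ε * ξ) ^ (-1 / 2 : ℝ) * ‖W‖)) ^ 2 * (ε ^ 2 * ξ) * ‖W‖) := by
          gcongr
      _ = ξ * (M.γ ξ * ((ε ^ 2 * ξ) ^ 2 * ((ε * ξ) ^ (-1 / 2 : ℝ)) ^ 2 * ‖W‖ ^ 2) * (ε ^ 2 * ξ)
          * ‖W‖) := by ring
      _ = _ := by rw [rpow_neg_half_sq hη]; field_simp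

theorem opP_mem_L2even (hM : M.Admissible) (hb : M.BoundUpTo ρ) (hε : 0 < ε)
    (hε1 : ε ≤ 1) {W : L2} (hW : ε * ‖W‖ ≤ ρ) (he : W ∈ L2even) : M.opP ε W ∈ L2even := by
  refine mem_evenSubmodule.1 (Submodule.smul_mem _ _ (mem_evenSubmodule.2 ?_))
  refine bochner_mem_L2even (bochnerWellDefined_integrandP hM hb hε hε1 hW) fun ξ hξ => ?_
  have hη := mul_pos hε hξ
  refine toL2_mem_L2even fun x => ?_
  change ξ * avg (ε * ξ) (M.force ε ξ W) (-x) = ξ * avg (ε * ξ) (M.force ε ξ W) x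
  rw [avg_even hη (fun y => by rw [force, force, avg_coe_even hη he]) x]

/-- The Lipschitz constant of the higher order force terms. -/
def lipP (M : Medium) (ε D : ℝ) : ℝ := 2 * M.amp ^ 2 * (∫ ξ in Ioi 0, M.γ ξ * ξ ^ 4)
  + 2 * (ε ^ 3 * D ^ 2) * ∫ ξ in Ioi 0, M.γ ξ * ξ ^ 3

/-- Each bond contributes `γ ξ⁴ ε⁶` times the square of a sup bound on the averages, and the
prefactor `ε⁻⁶` is exactly consumed. The sup bound is the amplitude of the wave plus a correction of
order `ε^(3/2) ξ^(-1/2)`, whose square leads to the third moment of `γ`. -/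
theorem norm_opP_sub_le (hM : M.Admissible) (hb : M.BoundUpTo ρ) (hε : 0 < ε)
    (hε1 : ε ≤ 1) {N D : ℝ} (hN : ε * N ≤ ρ) {W W' : L2} (hWN : ‖W‖ ≤ N) (hWN' : ‖W'‖ ≤ N)
    (hW : ∀ η, 0 < η → ∀ x, |avg η W x| ≤ M.amp + ε ^ 2 * (η ^ (-1 / 2 : ℝ) * D))
    (hW' : ∀ η, 0 < η → ∀ x, |avg η W' x| ≤ M.amp + ε ^ 2 * (η ^ (-1 / 2 : ℝ) * D)) :
    ‖M.opP ε W - M.opP ε W'‖ ≤ M.lipP ε D * ‖W - W'‖ := by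
  have hN0 : 0 ≤ N := (norm_nonneg _).trans hWN
  have b := bochnerWellDefined_integrandP hM hb hε hε1 (W := W)
    (le_trans (by gcongr) hN)
  have b' := bochnerWellDefined_integrandP hM hb hε hε1 (W := W')
    (le_trans (by gcongr) hN)
  have hint : IntegrableOn (fun ξ => (2 * M.amp ^ 2 * (M.γ ξ * ξ ^ 4)
      + 2 * (ε ^ 3 * D ^ 2) * (M.γ ξ * ξ ^ 3)) * (ε ^ 6 * ‖W - W'‖)) (Ioi 0) :=
    ((hM.γ_four.const_mul _).add (hM.γ_three.const_mul _)).mul_const _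
  have hmain : ‖bochner (M.integrandP ε W) - bochner (M.integrandP ε W')‖
      ≤ ∫ ξ in Ioi 0, (2 * M.amp ^ 2 * (M.γ ξ * ξ ^ 4)
      + 2 * (ε ^ 3 * D ^ 2) * (M.γ ξ * ξ ^ 3)) * (ε ^ 6 * ‖W - W'‖) := by
    rw [bochner_sub b b']
    refine norm_bochner_le hint fun ξ hξ => ?_
    have hη := mul_pos hε hξ
    have hγ := γ_nonneg hM hξ
    rw [toL2_sub (b.1 ξ hξ) (b'.1 ξ hξ)]
    -- The bound `S₁` keeps the strain in the admissible range, while `S₂` gives a Lipschitz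
    -- constant uniform in `ε`. Their minimum has both properties.
    set S₁ := (ε * ξ) ^ (-1 / 2 : ℝ) * N with hS₁
    set S₂ := M.amp + ε ^ 2 * ((ε * ξ) ^ (-1 / 2 : ℝ) * D) with hS₂
    have hS₁b : ∀ {U : L2}, ‖U‖ ≤ N → ∀ x, |avg (ε * ξ) U x| ≤ S₁ := fun {U} hU x =>
      (abs_avg_le hη U x).trans (by rw [hS₁]; gcongr)
    have hSm : ε ^ 2 * ξ * min S₁ S₂ ≤ ρ * Real.sqrt ξ :=
      le_trans (by gcongr; exact min_le_left _ _) (scale_le hε hε1 hξ hN0 hN)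
    have hUW : ∀ x, |avg (ε * ξ) W x| ≤ min S₁ S₂ := fun x =>
      le_min (hS₁b hWN x) (hW _ hη x)
    have hUW' : ∀ x, |avg (ε * ξ) W' x| ≤ min S₁ S₂ := fun x =>
      le_min (hS₁b hWN' x) (hW' _ hη x)
    have h1 := norm_avg_force_sub_le hM hb hε hξ hSm hUW hUW'
    have hS0 : 0 ≤ min S₁ S₂ := (abs_nonneg _).trans (hUW 0)
    have h2 : (min S₁ S₂) ^ 2 ≤ 2 * M.amp ^ 2 + 2 * (ε ^ 3 * D ^ 2) / ξ := by
      calc (min S₁ S₂) ^ 2 ≤ S₂ ^ 2 := by gcongr; exact min_le_right _ _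
        _ ≤ 2 * M.amp ^ 2 + 2 * (ε ^ 2 * ((ε * ξ) ^ (-1 / 2 : ℝ) * D)) ^ 2 := by
            have := sq_nonneg (M.amp - ε ^ 2 * ((ε * ξ) ^ (-1 / 2 : ℝ) * D))
            rw [hS₂]; linarith
        _ = 2 * M.amp ^ 2 + 2 * (ε ^ 4 * (((ε * ξ) ^ (-1 / 2 : ℝ)) ^ 2) * D ^ 2) := by ring
        _ = _ := by rw [rpow_neg_half_sq hη]; field_simp
    have e1 : toL2 (M.integrandP ε W ξ) - toL2 (M.integrandP ε W' ξ)
        = ξ • (toL2 (avg (ε * ξ) (M.force ε ξ W)) - toL2 (avg (ε * ξ) (M.force ε ξ W'))) := by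
      have m := memLp_avg hη (measurable_force hM hε hξ W) (memLp_force hM hb hε hξ hSm hUW)
      have m' := memLp_avg hη (measurable_force hM hε hξ W') (memLp_force hM hb hε hξ hSm hUW')
      rw [smul_sub, ← toL2_const_mul _ m, ← toL2_const_mul _ m']; rfl
    rw [e1, norm_smul, Real.norm_of_nonneg hξ.le]
    calc _ ≤ ξ * (M.γ ξ * (ε ^ 2 * ξ * min S₁ S₂) ^ 2 * (ε ^ 2 * ξ) * ‖W - W'‖) := by gcongr
      _ = ξ ^ 4 * M.γ ξ * ε ^ 6 * ‖W - W'‖ * (min S₁ S₂) ^ 2 := by ring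
      _ ≤ ξ ^ 4 * M.γ ξ * ε ^ 6 * ‖W - W'‖ * (2 * M.amp ^ 2 + 2 * (ε ^ 3 * D ^ 2) / ξ) := by
          gcongr
      _ = _ := by field_simp
  rw [opP, opP, ← smul_sub, norm_smul, Real.norm_of_nonneg (by positivity)]
  rw [integral_mul_const, integral_add (hM.γ_four.const_mul _) (hM.γ_three.const_mul _),
    integral_const_mul, integral_const_mul] at hmain
  rw [one_div, ← div_eq_inv_mul, div_le_iff₀ (by positivity), lipP]
  refine hmain.trans (le_of_eq (by ring))

theorem opP_zero (hM : M.Admissible) : M.opP ε 0 = 0 := by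
  have : bochner (M.integrandP ε 0) = 0 := by
    rw [bochner, setIntegral_congr_fun measurableSet_Ioi (g := fun _ => (0 : L2)), integral_zero]
    intro ξ hξ
    have : M.integrandP ε 0 ξ = fun _ => 0 := by
      funext x
      rw [integrandP_eq]
      simp [avg, force_zero hM hξ]
    simp only
    rw [this]
    exact toL2_eq_of_ae (Lp.coeFn_zero ℝ 2 volume).symm
  rw [opP, this, smul_zero]

theorem abs_avg_W₀_add_le (hM : M.Admissible) {D : ℝ} {V : L2} (hV : ‖V‖ ≤ D)
    {η : ℝ} (hη : 0 < η) (x : ℝ) :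
    |avg η (M.W₀ + ε ^ 2 • V : L2) x| ≤ M.amp + ε ^ 2 * (η ^ (-1 / 2 : ℝ) * D) := by
  rw [avg_coe_add, avg_coe_smul]
  refine (abs_add_le _ _).trans (add_le_add (abs_avg_W₀_le hM hη x) ?_)
  rw [abs_mul, abs_of_nonneg (sq_nonneg ε)]
  gcongr
  exact (abs_avg_le hη V x).trans (by gcongr)

theorem norm_opQ_sub_le (hM : M.Admissible) (hε : 0 < ε) (V V' : L2) :
    ‖M.opQ ε V - M.opQ ε V'‖ ≤ (∫ ξ in Ioi 0, M.β ξ * ξ ^ (5 / 2 : ℝ)) *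
      (ε ^ (-1 / 2 : ℝ) * ‖V + V'‖ * ‖V - V'‖) := by
  have b := bochnerWellDefined_integrandQ hM hε V
  have b' := bochnerWellDefined_integrandQ hM hε V'
  rw [opQ, opQ, bochner_sub b b', ← integral_mul_const]
  refine norm_bochner_le (hM.β_fiveHalves.mul_const _) fun ξ hξ => ?_
  have hη := mul_pos hε hξ
  have hβ := hM.β_nonneg ξ hξ
  rw [toL2_sub (b.1 ξ hξ) (b'.1 ξ hξ), toL2_integrandQ hε V hξ, toL2_integrandQ hε V' hξ,
    ← smul_sub, opT_self_sub_self hη, norm_smul, Real.norm_of_nonneg (by positivity)]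
  calc _ ≤ M.β ξ * ξ ^ 3 * ((ε * ξ) ^ (-1 / 2 : ℝ) * ‖V + V'‖ * ‖V - V'‖) := by
        gcongr; exact norm_opT_le hη _ _
    _ = M.β ξ * (ξ ^ 3 * (ε * ξ) ^ (-1 / 2 : ℝ)) * ‖V + V'‖ * ‖V - V'‖ := by ring
    _ = _ := by rw [rpow_weight hε hξ]; ring

end Medium

/-! ### The contraction on the ball of even functions -/

theorem isComplete_evenBall (D : ℝ) : IsComplete (evenBall D) := by
  have : evenBall D = (evenSubmodule : Set L2) ∩ Metric.closedBall 0 D := by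
    ext V
    simp [evenBall, ← mem_evenSubmodule]
  rw [this]
  exact (isClosed_evenSubmodule.inter Metric.isClosed_closedBall).isComplete

theorem existsUnique_fixedPoint_evenBall {D : ℝ} (hD : 0 ≤ D) {F : L2 → L2}
    (hmaps : ∀ V ∈ evenBall D, F V ∈ evenBall D)
    (hlip : ∀ V ∈ evenBall D, ∀ V' ∈ evenBall D, ‖F V - F V'‖ ≤ 1 / 2 * ‖V - V'‖) :
    ∃! V : L2, V ∈ evenBall D ∧ F V = V := by
  have hmaps' : MapsTo F (evenBall D) (evenBall D) := hmaps
  have hc : ContractingWith (1 / 2) (hmaps'.restrict F _ _) := by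
    refine ⟨by rw [div_lt_one] <;> norm_num, LipschitzWith.of_dist_le_mul fun V V' => ?_⟩
    simpa [Subtype.dist_eq, dist_eq_norm] using hlip V V.2 V' V'.2
  have h0 : (0 : L2) ∈ evenBall D :=
    ⟨mem_evenSubmodule.1 (Submodule.zero_mem _), by rwa [norm_zero]⟩
  obtain ⟨V, hV, hfix, -, -⟩ :=
    hc.exists_fixedPoint' (isComplete_evenBall D) hmaps' h0 (edist_ne_top _ _)
  refine ⟨V, ⟨hV, hfix⟩, fun V' hV' => ?_⟩
  have h := hlip V' hV'.1 V hV
  rw [hV'.2, hfix] at h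
  exact sub_eq_zero.1 (norm_eq_zero.1 (le_antisymm (by linarith) (norm_nonneg _)))

namespace Medium

variable {M : Medium} {ε ρ : ℝ}

theorem opF_spec (hL : BijOn (M.opL ε) L2even L2even) {V : L2} (hV : M.source ε V ∈ L2even) :
    M.opF ε V ∈ L2even ∧ M.opL ε (M.opF ε V) = M.source ε V :=
  ⟨Function.invFunOn_mem (hL.surjOn hV), Function.invFunOn_eq (hL.surjOn hV)⟩

theorem norm_W₀_add_le {D : ℝ} (hε : 0 < ε) (hε1 : ε ≤ 1) {V : L2} (hV : ‖V‖ ≤ D) :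
    ‖M.W₀ + ε ^ 2 • V‖ ≤ ‖M.W₀‖ + D := by
  refine (norm_add_le _ _).trans ?_
  rw [norm_smul, Real.norm_of_nonneg (sq_nonneg ε)]
  have : ε ^ 2 * ‖V‖ ≤ 1 * ‖V‖ := by
    gcongr
    exact pow_le_one₀ hε.le hε1
  linarith

theorem opL_sub (hM : M.Admissible) (hε : 0 < ε) (V V' : L2) :
    M.opL ε (V - V') = M.opL ε V - M.opL ε V' := (linL M hM hε).map_sub V V'

theorem resK_mem_L2even (hM : M.Admissible) (hε : 0 < ε) : M.resK ε ∈ L2even :=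
  mem_evenSubmodule.1 (Submodule.smul_mem _ _ (Submodule.sub_mem _
    (mem_evenSubmodule.2 (opQ_mem_L2even hM hε W₀_mem_L2even))
    (mem_evenSubmodule.2 (opB_mem_L2even hM hε W₀_mem_L2even))))

theorem source_mem_L2even (hM : M.Admissible) (hb : M.BoundUpTo ρ) (hε : 0 < ε) (hε1 : ε ≤ 1)
    {D : ℝ} (hρ : ε * (‖M.W₀‖ + D) ≤ ρ) {V : L2} (hV : V ∈ evenBall D) :
    M.source ε V ∈ L2even := by
  have hW := mem_evenSubmodule.2 (W₀_mem_L2even (M := M))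
  have hD : 0 ≤ D := (norm_nonneg _).trans hV.2
  have h0 := opP_mem_L2even hM hb hε hε1 (W := M.W₀)
    (le_trans (by gcongr; linarith) hρ) W₀_mem_L2even
  have h1 := opP_mem_L2even hM hb hε hε1 (W := M.W₀ + ε ^ 2 • V)
    (le_trans (by gcongr; exact norm_W₀_add_le hε hε1 hV.2) hρ)
    (mem_evenSubmodule.1 (add_mem hW (Submodule.smul_mem _ _ (mem_evenSubmodule.2 hV.1))))
  refine mem_evenSubmodule.1 (add_mem (add_mem (add_mem
    (mem_evenSubmodule.2 (resK_mem_L2even hM hε)) (mem_evenSubmodule.2 h0))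
    (Submodule.smul_mem _ _ (mem_evenSubmodule.2 (opQ_mem_L2even hM hε hV.1))))
    (Submodule.smul_mem _ _ (Submodule.smul_mem _ _ (sub_mem (mem_evenSubmodule.2 h1)
      (mem_evenSubmodule.2 h0)))))

/-- `K_ε` and `E_ε` drop out, and `ε²` cancels the division in `N_ε`. The remaining factor `ε²` of
the force term comes from its argument `W₀ + ε² V`. -/
theorem source_sub (hε : 0 < ε) (V V' : L2) :
    M.source ε V - M.source ε V' = ε ^ 2 • (M.opQ ε V - M.opQ ε V')
      + (M.opP ε (M.W₀ + ε ^ 2 • V) - M.opP ε (M.W₀ + ε ^ 2 • V')) := by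
  have h : ∀ U : L2, ε ^ 2 • M.opN ε U = M.opP ε (M.W₀ + ε ^ 2 • U) - M.opP ε M.W₀ := fun U => by
    rw [opN, smul_smul, mul_one_div_cancel (by positivity), one_smul]
  rw [source, source, h, h, smul_sub]
  abel

theorem lipP_le (hM : M.Admissible) {D : ℝ} (hε : 0 < ε) (hε1 : ε ≤ 1) :
    M.lipP ε D ≤ M.lipP 1 D := by
  have h3 : 0 ≤ ∫ ξ in Ioi 0, M.γ ξ * ξ ^ 3 :=
    setIntegral_nonneg measurableSet_Ioi fun ξ hξ =>
      mul_nonneg (γ_nonneg hM hξ) (pow_nonneg (le_of_lt hξ) _)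
  have : ε ^ 3 ≤ 1 ^ 3 := by gcongr
  rw [lipP, lipP]
  gcongr

theorem lipP_nonneg (hM : M.Admissible) {D : ℝ} (hε : 0 < ε) : 0 ≤ M.lipP ε D := by
  have h : ∀ n : ℕ, 0 ≤ ∫ ξ in Ioi 0, M.γ ξ * ξ ^ n := fun n =>
    setIntegral_nonneg measurableSet_Ioi fun ξ hξ =>
      mul_nonneg (γ_nonneg hM hξ) (pow_nonneg (le_of_lt hξ) _)
  have h3 := h 3
  have h4 := h 4
  rw [lipP]
  positivity

theorem norm_source_sub_le (hM : M.Admissible) (hb : M.BoundUpTo ρ) (hε : 0 < ε) (hε1 : ε ≤ 1)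
    {D : ℝ} (hρ : ε * (‖M.W₀‖ + D) ≤ ρ) {V V' : L2} (hV : ‖V‖ ≤ D) (hV' : ‖V'‖ ≤ D) :
    ‖M.source ε V - M.source ε V'‖
      ≤ ε * (2 * D * (∫ ξ in Ioi 0, M.β ξ * ξ ^ (5 / 2 : ℝ)) + M.lipP 1 D) * ‖V - V'‖ := by
  have hQ := norm_opQ_sub_le hM hε V V'
  have hP := norm_opP_sub_le hM hb hε hε1 hρ (norm_W₀_add_le hε hε1 hV) (norm_W₀_add_le hε hε1 hV')
    (fun η hη x => abs_avg_W₀_add_le hM hV hη x) (fun η hη x => abs_avg_W₀_add_le hM hV' hη x)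
  rw [add_sub_add_left_eq_sub, ← smul_sub, norm_smul, Real.norm_of_nonneg (sq_nonneg ε)] at hP
  have hsum : ‖V + V'‖ ≤ 2 * D := (norm_add_le _ _).trans (by linarith)
  have hβ := hM.β_fiveHalves_pos
  have hD : 0 ≤ D := (norm_nonneg _).trans hV
  -- The quadratic term is of order `ε^(3/2)`, which is at most `ε`.
  have hrp : ε ^ 2 * ε ^ (-1 / 2 : ℝ) ≤ ε := by
    rw [← Real.rpow_natCast, ← Real.rpow_add hε]
    conv_rhs => rw [← Real.rpow_one ε]
    exact Real.rpow_le_rpow_of_exponent_ge hε hε1 (by norm_num)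
  have hl1 := lipP_nonneg hM (D := D) one_pos
  rw [source_sub hε]
  refine (norm_add_le _ _).trans ?_
  rw [norm_smul, Real.norm_of_nonneg (sq_nonneg ε), mul_add, add_mul]
  refine add_le_add ?_ (hP.trans ?_)
  · calc _ ≤ ε ^ 2 * ((∫ ξ in Ioi 0, M.β ξ * ξ ^ (5 / 2 : ℝ)) *
          (ε ^ (-1 / 2 : ℝ) * ‖V + V'‖ * ‖V - V'‖)) := by gcongr
      _ = (ε ^ 2 * ε ^ (-1 / 2 : ℝ)) * (‖V + V'‖ * (∫ ξ in Ioi 0, M.β ξ * ξ ^ (5 / 2 : ℝ)))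
          * ‖V - V'‖ := by ring
      _ ≤ _ := by gcongr
  · calc _ ≤ M.lipP 1 D * (ε * ‖V - V'‖) := by
          refine mul_le_mul (lipP_le hM hε hε1) ?_ (by positivity) hl1
          gcongr
          nlinarith
      _ = _ := by ring

/-- Since `P_ε[0] = 0`, this is the Lipschitz bound between `W₀` and `0`, without corrector (`D =
0`). -/
theorem norm_resE_le (hM : M.Admissible) (hb : M.BoundUpTo ρ) (hε : 0 < ε) (hε1 : ε ≤ 1)
    (hρ : ε * ‖M.W₀‖ ≤ ρ) : ‖M.resE ε‖ ≤ M.lipP 1 0 * ‖M.W₀‖ := by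
  have h := norm_opP_sub_le hM hb hε hε1 (D := 0) hρ (W' := 0) le_rfl
    (by rw [norm_zero]; exact norm_nonneg _)
    (fun η hη x => by simpa using abs_avg_W₀_le hM hη x)
    (fun η hη x => by
      rw [avg_zero, abs_zero, mul_zero, mul_zero, add_zero]
      exact (amp_pos hM).le)
  rw [opP_zero hM, sub_zero, sub_zero] at h
  exact h.trans (by gcongr; exact lipP_le hM hε hε1)

theorem source_zero : M.source ε 0 = M.resK ε + M.resE ε := by
  have hQ : M.opQ ε 0 = 0 := by
    rw [opQ, bochner, setIntegral_congr_fun measurableSet_Ioi (g := fun _ => (0 : L2)),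
      integral_zero]
    intro ξ hξ
    simp only
    have : M.integrandQ ε 0 ξ = fun _ => 0 := by
      funext x
      simp only [integrandQ, avg_zero]
      simp [avg]
    rw [this]
    exact toL2_eq_of_ae (Lp.coeFn_zero ℝ 2 volume).symm
  simp [source, opN, hQ]

end Medium

end Peridynamics

end

theorem mainTheorem2 (M : Peridynamics.Medium) (hM : M.Admissible)
    (ρ : ℝ) (hρ : 0 < ρ) (hbound : M.BoundUpTo ρ) :
    ∃ εs : ℝ, 0 < εs ∧ εs ≤ 1 ∧ ∃ D : ℝ, 0 < D ∧ ∀ ε : ℝ, 0 < ε → ε ≤ εs →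
      -- all integrals that enter the corrector map are genuine Bochner integrals
      (∀ V : Peridynamics.L2,
        Peridynamics.BochnerWellDefined (M.integrandB ε V) ∧
        Peridynamics.BochnerWellDefined (M.integrandM ε V) ∧
        Peridynamics.BochnerWellDefined (M.integrandQ ε V)) ∧
      Peridynamics.BochnerWellDefined (M.integrandP ε M.W₀) ∧
      (∀ V ∈ Peridynamics.evenBall D,
        Peridynamics.BochnerWellDefined (M.integrandP ε (M.W₀ + ε ^ 2 • V))) ∧
      -- the linear operator is invertible on even functions and the right hand side is even
      Set.BijOn (M.opL ε) Peridynamics.L2even Peridynamics.L2even ∧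
      (∀ V ∈ Peridynamics.evenBall D, M.source ε V ∈ Peridynamics.L2even) ∧
      -- unique fixed point in the ball
      ∃! V : Peridynamics.L2, V ∈ Peridynamics.evenBall D ∧ M.opF ε V = V := by
  open Peridynamics Peridynamics.Medium in
  obtain ⟨ε₀, hε₀, C, hC, hlow⟩ := exists_lower_bound hM
  obtain ⟨CK, hCK⟩ := exists_norm_resK_le hM
  have hCK0 : 0 ≤ CK := (norm_nonneg _).trans (hCK 1 one_pos)
  set CE : ℝ := M.lipP 1 0 * ‖M.W₀‖ with hCE
  have hCE0 : 0 ≤ CE := mul_nonneg (lipP_nonneg hM one_pos) (norm_nonneg _)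
  -- Twice the bound of `‖F_ε[0]‖`, so that a contraction with factor `1/2` maps the ball into
  -- itself; the `1` makes the radius positive.
  set D : ℝ := 2 * C * (CK + CE) + 1 with hD
  have hD0 : 0 < D := by positivity
  set K : ℝ := 2 * D * (∫ ξ in Set.Ioi 0, M.β ξ * ξ ^ (5 / 2 : ℝ)) + M.lipP 1 D with hK
  have hK0 : 0 ≤ K := by
    have := hM.β_fiveHalves_pos
    have := lipP_nonneg hM (D := D) one_pos
    positivity
  set N : ℝ := ‖M.W₀‖ + D with hN
  have hN0 : 0 < N := by positivity
  -- In turn: `ε ≤ 1`, the range of the lower bound, the Lipschitz constant `C ε K ≤ 1/2` of `F_ε`,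
  -- and strains within the range governed by `ρ`.
  refine ⟨min 1 (min ε₀ (min (1 / (2 * (C * K + 1))) (ρ / N))), by positivity,
    min_le_left _ _, D, hD0, fun ε hε hle => ?_⟩
  obtain ⟨hε1, hle⟩ := le_min_iff.1 hle
  obtain ⟨hεε₀, hle⟩ := le_min_iff.1 hle
  obtain ⟨hεK, hερ⟩ := le_min_iff.1 hle
  have hρN : ε * N ≤ ρ := (le_div_iff₀ hN0).1 hερ
  have hρW : ε * ‖M.W₀‖ ≤ ρ := le_trans (by gcongr; linarith) hρN
  have hCK' : C * (ε * K) ≤ 1 / 2 := by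
    rw [le_div_iff₀ (by positivity)] at hεK
    nlinarith
  have hbij : Set.BijOn (M.opL ε) L2even L2even := by
    refine bijOn_opL hM hε W₀_mem_L2even (c := 1 / C) (by positivity) fun V hV => ?_
    rw [one_div, ← div_eq_inv_mul, div_le_iff₀' hC]
    exact hlow ε hε hεε₀ V hV
  have hsrc : ∀ V ∈ evenBall D, M.source ε V ∈ L2even := fun V hV =>
    source_mem_L2even hM hbound hε hε1 hρN hV
  have hlip : ∀ V ∈ evenBall D, ∀ V' ∈ evenBall D,
      ‖M.opF ε V - M.opF ε V'‖ ≤ 1 / 2 * ‖V - V'‖ := fun V hV V' hV' => by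
    obtain ⟨m, e⟩ := opF_spec hbij (hsrc V hV)
    obtain ⟨m', e'⟩ := opF_spec hbij (hsrc V' hV')
    have h := hlow ε hε hεε₀ (M.opF ε V - M.opF ε V')
      (mem_evenSubmodule.1 (sub_mem (mem_evenSubmodule.2 m) (mem_evenSubmodule.2 m')))
    rw [opL_sub hM hε, e, e'] at h
    calc _ ≤ C * (ε * K * ‖V - V'‖) := h.trans (by
            gcongr; exact norm_source_sub_le hM hbound hε hε1 hρN hV.2 hV'.2)
      _ = C * (ε * K) * ‖V - V'‖ := by ring
      _ ≤ _ := by gcongr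
  have hzero : (0 : L2) ∈ evenBall D :=
    ⟨mem_evenSubmodule.1 (Submodule.zero_mem _), by rw [norm_zero]; exact hD0.le⟩
  have hF0 : ‖M.opF ε 0‖ ≤ C * (CK + CE) := by
    obtain ⟨m, e⟩ := opF_spec hbij (hsrc 0 hzero)
    have h := hlow ε hε hεε₀ _ m
    rw [e, source_zero] at h
    refine h.trans ?_
    gcongr
    exact (norm_add_le _ _).trans
      (add_le_add (hCK ε hε) (norm_resE_le hM hbound hε hε1 hρW))
  refine ⟨fun V => ⟨bochnerWellDefined_integrandB hM hε V, bochnerWellDefined_integrandM hM hε V,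
    bochnerWellDefined_integrandQ hM hε V⟩,
    bochnerWellDefined_integrandP hM hbound hε hε1 hρW,
    fun V hV => bochnerWellDefined_integrandP hM hbound hε hε1
      (le_trans (by gcongr; exact norm_W₀_add_le hε hε1 hV.2) hρN),
    hbij, hsrc, existsUnique_fixedPoint_evenBall hD0.le (fun V hV => ?_) hlip⟩
  refine ⟨(opF_spec hbij (hsrc V hV)).1, ?_⟩
  -- `‖F V‖ ≤ ‖F 0‖ + ‖V‖ / 2`, and each summand is at most `D / 2`.
  have h := hlip V hV 0 hzero
  rw [sub_zero] at h
  have h2 := norm_le_norm_add_norm_sub' (M.opF ε V) (M.opF ε 0)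
  have h3 := hV.2
  linarith
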